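/- **Setting.** Let $\Omega$ be the unit ball of $\mathbb R^n$, $T>0$. All functions are $\mathbb R^n$-valued on $[0,T]\times\overline\Omega$. For real $a\ge 0$ let $\|\cdot\|_a$ be the Hölder norm on $\overline\Omega$: $\|u\|_0=\sup|u|$ and, if $k<a\le k+1$ with an integer $k\ge0$, $$\|u\|_a=\sup_{x,y\in\overline\Omega}\ \sum_{|\alpha|=k}\frac{|\partial^\alpha u(x)-\partial^\alpha u(y)|}{|x-y|^{a-k}}+\sup_{x\in\overline\Omega}|u(x)| .$$ Let $|||u|||_{a,k}=\sup_{0\le t\le T}\big(\|u(t,\cdot)\|_a+\|D_tu(t,\cdot)\|_a+\dots+\|D_t^ku(t,\cdot)\|_a\big)$ and $|||u|||_a=|||u|||_{a,0}$. The spaces $C^2([0,T],C^\infty(\overline\Omega))$ and $C([0,T],C^\infty(\overline\Omega))$ carry the topologies given by the norms $|||\cdot|||_{a,2}$, respectively $|||\cdot|||_a$, $a\ge0$. "Smooth" means: in $C^\infty([0,T],C^\infty(\overline\Omega))$. Put $\mu=5$, $\lambda=[n/2]+3$, $d=[n/2]+7$. Let $U\subset C^2([0,T],C^\infty(\overline\Omega))$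 be open and contain every $u$ with $|||u|||_{\mu,2}\le1$. Let $\Phi:U\to C([0,T],C^\infty(\overline\Omega))$ be continuous, map smooth functions to smooth functions, and be twice differentiable at smooth points in smooth directions: for smooth $u\in U$ and smooth $v,v_1,v_2$ the directional derivatives $$\Phi'(u)v=\tfrac{d}{dr}\Phi(u+rv)\big|_{r=0},\qquad \Phi''(u)(v_1,v_2)=\tfrac{d}{dr}\Phi'(u+rv_1)v_2\big|_{r=0}$$ exist in $C([0,T],C^\infty(\overline\Omega))$ and are linear in $v$, respectively in $v_1$ and in $v_2$. $(\mathcal H_1)$ For every $a\ge0$ there is $C_a$ such that for all smooth $u,v_1,v_2$ with $|||u|||_{\mu,2}\le1$ $$|||\Phi''(u)(v_1,v_2)|||_a\le C_a\big(|||v_1|||_{a+\mu,2}|||v_2|||_{\mu,2}+|||v_1|||_{\mu,2}|||v_2|||_{a+\mu,2}\big)+C_a|||u|||_{a+\mu,2}|||v_1|||_{\mu,2}|||v_2|||_{\mu,2}.$$ $(\mathcal H_2)$ There are constants $C_a$, $a\ge 0$, such that for every smooth $u$ with $|||u|||_{\mu,2}\le1$ there is a linear map $\psi(u)$ from $C^\infty([0,T],C^\infty(\overline\Omega))$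 to itself with $\Phi'(u)\psi(u)g=g$ and $$|||\psi(u)g|||_{a,2}\le C_a\big(|||g|||_{a+\lambda}+|||g|||_\lambda|||u|||_{a+d,2}\big)$$ for all smooth $g$ and all $a\ge0$. **Proposition 18.1.** Suppose that $\Phi$ satisfies $(\mathcal H_1)$, $(\mathcal H_2)$ and $\Phi(0)=0$. Let $\alpha>\mu$, $\alpha>d$, $\alpha>\lambda+2\mu$, $\alpha\notin\mathbb N$. Then there are $\delta>0$ and constants $C_a$, $0\le a<\alpha$, such that for every smooth $f$ with $|||f|||_{\alpha+\lambda}\le\delta^2$ the equation $\Phi(u)=f$ has a solution $u=u(f)\in U\subset C^2([0,T],C^\infty(\overline\Omega))$ with $$|||u(f)|||_{a,2}\le C_a\,|||f|||_{\alpha+\lambda}\qquad\text{for all }0\le a<\alpha .$$ -/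

import Mathlib

open Set Filter Topology
open scoped ContDiff

noncomputable section

namespace NashMoser

/-- Euclidean space `ℝⁿ`. -/
abbrev Rn (n : ℕ) : Type := EuclideanSpace ℝ (Fin n)

/-- `Ω̄`, the closed unit ball of `ℝⁿ`. -/
abbrev OmegaBar (n : ℕ) : Set (Rn n) := Metric.closedBall 0 1

/-- All functions `[0,T] × Ω̄ → ℝⁿ`. The spaces `C^k([0,T], C^∞(Ω̄))` are singled out by
the predicate `IsCkCinf` below. -/
abbrev Fun (n : ℕ) (T : ℝ) : Type := Icc (0 : ℝ) T × OmegaBar n → Rn n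

open Classical in
/-- Extension by zero of a function on `[0,T] × Ω̄`. It serves only to apply Mathlib's
derivatives *within* `[0,T]` and *within* `Ω̄`, which do not see the values outside. -/
def extend {n : ℕ} {T : ℝ} (u : Fun n T) (t : ℝ) (x : Rn n) : Rn n :=
  if h : t ∈ Icc (0 : ℝ) T ∧ x ∈ OmegaBar n then u (⟨t, h.1⟩, ⟨x, h.2⟩) else 0

/-- `D_t^j u (t, x)`, one-sided at the end points of `[0,T]`. -/
def timeDeriv {n : ℕ} {T : ℝ} (j : ℕ) (u : Fun n T) (t : ℝ) (x : Rn n) : Rn n :=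
  iteratedDerivWithin j (fun s => extend u s x) (Icc (0 : ℝ) T) t

/-- `u ∈ C^k([0,T], C^∞(Ω̄))`, for `k ∈ {0, 1, …, ∞}`: the time derivatives `D_t^j u`, `j ≤ k`,
exist, are smooth up to the boundary in space, and all their space derivatives are jointly
continuous on the compact set `[0,T] × Ω̄`. For `k = ∞` (written `⊤`) this is
`C^∞([0,T], C^∞(Ω̄))`. -/
def IsCkCinf {n : ℕ} {T : ℝ} (k : ℕ∞) (u : Fun n T) : Prop :=
  (∀ x ∈ OmegaBar n, ContDiffOn ℝ k (fun s => extend u s x) (Icc (0 : ℝ) T)) ∧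
  ∀ j : ℕ, (j : ℕ∞) ≤ k →
    (∀ t ∈ Icc (0 : ℝ) T, ContDiffOn ℝ ∞ (timeDeriv j u t) (OmegaBar n)) ∧
    ∀ i : ℕ, ContinuousOn
      (fun p : ℝ × Rn n => iteratedFDerivWithin ℝ i (timeDeriv j u p.1) (OmegaBar n) p.2)
      (Icc (0 : ℝ) T ×ˢ OmegaBar n)

/-- The partial derivative `∂_{i₁} ⋯ ∂_{i_k} f (x)` within `Ω̄`. -/
def partialDeriv {n k : ℕ} (i : Fin k → Fin n) (f : Rn n → Rn n) (x : Rn n) : Rn n :=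
  iteratedFDerivWithin ℝ k f (OmegaBar n) x (fun l => EuclideanSpace.single (i l) 1)

open Classical in
/-- `∑_{|α| = k} |∂^α f(x) - ∂^α f(y)|`. The multi-indices `α` of order `k` correspond to the
nondecreasing sequences `i₁ ≤ ⋯ ≤ i_k` in `{1, …, n}`. -/
def derivDiff {n : ℕ} (k : ℕ) (f : Rn n → Rn n) (x y : Rn n) : ℝ :=
  ∑ i : Fin k → Fin n with Monotone i, ‖partialDeriv i f x - partialDeriv i f y‖

/-- The Hölder norm `‖f‖_{a,∞}` on `Ω̄`, for real `a ≥ 0`: the sup norm if `a = 0`, and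
`sup_{x,y} ∑_{|α| = k} |∂^α f(x) - ∂^α f(y)| / |x - y|^{a - k} + sup |f|` if `k < a ≤ k + 1`,
where `k = ⌈a⌉ - 1`. It is applied to functions that are smooth on `Ω̄` only, for which the
suprema are finite. -/
def holderNorm {n : ℕ} (a : ℝ) (f : Rn n → Rn n) : ℝ :=
  if a = 0 then ⨆ x : OmegaBar n, ‖f x‖
  else
    (⨆ p : OmegaBar n × OmegaBar n,
      derivDiff (⌈a⌉₊ - 1) f p.1 p.2 /
        ‖(p.1 : Rn n) - (p.2 : Rn n)‖ ^ (a - ((⌈a⌉₊ - 1 : ℕ) : ℝ))) +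
    ⨆ x : OmegaBar n, ‖f x‖

/-- `|||u|||_{a,k} = sup_{0 ≤ t ≤ T} (‖u(t,·)‖_a + ‖D_t u(t,·)‖_a + ⋯ + ‖D_t^k u(t,·)‖_a)`;
`|||u|||_a` is the case `k = 0`. -/
def tnorm {n : ℕ} {T : ℝ} (a : ℝ) (k : ℕ) (u : Fun n T) : ℝ :=
  ⨆ t : Icc (0 : ℝ) T, ∑ j ∈ Finset.range (k + 1), holderNorm a (timeDeriv j u t)

/-- `U` is an open subset of the Fréchet space `C²([0,T], C^∞(Ω̄))`, whose topology is given by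
the (increasing, up to constants) norms `|||·|||_{a,2}`. -/
def IsOpenC2 {n : ℕ} {T : ℝ} (U : Set (Fun n T)) : Prop :=
  (∀ u ∈ U, IsCkCinf 2 u) ∧
  ∀ u ∈ U, ∃ a : ℝ, 0 ≤ a ∧ ∃ ε : ℝ, 0 < ε ∧
    ∀ v : Fun n T, IsCkCinf 2 v → tnorm a 2 (v - u) < ε → v ∈ U

/-- `Φ` is a continuous map from `U ⊆ C²([0,T], C^∞(Ω̄))` to `C([0,T], C^∞(Ω̄))`, the latter
with the topology of the norms `|||·|||_a`. -/
def ContinuousC2C0 {n : ℕ} {T : ℝ} (Φ : Fun n T → Fun n T) (U : Set (Fun n T)) : Prop :=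
  (∀ u ∈ U, IsCkCinf 0 (Φ u)) ∧
  ∀ u ∈ U, ∀ a : ℝ, 0 ≤ a → ∀ ε : ℝ, 0 < ε →
    ∃ b : ℝ, 0 ≤ b ∧ ∃ η : ℝ, 0 < η ∧
      ∀ v ∈ U, tnorm b 2 (v - u) < η → tnorm a 0 (Φ v - Φ u) < ε

/-- `w = d/dr F(u + r v) |_{r = 0}`, the limit being taken in `C([0,T], C^∞(Ω̄))`. -/
def HasDirDeriv {n : ℕ} {T : ℝ} (F : Fun n T → Fun n T) (u v w : Fun n T) : Prop :=
  ∀ a : ℝ, 0 ≤ a →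
    Tendsto (fun r : ℝ => tnorm a 0 (r⁻¹ • (F (u + r • v) - F u) - w)) (𝓝[≠] 0) (𝓝 0)

/-- `Φ` is twice differentiable at the smooth points of `U`, with (directional) derivatives
`Φ'(u) v = Φ₁ u v` and `Φ''(u)(v₁, v₂) = Φ₂ u v₁ v₂` that are linear in each direction.
Only the values at smooth `u ∈ U` and smooth directions matter. -/
structure IsTwiceDifferentiable {n : ℕ} {T : ℝ} (Φ : Fun n T → Fun n T) (U : Set (Fun n T))
    (Φ₁ : Fun n T → Fun n T →ₗ[ℝ] Fun n T)
    (Φ₂ : Fun n T → Fun n T →ₗ[ℝ] Fun n T →ₗ[ℝ] Fun n T) : Prop where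
  mem_first : ∀ u ∈ U, IsCkCinf ⊤ u → ∀ v, IsCkCinf ⊤ v → IsCkCinf 0 (Φ₁ u v)
  mem_second : ∀ u ∈ U, IsCkCinf ⊤ u → ∀ v₁ v₂, IsCkCinf ⊤ v₁ → IsCkCinf ⊤ v₂ →
    IsCkCinf 0 (Φ₂ u v₁ v₂)
  first : ∀ u ∈ U, IsCkCinf ⊤ u → ∀ v, IsCkCinf ⊤ v → HasDirDeriv Φ u v (Φ₁ u v)
  second : ∀ u ∈ U, IsCkCinf ⊤ u → ∀ v₁ v₂, IsCkCinf ⊤ v₁ → IsCkCinf ⊤ v₂ →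
    HasDirDeriv (fun w => Φ₁ w v₂) u v₁ (Φ₂ u v₁ v₂)

/-- The tame bound for the second derivative `Φ₂`, for smooth `u` with `|||u|||_{μ,2} ≤ 1`. -/
def TameSecondDerivative {n : ℕ} {T : ℝ} (μ : ℝ)
    (Φ₂ : Fun n T → Fun n T →ₗ[ℝ] Fun n T →ₗ[ℝ] Fun n T) : Prop :=
  ∀ a : ℝ, 0 ≤ a → ∃ C : ℝ, ∀ u v₁ v₂ : Fun n T,
    IsCkCinf ⊤ u → IsCkCinf ⊤ v₁ → IsCkCinf ⊤ v₂ → tnorm μ 2 u ≤ 1 →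
    tnorm a 0 (Φ₂ u v₁ v₂) ≤
      C * (tnorm (a + μ) 2 v₁ * tnorm μ 2 v₂ + tnorm μ 2 v₁ * tnorm (a + μ) 2 v₂) +
      C * (tnorm (a + μ) 2 u * tnorm μ 2 v₁ * tnorm μ 2 v₂)

/-- For smooth `u` with `|||u|||_{μ,2} ≤ 1` the linearization `Φ₁ u` has a linear right inverse
`ψ` on `C^∞([0,T], C^∞(Ω̄))` that obeys a tame estimate, with constants `C a` that do not
depend on `u`. -/
def TameRightInverse {n : ℕ} {T : ℝ} (μ lam d : ℝ)
    (Φ₁ : Fun n T → Fun n T →ₗ[ℝ] Fun n T) : Prop :=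
  ∃ C : ℝ → ℝ, ∀ u : Fun n T, IsCkCinf ⊤ u → tnorm μ 2 u ≤ 1 →
    ∃ ψ : Fun n T →ₗ[ℝ] Fun n T, ∀ g : Fun n T, IsCkCinf ⊤ g →
      IsCkCinf ⊤ (ψ g) ∧ Φ₁ u (ψ g) = g ∧
      ∀ a : ℝ, 0 ≤ a →
        tnorm a 2 (ψ g) ≤ C a * (tnorm (a + lam) 0 g + tnorm lam 0 g * tnorm (a + d) 2 u)

end NashMoser

end

/-! ### Weighted averages over the ball and their derivatives. -/

noncomputable section
namespace NashMoser
open MeasureTheory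

/-! Newton's method for `Φ(u) = f` fails directly because `ψ` loses `λ` derivatives of `g` and `d`
of the base point. The remedy is to interleave it with smoothing operators `S_k` at scale `2^{-k}`.
Step `k` inverts the linearization at `S_k u_k`: `w_k = ψ(S_k u_k) g_k` and `u_{k+1} = u_k + w_k`.
The `g_j` are fixed by `g_0 + ⋯ + g_k = S_k (f - E_k)`, where `E_k` is the sum of the earlier errors
`e_j = Φ(u_{j+1}) - Φ(u_j) - g_j`. Hence `Φ(u_{k+1}) - f = e_k + (E_k - S_k E_k) - (f - S_k f)`, and
it is enough to control the errors.

The claim carried along is that `w_k` has size `2^{k(m-α)}` in the norm of order `m`. Since `Φ'(S_k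
u_k) w_k = g_k`, the error `e_k` consists of a Taylor remainder and of the effect of replacing `u_k`
by `S_k u_k`. Both are quadratic by (H1); see `exists_tnorm_error_le`, which rests on the mean value
inequality `tnorm_sub_le_of_tendsto`. So `e_k` has size `2^{k(m+2μ-2α)}`, which is needed only for
`m = 0` and for one large `m = s` (`TameData.exists_error_le`). In the norm of order `s` the sum
`E_k` is dominated by its last term, and the differences `S_{k+1} - S_k` carry this bound to all
orders. Applying `ψ` costs `λ` derivatives, and `α > λ + 2μ` gives `m + λ + 2μ - 2α < m - α`. The
condition `α > d` keeps `u_k` bounded in the norm of order `d`, so that the base points `S_k u_k`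
cost only `2^{km}`; `α > μ` keeps the iterates in the unit ball. As the errors are quadratic in the
size of `f`, the induction closes for small `f` (`TameData.exists_forall_adm`).

These bounds alone give convergence only below order `α`. For a fixed smooth `f` the decay rate
improves itself from `α'` to `2α' - 2μ - λ`, and it grows beyond every bound when this is repeated
(`TameData.exists_rate_succ`, `TameData.summable_P_w`). So the series of the `w_k` converges in
every norm, and continuity of `Φ` yields the equation. The estimate for `a < α` comes from the
original rate, whose constants do not depend on `f`.

The smoothing operators combine averages of `v(x + s(z - x))` over `z ∈ Ω̄`. Convexity keeps these
points in `Ω̄`, so no extension operator is needed. The radii are `2^{i-k}`, and the coefficients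
annihilate more and more moments as `k` grows while their weighted sums stay bounded; one family
thus serves all orders. It acts in `x` alone and commutes with `D_t`. The estimates
`exists_holderNorm_smoothing_le` and `exists_holderNorm_sub_smoothing_le` go from real to integer
orders. The iteration uses integer orders only, apart from the norm of `f`; fractional orders are
recovered by `exists_holderNorm_le_interp`. -/

/-- Differentiation under the integral sign within a convex set. -/
theorem hasFDerivWithinAt_integral_of_convex {Z V W : Type*} [MeasurableSpace Z]
    {ν : Measure Z} [NormedAddCommGroup V] [NormedSpace ℝ V] [NormedAddCommGroup W]
    [NormedSpace ℝ W] [CompleteSpace W] {s : Set V} (hs : Convex ℝ s) {F : V → Z → W}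
    {F' : V → Z → V →L[ℝ] W} {bound : Z → ℝ} (hb : Integrable bound ν)
    (hF : ∀ x ∈ s, Integrable (F x) ν) {x₀ : V} (hx₀ : x₀ ∈ s)
    (hF' : AEStronglyMeasurable (F' x₀) ν)
    (h : ∀ᵐ z ∂ν, ∀ x ∈ s, HasFDerivWithinAt (fun y => F y z) (F' x z) s x ∧
      ‖F' x z‖ ≤ bound z) :
    HasFDerivWithinAt (fun x => ∫ z, F x z ∂ν) (∫ z, F' x₀ z ∂ν) s x₀ := by
  have hF'i : Integrable (F' x₀) ν :=
    hb.mono' hF' (h.mono fun z hz => (hz x₀ hx₀).2)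
  rw [hasFDerivWithinAt_iff_tendsto]
  have key : Tendsto (fun x => ∫ z, ‖x - x₀‖⁻¹ • (F x z - F x₀ z - F' x₀ z (x - x₀)) ∂ν)
      (𝓝[s] x₀) (𝓝 (∫ _, (0 : W) ∂ν)) := by
    refine tendsto_integral_filter_of_dominated_convergence (fun z => 2 * bound z) ?_ ?_
      (hb.const_mul 2) ?_
    · filter_upwards [self_mem_nhdsWithin] with x hx
      exact ((((hF x hx).sub (hF x₀ hx₀)).sub
        (hF'i.apply_continuousLinearMap _)).smul (‖x - x₀‖⁻¹)).aestronglyMeasurable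
    · filter_upwards [self_mem_nhdsWithin] with x hx
      filter_upwards [h] with z hz
      -- The mean value inequality on the convex set supplies the dominating function: the
      -- difference quotient minus `F' x₀ z` is at most twice the bound on the derivative.
      have h1 : ‖F x z - F x₀ z - F' x₀ z (x - x₀)‖ ≤ (2 * bound z) * ‖x - x₀‖ := by
        refine hs.norm_image_sub_le_of_norm_hasFDerivWithin_le' (f := fun y => F y z)
          (fun y hy => (hz y hy).1) (fun y hy => ?_) hx₀ hx
        calc _ ≤ ‖F' y z‖ + ‖F' x₀ z‖ := norm_sub_le _ _
          _ ≤ _ := by linarith [(hz y hy).2, (hz x₀ hx₀).2]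
      rw [norm_smul, norm_inv, norm_norm]
      rcases eq_or_ne x x₀ with rfl | hne
      · simp only [sub_self, norm_zero, inv_zero, zero_mul]
        have := (norm_nonneg _).trans (hz x hx).2
        positivity
      · have : 0 < ‖x - x₀‖ := norm_pos_iff.2 (sub_ne_zero.2 hne)
        rw [inv_mul_le_iff₀ this, mul_comm]
        exact h1
    · filter_upwards [h] with z hz
      have := hasFDerivWithinAt_iff_tendsto.1 (hz x₀ hx₀).1
      rw [tendsto_zero_iff_norm_tendsto_zero]
      simpa [norm_smul] using this
  rw [integral_zero, tendsto_zero_iff_norm_tendsto_zero] at key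
  refine key.congr' ?_
  filter_upwards [self_mem_nhdsWithin] with x hx
  have h1 := integral_sub ((hF x hx).sub (hF x₀ hx₀))
    (hF'i.apply_continuousLinearMap (x - x₀))
  have h2 := integral_sub (hF x hx) (hF x₀ hx₀)
  simp only [Pi.sub_apply] at h1
  rw [integral_smul, norm_smul, norm_inv, norm_norm, h1, h2,
    ContinuousLinearMap.integral_apply hF'i]

theorem mem_omegaBar_of_segment {n : ℕ} {x z : Rn n} {s : ℝ} (hs : s ∈ Icc (0 : ℝ) 1)
    (hx : x ∈ OmegaBar n) (hz : z ∈ OmegaBar n) : x + s • (z - x) ∈ OmegaBar n :=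
  (convex_closedBall (0 : Rn n) 1).add_smul_sub_mem hx hz hs

theorem uniqueDiffOn_omegaBar (n : ℕ) : UniqueDiffOn ℝ (OmegaBar n) :=
  uniqueDiffOn_convex (convex_closedBall _ _) (by
    rw [interior_closedBall _ one_ne_zero]; exact ⟨0, by simp⟩)

theorem isCompact_omegaBar (n : ℕ) : IsCompact (OmegaBar n) := isCompact_closedBall _ _

/-- Weighted average of `v` over the points `x + s (z - x)`, `z ∈ Ω̄`. -/
def avg {n : ℕ} {F : Type*} [NormedAddCommGroup F] [NormedSpace ℝ F] (φ : Rn n → ℝ) (s : ℝ)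
    (v : Rn n → F) (x : Rn n) : F :=
  ∫ z in OmegaBar n, φ z • v (x + s • (z - x))

section avg
variable {n : ℕ} {F : Type*} [NormedAddCommGroup F] [NormedSpace ℝ F]
  {φ : Rn n → ℝ} {s : ℝ} {v w : Rn n → F} {x : Rn n}

theorem continuousOn_avg_integrand (hφ : Continuous φ) (hs : s ∈ Icc (0 : ℝ) 1)
    (hv : ContinuousOn v (OmegaBar n)) (hx : x ∈ OmegaBar n) :
    ContinuousOn (fun z => φ z • v (x + s • (z - x))) (OmegaBar n) :=
  hφ.continuousOn.smul (hv.comp (by fun_prop) fun _ hz => mem_omegaBar_of_segment hs hx hz)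

theorem integrableOn_avg_integrand (hφ : Continuous φ) (hs : s ∈ Icc (0 : ℝ) 1)
    (hv : ContinuousOn v (OmegaBar n)) (hx : x ∈ OmegaBar n) :
    IntegrableOn (fun z => φ z • v (x + s • (z - x))) (OmegaBar n) :=
  (continuousOn_avg_integrand hφ hs hv hx).integrableOn_compact (isCompact_omegaBar n)

theorem avg_sub (hφ : Continuous φ) (hs : s ∈ Icc (0 : ℝ) 1)
    (hv : ContinuousOn v (OmegaBar n)) (hw : ContinuousOn w (OmegaBar n)) (hx : x ∈ OmegaBar n) :
    avg φ s (fun y => v y - w y) x = avg φ s v x - avg φ s w x := by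
  have h := integral_sub (integrableOn_avg_integrand hφ hs hv hx)
    (integrableOn_avg_integrand hφ hs hw hx)
  refine Eq.trans ?_ h
  simp only [avg, smul_sub (φ _)]

/-- Since `Ω̄` has diameter 2, the average sees `v` only within distance `2s` of `x`. This locality
later turns a Hölder bound into a power of `s`. -/
theorem norm_avg_le (hφ : Continuous φ) (hs : s ∈ Icc (0 : ℝ) 1) (hx : x ∈ OmegaBar n) {M : ℝ}
    (h : ∀ y ∈ OmegaBar n, ‖y - x‖ ≤ 2 * s → ‖v y‖ ≤ M) :
    ‖avg φ s v x‖ ≤ (∫ z in OmegaBar n, |φ z|) * M := by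
  rw [← integral_mul_const]
  refine norm_integral_le_of_norm_le ?_ ?_
  · exact ((hφ.abs.continuousOn).integrableOn_compact (isCompact_omegaBar n)).mul_const _
  · filter_upwards [ae_restrict_mem measurableSet_closedBall] with z hz
    rw [norm_smul, Real.norm_eq_abs]
    refine mul_le_mul_of_nonneg_left (h _ (mem_omegaBar_of_segment hs hx hz) ?_) (abs_nonneg _)
    rw [add_sub_cancel_left, norm_smul, Real.norm_of_nonneg hs.1, mul_comm]
    refine mul_le_mul_of_nonneg_right ?_ hs.1
    calc ‖z - x‖ ≤ ‖z‖ + ‖x‖ := norm_sub_le _ _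
      _ ≤ 2 := by
        have h1 := mem_closedBall_zero_iff.1 hz
        have h2 := mem_closedBall_zero_iff.1 hx
        linarith

variable [CompleteSpace F]

/-- The map `y ↦ y + s(z - y)` contracts towards `z` with linear part `1 - s`. Differentiation
therefore passes through the average at the price of this factor, and no derivative falls on `φ`. -/
theorem hasFDerivWithinAt_avg (hφ : Continuous φ) (hs : s ∈ Icc (0 : ℝ) 1)
    {v' : Rn n → Rn n →L[ℝ] F} (hv : ∀ y ∈ OmegaBar n, HasFDerivWithinAt v (v' y) (OmegaBar n) y)
    (hv' : ContinuousOn v' (OmegaBar n)) (hx : x ∈ OmegaBar n) :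
    HasFDerivWithinAt (avg φ s v) ((1 - s) • avg φ s v' x) (OmegaBar n) x := by
  obtain ⟨M, hM⟩ := (isCompact_omegaBar n).exists_bound_of_continuousOn hv'
  have hvc : ContinuousOn v (OmegaBar n) := fun y hy => (hv y hy).continuousWithinAt
  have := hasFDerivWithinAt_integral_of_convex (ν := volume.restrict (OmegaBar n))
    (convex_closedBall (0 : Rn n) 1) (F := fun x z => φ z • v (x + s • (z - x)))
    (F' := fun x z => (1 - s) • φ z • v' (x + s • (z - x)))
    (bound := fun z => |1 - s| * (|φ z| * M)) (x₀ := x)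
    ((((hφ.abs.continuousOn).integrableOn_compact (isCompact_omegaBar n)).mul_const _).const_mul _)
    (fun x hx => integrableOn_avg_integrand hφ hs hvc hx) hx
    ((integrableOn_avg_integrand hφ hs hv' hx).smul (1 - s)).aestronglyMeasurable ?_
  · rwa [integral_smul] at this
  · filter_upwards [ae_restrict_mem measurableSet_closedBall] with z hz y hy
    refine ⟨?_, ?_⟩
    · have h1 : HasFDerivWithinAt (fun y : Rn n => y + s • (z - y))
          ((1 - s) • ContinuousLinearMap.id ℝ (Rn n)) (OmegaBar n) y := by
        have := (hasFDerivWithinAt_id (𝕜 := ℝ) y (OmegaBar n)).add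
          (((hasFDerivWithinAt_id (𝕜 := ℝ) y (OmegaBar n)).const_sub z).const_smul s)
        refine this.congr_fderiv ?_
        ext1 u
        simp [sub_eq_add_neg, add_smul]
      have h2 := ((hv _ (mem_omegaBar_of_segment hs hy hz)).comp y h1
        fun y hy => mem_omegaBar_of_segment hs hy hz).const_smul (φ z)
      refine h2.congr_fderiv ?_
      ext1 u
      simp [smul_smul, mul_comm]
    · simp only [norm_smul, Real.norm_eq_abs]
      have := hM _ (mem_omegaBar_of_segment hs hy hz)
      gcongr

theorem hasFTaylorSeriesUpToOn_avg (hφ : Continuous φ) (hs : s ∈ Icc (0 : ℝ) 1)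
    (hv : ContDiffOn ℝ ∞ v (OmegaBar n)) :
    HasFTaylorSeriesUpToOn ∞ (avg φ s v)
      (fun x m => (1 - s) ^ m • avg φ s (fun y => iteratedFDerivWithin ℝ m v (OmegaBar n) y) x)
      (OmegaBar n) := by
  have hc : ∀ m : ℕ, ContinuousOn (iteratedFDerivWithin ℝ m v (OmegaBar n)) (OmegaBar n) :=
    fun m => hv.continuousOn_iteratedFDerivWithin (by exact_mod_cast le_top)
      (uniqueDiffOn_omegaBar n)
  have hT := hv.ftaylorSeriesWithin (uniqueDiffOn_omegaBar n)
  have hd : ∀ m : ℕ, ∀ x ∈ OmegaBar n, HasFDerivWithinAt (fun x => (1 - s) ^ m •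
      avg φ s (fun y => iteratedFDerivWithin ℝ m v (OmegaBar n) y) x)
      (((1 - s) ^ (m + 1) • avg φ s
        (fun y => iteratedFDerivWithin ℝ (m + 1) v (OmegaBar n) y) x).curryLeft)
      (OmegaBar n) x := by
    intro m x hx
    have h1 := hasFDerivWithinAt_avg (φ := φ) hφ hs
      (fun y hy => hT.fderivWithin m (by exact_mod_cast WithTop.coe_lt_top m) y hy)
      (v' := fun y => (iteratedFDerivWithin ℝ (m + 1) v (OmegaBar n) y).curryLeft)
      ((continuousMultilinearCurryLeftEquiv ℝ (fun _ : Fin (m + 1) => Rn n)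
        F).continuous.comp_continuousOn (hc (m + 1))) hx
    refine (h1.const_smul ((1 - s) ^ m)).congr_fderiv ?_
    rw [smul_smul, ← pow_succ]
    have hi := integrableOn_avg_integrand hφ hs (hc (m + 1)) hx
    have hi' := integrableOn_avg_integrand (φ := φ) (F := Rn n →L[ℝ] Rn n [×m]→L[ℝ] F)
      (v := fun y => (iteratedFDerivWithin ℝ (m + 1) v (OmegaBar n) y).curryLeft) hφ hs
      ((continuousMultilinearCurryLeftEquiv ℝ (fun _ : Fin (m + 1) => Rn n)
        F).continuous.comp_continuousOn (hc (m + 1))) hx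
    ext h u
    have e1 := ContinuousLinearMap.integral_apply hi' h
    have e2 := ContinuousMultilinearMap.integral_apply
      (hi'.apply_continuousLinearMap h) u
    have e3 := ContinuousMultilinearMap.integral_apply hi (Fin.cons h u)
    simp only [smul_apply, ContinuousMultilinearMap.curryLeft_apply, avg]
    congr 1
    refine Eq.trans ?_ e3.symm
    refine (congrArg (fun q => q u) e1).trans ?_
    exact e2
  refine ⟨fun x hx => ?_, fun m _ x hx => hd m x hx,
    fun m _ x hx => (hd m x hx).continuousWithinAt⟩
  rw [pow_zero, one_smul]
  exact ContinuousMultilinearMap.integral_apply (integrableOn_avg_integrand hφ hs (hc 0) hx) 0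

theorem contDiffOn_avg (hφ : Continuous φ) (hs : s ∈ Icc (0 : ℝ) 1)
    (hv : ContDiffOn ℝ ∞ v (OmegaBar n)) : ContDiffOn ℝ ∞ (avg φ s v) (OmegaBar n) :=
  (hasFTaylorSeriesUpToOn_avg hφ hs hv).contDiffOn 

theorem iteratedFDerivWithin_avg (hφ : Continuous φ) (hs : s ∈ Icc (0 : ℝ) 1)
    (hv : ContDiffOn ℝ ∞ v (OmegaBar n)) (m : ℕ) (hx : x ∈ OmegaBar n) :
    iteratedFDerivWithin ℝ m (avg φ s v) (OmegaBar n) x =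
      (1 - s) ^ m • avg φ s (iteratedFDerivWithin ℝ m v (OmegaBar n)) x :=
  ((hasFTaylorSeriesUpToOn_avg hφ hs hv).eq_iteratedFDerivWithin_of_uniqueDiffOn
    (by exact_mod_cast le_top) (uniqueDiffOn_omegaBar n) hx).symm

end avg
end NashMoser
end

/-! ### Integration by parts for averages. -/

noncomputable section
namespace NashMoser
open MeasureTheory

section parts
variable {n : ℕ} {F : Type*} [NormedAddCommGroup F] [NormedSpace ℝ F]
  {φ : Rn n → ℝ} {s : ℝ} {v : Rn n → F} {x : Rn n}

/-- Integration by parts for averages. -/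
theorem smul_avg_fderiv (hφ : ContDiff ℝ ∞ φ) (hsupp : tsupport φ ⊆ Metric.ball 0 1)
    (hs : s ∈ Ioc (0 : ℝ) 1) {v' : Rn n → Rn n →L[ℝ] F}
    (hv : ∀ y ∈ OmegaBar n, HasFDerivWithinAt v (v' y) (OmegaBar n) y)
    (hv' : ContinuousOn v' (OmegaBar n)) (hx : x ∈ OmegaBar n) (h : Rn n) :
    s • avg φ s (fun y => v' y h) x = -avg (fun z => fderiv ℝ φ z h) s v x := by
  have hs' : s ∈ Icc (0 : ℝ) 1 := ⟨hs.1.le, hs.2⟩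
  have hvc : ContinuousOn v (OmegaBar n) := fun y hy => (hv y hy).continuousWithinAt
  have hvh : ContinuousOn (fun y => v' y h) (OmegaBar n) := hv'.clm_apply continuousOn_const
  have hφ0 : ∀ z ∉ OmegaBar n, φ z = 0 := fun z hz => image_eq_zero_of_notMem_tsupport
    fun hz' => hz (Metric.ball_subset_closedBall (hsupp hz'))
  have hφ1 : ∀ z ∉ OmegaBar n, fderiv ℝ φ z h = 0 := fun z hz => by
    rw [fderiv_of_notMem_tsupport ℝ
      (fun hz' => hz (Metric.ball_subset_closedBall (hsupp hz')))]; rfl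
  have hφ' : Continuous fun z => fderiv ℝ φ z h :=
    (hφ.continuous_fderiv (by simp)).clm_apply continuous_const
  -- A weight vanishing off `Ω̄` makes the integral one over the whole space, so that integration by
  -- parts has no boundary term.
  have int : ∀ (χ : Rn n → ℝ) (w : Rn n → F), (∀ z ∉ OmegaBar n, χ z = 0) → Continuous χ →
      ContinuousOn w (OmegaBar n) → Integrable (fun z => χ z • w (x + s • (z - x))) := by
    intro χ w hχ hχc hw
    refine (integrableOn_iff_integrable_of_support_subset ?_).1
      (integrableOn_avg_integrand hχc hs' hw hx)
    intro z hz
    by_contra hz'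
    exact hz (by simp [hχ z hz'])
  have key := integral_bilinear_hasFDerivAt_right_eq_neg_left_of_integrable
    (μ := (volume : Measure (Rn n))) (f := φ) (f' := fderiv ℝ φ)
    (g := fun z => v (x + s • (z - x))) (g' := fun z => s • v' (x + s • (z - x))) (v := h)
    (B := ContinuousLinearMap.lsmul ℝ ℝ) (int _ _ hφ1 hφ' hvc)
    (by
      have := (int _ _ hφ0 hφ.continuous hvh).smul s
      refine this.congr (ae_of_all _ fun z => ?_)
      simp [smul_smul])
    (int _ _ hφ0 hφ.continuous hvc)
    (fun z _ => (hφ.differentiable (by simp) z).hasFDerivAt)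
    -- For `z` in the support of `φ` and `s > 0` the point `x + s(z - x)` is interior even when `x`
    -- is on the sphere, so the derivative within `Ω̄` is a full derivative there.
    (fun z hz => by
      have hz1 := hsupp hz
      have hy : x + s • (z - x) ∈ Metric.ball (0 : Rn n) 1 := by
        rw [mem_ball_zero_iff] at hz1 ⊢
        have hx1 := mem_closedBall_zero_iff.1 hx
        have : x + s • (z - x) = (1 - s) • x + s • z := by module
        rw [this]
        calc _ ≤ ‖(1 - s) • x‖ + ‖s • z‖ := norm_add_le _ _
          _ = (1 - s) * ‖x‖ + s * ‖z‖ := by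
            rw [norm_smul, norm_smul, Real.norm_of_nonneg hs.1.le,
              Real.norm_of_nonneg (by linarith [hs.2])]
          _ < 1 := by nlinarith [hs.1, hs.2, norm_nonneg x, norm_nonneg z]
      have h1 := (hv _ (Metric.ball_subset_closedBall hy)).hasFDerivAt
        (Filter.mem_of_superset (Metric.isOpen_ball.mem_nhds hy) Metric.ball_subset_closedBall)
      have h2 : HasFDerivAt (fun y : Rn n => x + s • (y - x))
          (s • ContinuousLinearMap.id ℝ (Rn n)) z :=
        (((hasFDerivAt_id (𝕜 := ℝ) z).sub_const x).const_smul s).const_add x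
      refine (h1.comp z h2).congr_fderiv ?_
      ext1 u
      simp)
  simp only [ContinuousLinearMap.lsmul_apply, smul_apply] at key
  rw [avg, avg, setIntegral_eq_integral_of_forall_compl_eq_zero
    (fun z hz => by rw [hφ0 z hz, zero_smul]),
    setIntegral_eq_integral_of_forall_compl_eq_zero
    (fun z hz => by rw [hφ1 z hz, zero_smul]), ← key, ← integral_smul]
  congr 1
  ext1 z
  rw [smul_comm]

theorem norm_clm_le_sum {G : Type*} [NormedAddCommGroup G] [NormedSpace ℝ G]
    (L : Rn n →L[ℝ] G) : ‖L‖ ≤ ∑ l, ‖L (EuclideanSpace.single l 1)‖ := by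
  refine L.opNorm_le_bound (Finset.sum_nonneg fun _ _ => norm_nonneg _) fun y => ?_
  have hy : y = ∑ l, y l • EuclideanSpace.single l (1 : ℝ) := by
    ext i
    simp [Finset.sum_apply, Pi.single_apply]
  conv_lhs => rw [hy]
  rw [map_sum, Finset.sum_mul]
  refine (norm_sum_le _ _).trans (Finset.sum_le_sum fun l _ => ?_)
  rw [map_smul, norm_smul, mul_comm]
  exact mul_le_mul_of_nonneg_left (PiLp.norm_apply_le y l) (norm_nonneg _)

theorem continuousOn_iteratedFDerivWithin_omegaBar (hv : ContDiffOn ℝ ∞ v (OmegaBar n)) (m : ℕ) :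
    ContinuousOn (iteratedFDerivWithin ℝ m v (OmegaBar n)) (OmegaBar n) :=
  hv.continuousOn_iteratedFDerivWithin (by exact_mod_cast le_top) (uniqueDiffOn_omegaBar n)

theorem hasFDerivWithinAt_iteratedFDerivWithin (hv : ContDiffOn ℝ ∞ v (OmegaBar n)) (m : ℕ)
    (hx : x ∈ OmegaBar n) :
    HasFDerivWithinAt (iteratedFDerivWithin ℝ m v (OmegaBar n))
      (iteratedFDerivWithin ℝ (m + 1) v (OmegaBar n) x).curryLeft (OmegaBar n) x :=
  (hv.ftaylorSeriesWithin (uniqueDiffOn_omegaBar n)).fderivWithin m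
    (by exact_mod_cast WithTop.coe_lt_top m) x hx

/-- One derivative moves from `v` to `φ` at the price of `s⁻¹`. As constants have zero derivative,
any `c` may be subtracted first; the value of the derivative at `x` is the choice that exploits
Hölder continuity. -/
theorem norm_avg_iteratedFDerivWithin_succ_le [CompleteSpace F] (hφ : ContDiff ℝ ∞ φ)
    (hsupp : tsupport φ ⊆ Metric.ball 0 1) (hs : s ∈ Ioc (0 : ℝ) 1)
    (hv : ContDiffOn ℝ ∞ v (OmegaBar n)) (hx : x ∈ OmegaBar n) (m : ℕ)
    (c : Rn n [×m]→L[ℝ] F) :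
    ‖avg φ s (iteratedFDerivWithin ℝ (m + 1) v (OmegaBar n)) x‖ ≤
      s⁻¹ * ∑ l : Fin n, ‖avg (fun z => fderiv ℝ φ z (EuclideanSpace.single l 1)) s
        (fun y => iteratedFDerivWithin ℝ m v (OmegaBar n) y - c) x‖ := by
  have hs' : s ∈ Icc (0 : ℝ) 1 := ⟨hs.1.le, hs.2⟩
  have hc := continuousOn_iteratedFDerivWithin_omegaBar hv (m + 1)
  have hc' : ContinuousOn (fun y => (iteratedFDerivWithin ℝ (m + 1) v (OmegaBar n) y).curryLeft)
      (OmegaBar n) := (continuousMultilinearCurryLeftEquiv ℝ (fun _ : Fin (m + 1) => Rn n)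
        F).continuous.comp_continuousOn hc
  have h0 : ‖avg φ s (iteratedFDerivWithin ℝ (m + 1) v (OmegaBar n)) x‖ =
      ‖(avg φ s (iteratedFDerivWithin ℝ (m + 1) v (OmegaBar n)) x).curryLeft‖ :=
    ((continuousMultilinearCurryLeftEquiv ℝ (fun _ : Fin (m + 1) => Rn n)
        F).norm_map _).symm
  rw [h0]
  refine (norm_clm_le_sum _).trans ?_
  rw [Finset.mul_sum]
  refine Finset.sum_le_sum fun l _ => ?_
  set h : Rn n := EuclideanSpace.single l 1
  have e : (avg φ s (iteratedFDerivWithin ℝ (m + 1) v (OmegaBar n)) x).curryLeft h =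
      avg φ s (fun y => (iteratedFDerivWithin ℝ (m + 1) v (OmegaBar n) y).curryLeft h) x := by
    ext u
    have e2 := ContinuousMultilinearMap.integral_apply
      (integrableOn_avg_integrand hφ.continuous hs'
        (hc'.clm_apply (continuousOn_const (c := h))) hx) u
    have e3 := ContinuousMultilinearMap.integral_apply
      (integrableOn_avg_integrand hφ.continuous hs' hc hx) (Fin.cons h u)
    exact e3.trans e2.symm
  have e4 := smul_avg_fderiv hφ hsupp hs
    (v := fun y => iteratedFDerivWithin ℝ m v (OmegaBar n) y - c)
    (fun y hy => (hasFDerivWithinAt_iteratedFDerivWithin hv m hy).sub_const c) hc' hx h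
  rw [e, ← norm_neg (avg (fun z => fderiv ℝ φ z h) s _ x), ← e4, norm_smul, Real.norm_of_nonneg hs.1.le,
    inv_mul_cancel_left₀ hs.1.ne']

theorem tsupport_fderiv_apply_subset_ball (hsupp : tsupport φ ⊆ Metric.ball 0 1) (h : Rn n) :
    tsupport (fun z => fderiv ℝ φ z h) ⊆ Metric.ball 0 1 :=
  (tsupport_fderiv_apply_subset ℝ h).trans hsupp

/-- Averages of derivatives gain powers of `s⁻¹`. -/
theorem exists_norm_avg_iteratedFDerivWithin_le (F : Type*) [NormedAddCommGroup F]
    [NormedSpace ℝ F] [CompleteSpace F] (κ m : ℕ) (φ : Rn n → ℝ) (hφ : ContDiff ℝ ∞ φ)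
    (hsupp : tsupport φ ⊆ Metric.ball 0 1) :
    ∃ C : ℝ, 0 ≤ C ∧ ∀ (s : ℝ) (x : Rn n) (v : Rn n → F) (c : Rn n [×κ]→L[ℝ] F) (M : ℝ),
      s ∈ Ioc (0 : ℝ) 1 → x ∈ OmegaBar n → ContDiffOn ℝ ∞ v (OmegaBar n) →
      (∀ y ∈ OmegaBar n, ‖y - x‖ ≤ 2 * s →
        ‖iteratedFDerivWithin ℝ κ v (OmegaBar n) y - c‖ ≤ M) →
      ‖avg φ s (iteratedFDerivWithin ℝ (κ + m + 1) v (OmegaBar n)) x‖ ≤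
        C * (s⁻¹ ^ (m + 1) * M) := by
  induction m generalizing φ with
  | zero =>
    refine ⟨∑ l : Fin n, ∫ z in OmegaBar n, |fderiv ℝ φ z (EuclideanSpace.single l 1)|,
      Finset.sum_nonneg fun l _ => integral_nonneg fun _ => abs_nonneg _, ?_⟩
    intro s x v c M hs hx hv hM
    refine (norm_avg_iteratedFDerivWithin_succ_le hφ hsupp hs hv hx κ c).trans ?_
    have : ∀ l : Fin n, _ := fun l => norm_avg_le
      (φ := fun z => fderiv ℝ φ z (EuclideanSpace.single l 1))
      ((hφ.continuous_fderiv (by simp)).clm_apply continuous_const) ⟨hs.1.le, hs.2⟩ hx hM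
    refine (mul_le_mul_of_nonneg_left (Finset.sum_le_sum fun l _ => this l)
      (inv_nonneg.2 hs.1.le)).trans (le_of_eq ?_)
    rw [← Finset.sum_mul]
    ring
  | succ m ih =>
    -- Every integration by parts replaces `φ` by a partial derivative of `φ`, whence the induction
    -- over all weights. The constant `c` enters only at the last one; the others take `0`.
    have ih' := fun l : Fin n => ih (fun z => fderiv ℝ φ z (EuclideanSpace.single l 1))
      ((hφ.fderiv_right (m := ∞) (by simp)).clm_apply contDiff_const)
      (tsupport_fderiv_apply_subset_ball hsupp _)
    choose C hC0 hC using ih'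
    refine ⟨∑ l, C l, Finset.sum_nonneg fun l _ => hC0 l, ?_⟩
    intro s x v c M hs hx hv hM
    refine (norm_avg_iteratedFDerivWithin_succ_le hφ hsupp hs hv hx (κ + m + 1) 0).trans ?_
    simp only [sub_zero]
    refine (mul_le_mul_of_nonneg_left (Finset.sum_le_sum fun l _ => hC l s x v c M hs hx hv hM)
      (inv_nonneg.2 hs.1.le)).trans (le_of_eq ?_)
    rw [← Finset.sum_mul]
    ring

end parts

/-! ### Taylor's formula with a Hölder remainder. -/

/-- Taylor expansion with a Hölder remainder. -/
theorem norm_sub_taylor_le_of_holder {F : Type*} [NormedAddCommGroup F] [NormedSpace ℝ F]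
    {M σ : ℝ} (hM : 0 ≤ M) (hσ : 0 < σ) (p : ℕ) (h : ℕ → ℝ → F)
    (hd : ∀ i < p, ∀ s ∈ Icc (0 : ℝ) 1, HasDerivWithinAt (h i) (h (i + 1) s) (Icc 0 1) s)
    (hp : ∀ s ∈ Icc (0 : ℝ) 1, ‖h p s - h p 0‖ ≤ M * s ^ σ) :
    ∀ s ∈ Icc (0 : ℝ) 1,
      ‖h 0 s - ∑ i ∈ Finset.range (p + 1), (s ^ i / (i.factorial : ℝ)) • h i 0‖ ≤
        M * s ^ (p + σ) := by
  induction p generalizing h with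
  | zero => intro s hs; simpa using hp s hs
  | succ p ih =>
    intro s hs
    have ih' := ih (fun i => h (i + 1)) (fun i hi => hd (i + 1) (by omega)) hp
    have hder : ∀ r ∈ Icc (0 : ℝ) s, HasDerivWithinAt
        (fun r => h 0 r - ∑ i ∈ Finset.range (p + 1 + 1), (r ^ i / (i.factorial : ℝ)) • h i 0)
        (h 1 r - ∑ i ∈ Finset.range (p + 1), (r ^ i / (i.factorial : ℝ)) • h (i + 1) 0)
        (Icc 0 s) r := by
      intro r hr
      refine ((hd 0 (by omega) r ⟨hr.1, hr.2.trans hs.2⟩).mono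
        (Icc_subset_Icc_right hs.2)).sub ?_
      have e : (fun r : ℝ => ∑ i ∈ Finset.range (p + 1 + 1), (r ^ i / (i.factorial : ℝ)) • h i 0)
          = fun r => ∑ i ∈ Finset.range (p + 1),
            (r ^ (i + 1) / ((i + 1).factorial : ℝ)) • h (i + 1) 0 + h 0 0 := by
        ext1 r
        rw [Finset.sum_range_succ']
        simp
      rw [e]
      refine HasDerivWithinAt.add_const _ (HasDerivWithinAt.fun_sum fun i _ => ?_)
      refine HasDerivWithinAt.smul_const ?_ _
      have h1 := ((hasDerivAt_pow (i + 1) r).div_const ((i + 1).factorial : ℝ)).hasDerivWithinAt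
        (s := Icc 0 s)
      refine h1.congr_deriv ?_
      have : ((i + 1 : ℕ) : ℝ) ≠ 0 := by positivity
      rw [Nat.factorial_succ, Nat.cast_mul, Nat.add_sub_cancel, mul_div_mul_left _ _ this]
    -- The derivative of the remainder of `h 0` is the remainder of `h 1`. Bounding it by its
    -- largest value on `[0, s]` and multiplying by `s` gives the right power; the factor that exact
    -- integration would gain is not needed.
    have hbound := norm_image_sub_le_of_norm_deriv_le_segment' hder (C := M * s ^ (p + σ))
      (fun r hr => (ih' r ⟨hr.1, hr.2.le.trans hs.2⟩).trans (by
        have := hr.1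
        have := hr.2.le
        gcongr)) s ⟨hs.1, le_rfl⟩
    have e0 : ∑ i ∈ Finset.range (p + 1 + 1), ((0 : ℝ) ^ i / (i.factorial : ℝ)) • h i 0 = h 0 0 := by
      rw [Finset.sum_range_succ']
      simp
    rw [e0, sub_self, sub_zero, sub_zero] at hbound
    refine hbound.trans (le_of_eq ?_)
    rcases hs.1.eq_or_lt with rfl | hs0
    · rw [Real.zero_rpow (by positivity), Real.zero_rpow (by positivity)]; simp
    · rw [mul_assoc, ← Real.rpow_add_one hs0.ne']
      push_cast
      ring_nf

/-! ### Coefficients that annihilate moments. -/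

/-- Coefficients of `∏_{1 ≤ j ≤ k} (X - 2^j) / (1 - 2^j)`. -/
def coef : ℕ → ℕ → ℝ
  | 0, 0 => 1
  | 0, _ + 1 => 0
  | k + 1, 0 => (1 - 2 ^ (k + 1))⁻¹ * (-2 ^ (k + 1) * coef k 0)
  | k + 1, i + 1 => (1 - 2 ^ (k + 1))⁻¹ * (coef k i - 2 ^ (k + 1) * coef k (i + 1))

theorem coef_eq_zero {k i : ℕ} (h : k < i) : coef k i = 0 := by
  induction k generalizing i with
  | zero => cases i with
    | zero => omega
    | succ i => rfl
  | succ k ih => cases i with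
    | zero => omega
    | succ i => rw [coef, ih (by omega), ih (by omega)]; simp

theorem sum_coef_mul_pow_succ (k : ℕ) (y : ℝ) :
    ∑ i ∈ Finset.range (k + 2), coef (k + 1) i * y ^ i =
      (1 - 2 ^ (k + 1))⁻¹ * (y - 2 ^ (k + 1)) * ∑ i ∈ Finset.range (k + 1), coef k i * y ^ i := by
  have h1 : ∑ i ∈ Finset.range (k + 1), coef k (i + 1) * y ^ (i + 1) =
      ∑ i ∈ Finset.range (k + 1), coef k i * y ^ i - coef k 0 := by
    have := Finset.sum_range_succ' (fun i => coef k i * y ^ i) (k + 1)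
    rw [Finset.sum_range_succ, coef_eq_zero (Nat.lt_succ_self k)] at this
    simp at this
    linarith
  rw [Finset.sum_range_succ']
  simp only [coef]
  have h2 : ∀ i : ℕ, (1 - 2 ^ (k + 1) : ℝ)⁻¹ * (coef k i - 2 ^ (k + 1) * coef k (i + 1)) *
      y ^ (i + 1) = (1 - 2 ^ (k + 1))⁻¹ * (y * (coef k i * y ^ i) -
        2 ^ (k + 1) * (coef k (i + 1) * y ^ (i + 1))) := fun i => by ring
  simp only [h2]
  rw [← Finset.mul_sum, Finset.sum_sub_distrib, ← Finset.mul_sum, ← Finset.mul_sum, h1]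
  ring

theorem one_sub_two_pow_succ_ne_zero (k : ℕ) : (1 - 2 ^ (k + 1) : ℝ) ≠ 0 := by
  have : (1 : ℝ) < 2 ^ (k + 1) := one_lt_pow₀ (by norm_num) (by omega)
  linarith

theorem sum_coef (k : ℕ) : ∑ i ∈ Finset.range (k + 1), coef k i = 1 := by
  induction k with
  | zero => simp [coef]
  | succ k ih =>
    have := sum_coef_mul_pow_succ k 1
    simp only [one_pow, mul_one] at this
    rw [this, ih, inv_mul_cancel₀ (one_sub_two_pow_succ_ne_zero k), one_mul]

/-- The sum is the value at `2^j` of the polynomial with coefficients `coef k`, and `2^j` is one of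
its roots. -/
theorem sum_coef_mul_two_pow_pow {k j : ℕ} (hj : 1 ≤ j) (hjk : j ≤ k) :
    ∑ i ∈ Finset.range (k + 1), coef k i * (2 ^ j) ^ i = 0 := by
  induction k with
  | zero => omega
  | succ k ih =>
    rw [sum_coef_mul_pow_succ]
    rcases hjk.eq_or_lt with rfl | h
    · simp
    · rw [ih (by omega), mul_zero]

/-- Passing from `k` to `k + 1` multiplies the sum by at most `(y + 2^(k+1)) / (2^(k+1) - 1) ≤ 1 +
(y + 1) 2^{-k}`, and the product of these factors converges. Uniformity in `k` is what allows the
number of vanishing moments to grow with the scale. -/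
theorem exists_sum_abs_coef_le (y : ℝ) (hy : 0 ≤ y) :
    ∃ C : ℝ, 0 ≤ C ∧ ∀ k, ∑ i ∈ Finset.range (k + 1), |coef k i| * y ^ i ≤ C := by
  refine ⟨Real.exp (2 * (y + 1)), (Real.exp_pos _).le, fun k => ?_⟩
  -- The exponent `2(y + 1)(1 - 2^{-k})` is the partial sum of `(y + 1) 2^{-j}` over `j < k`, so
  -- each step of the induction uses up one term.
  suffices h : ∑ i ∈ Finset.range (k + 1), |coef k i| * y ^ i ≤
      Real.exp (2 * (y + 1) * (1 - 2⁻¹ ^ k)) by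
    refine h.trans (Real.exp_le_exp.2 ?_)
    have : (0 : ℝ) ≤ 2⁻¹ ^ k := by positivity
    nlinarith
  induction k with
  | zero => simp [coef]
  | succ k ih =>
    have h2 : (1 : ℝ) ≤ 2 ^ k := one_le_pow₀ (by norm_num)
    have hq : (0 : ℝ) < 2 ^ (k + 1) - 1 := by rw [pow_succ]; linarith
    have hqa : |(1 - 2 ^ (k + 1) : ℝ)⁻¹| = (2 ^ (k + 1) - 1)⁻¹ := by
      rw [abs_inv, abs_sub_comm, abs_of_pos hq]
    have step : ∑ i ∈ Finset.range (k + 2), |coef (k + 1) i| * y ^ i ≤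
        (2 ^ (k + 1) - 1)⁻¹ * (y + 2 ^ (k + 1)) *
          ∑ i ∈ Finset.range (k + 1), |coef k i| * y ^ i := by
      have h1 : ∑ i ∈ Finset.range (k + 1), |coef k (i + 1)| * y ^ (i + 1) =
          ∑ i ∈ Finset.range (k + 1), |coef k i| * y ^ i - |coef k 0| := by
        have := Finset.sum_range_succ' (fun i => |coef k i| * y ^ i) (k + 1)
        rw [Finset.sum_range_succ, coef_eq_zero (Nat.lt_succ_self k)] at this
        simp at this
        linarith
      rw [Finset.sum_range_succ']
      have h3 : ∀ i : ℕ, |coef (k + 1) (i + 1)| * y ^ (i + 1) ≤ (2 ^ (k + 1) - 1)⁻¹ *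
          (y * (|coef k i| * y ^ i) + 2 ^ (k + 1) * (|coef k (i + 1)| * y ^ (i + 1))) := by
        intro i
        rw [coef, abs_mul, hqa]
        have : |coef k i - 2 ^ (k + 1) * coef k (i + 1)| ≤
            |coef k i| + 2 ^ (k + 1) * |coef k (i + 1)| := by
          refine (abs_sub _ _).trans (le_of_eq ?_)
          rw [abs_mul, abs_of_pos (by positivity : (0 : ℝ) < 2 ^ (k + 1))]
        calc _ ≤ (2 ^ (k + 1) - 1)⁻¹ * (|coef k i| + 2 ^ (k + 1) * |coef k (i + 1)|)
              * y ^ (i + 1) := by gcongr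
          _ = _ := by ring
      refine (add_le_add_left (Finset.sum_le_sum fun i _ => h3 i) _).trans (le_of_eq ?_)
      rw [← Finset.mul_sum, Finset.sum_add_distrib, ← Finset.mul_sum, ← Finset.mul_sum, h1,
        coef, abs_mul, hqa, abs_mul, abs_neg, abs_of_pos (by positivity : (0 : ℝ) < 2 ^ (k + 1))]
      ring
    refine step.trans ?_
    have e1 : (2 * (y + 1) * (1 - 2⁻¹ ^ (k + 1))) =
        (y + 1) * 2⁻¹ ^ k + 2 * (y + 1) * (1 - 2⁻¹ ^ k) := by rw [pow_succ]; ring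
    rw [e1, Real.exp_add]
    refine mul_le_mul ?_ ih (by positivity) (Real.exp_pos _).le
    refine le_trans ?_ (Real.add_one_le_exp _)
    rw [inv_mul_le_iff₀ hq, inv_pow]
    have h4 : (2 : ℝ) ^ k * (2 ^ k)⁻¹ = 1 := mul_inv_cancel₀ (by positivity)
    have h5 : (2 ^ k : ℝ)⁻¹ ≤ 1 := inv_le_one_of_one_le₀ h2
    rw [pow_succ]
    nlinarith

end NashMoser
end

/-! ### Smoothing operators of unlimited order on the ball. -/

noncomputable section
namespace NashMoser
open MeasureTheory

/-- Only total mass one and support inside the open ball are asked of the weight. The cancellation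
of moments comes from the coefficients, not from the weight. -/
theorem exists_bump (n : ℕ) : ∃ φ : Rn n → ℝ, ContDiff ℝ ∞ φ ∧
    tsupport φ ⊆ Metric.ball 0 1 ∧ ∫ z in OmegaBar n, φ z = 1 := by
  let f : ContDiffBump (0 : Rn n) := ⟨1 / 4, 1 / 2, by norm_num, by norm_num⟩
  have ht : tsupport (f.normed volume) ⊆ Metric.ball 0 1 := by
    rw [f.tsupport_normed_eq]
    exact Metric.closedBall_subset_ball (by norm_num)
  refine ⟨f.normed volume, f.contDiff_normed, ht, ?_⟩
  rw [setIntegral_eq_integral_of_forall_compl_eq_zero, f.integral_normed]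
  exact fun z hz => image_eq_zero_of_notMem_tsupport
    fun hz' => hz (Metric.ball_subset_closedBall (ht hz'))

/-- A mollifier on the unit ball. -/
def bump (n : ℕ) : Rn n → ℝ := (exists_bump n).choose

theorem contDiff_bump (n : ℕ) : ContDiff ℝ ∞ (bump n) := (exists_bump n).choose_spec.1

theorem tsupport_bump (n : ℕ) : tsupport (bump n) ⊆ Metric.ball 0 1 :=
  (exists_bump n).choose_spec.2.1

theorem integral_bump (n : ℕ) : ∫ z in OmegaBar n, bump n z = 1 :=
  (exists_bump n).choose_spec.2.2

/-- The radii `2^{i-k}`. -/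
def radius (k i : ℕ) : ℝ := 2 ^ i / 2 ^ k

theorem radius_mem {k i : ℕ} (h : i ∈ Finset.range (k + 1)) : radius k i ∈ Ioc (0 : ℝ) 1 :=
  ⟨by unfold radius; positivity, div_le_one_of_le₀ (pow_le_pow_right₀ (by norm_num)
    (Nat.lt_succ_iff.1 (Finset.mem_range.1 h))) (by positivity)⟩

theorem radius_mem_Icc {k i : ℕ} (h : i ∈ Finset.range (k + 1)) :
    radius k i ∈ Icc (0 : ℝ) 1 := ⟨(radius_mem h).1.le, (radius_mem h).2⟩

theorem radius_rpow (k i : ℕ) (r : ℝ) :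
    radius k i ^ r = (2 : ℝ) ^ (-(k * r)) * ((2 : ℝ) ^ r) ^ i := by
  rw [radius, Real.div_rpow (by positivity) (by positivity), ← Real.rpow_natCast,
    ← Real.rpow_natCast, ← Real.rpow_mul (by norm_num), ← Real.rpow_mul (by norm_num),
    ← Real.rpow_natCast, ← Real.rpow_mul (by norm_num), Real.rpow_neg (by norm_num),
    mul_comm (i : ℝ), div_eq_inv_mul]

/-- For `b = 0` this is the polynomial of the coefficients at `2^l`, divided by `2^{kl}`. One more
factor `1 - r` splits `r^l` into `r^l - r^(l+1)`, which uses up one of the `k` available moments.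
The factor `(1 - r)^b` is the one that `b` derivatives of an average produce. -/
theorem sum_coef_mul_radius_pow {k b l : ℕ} (h : b + l ≤ k) :
    ∑ i ∈ Finset.range (k + 1), coef k i * ((1 - radius k i) ^ b * radius k i ^ l) =
      if l = 0 then 1 else 0 := by
  induction b generalizing l with
  | zero =>
    split_ifs with hl
    · simp [hl, sum_coef]
    · have := sum_coef_mul_two_pow_pow (Nat.one_le_iff_ne_zero.2 hl) (k := k) (by omega)
      rw [← zero_mul ((2 ^ k : ℝ) ^ l)⁻¹, ← this, Finset.sum_mul]
      refine Finset.sum_congr rfl fun i _ => ?_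
      rw [radius, pow_zero, one_mul, div_pow, pow_right_comm, div_eq_mul_inv, mul_assoc]
  | succ b ih =>
    have h1 := ih (l := l) (by omega)
    have h2 := ih (l := l + 1) (by omega)
    rw [if_neg (by omega)] at h2
    rw [← h1, ← sub_zero (∑ i ∈ Finset.range (k + 1), coef k i * ((1 - radius k i) ^ b *
      radius k i ^ l)), ← h2, ← Finset.sum_sub_distrib]
    refine Finset.sum_congr rfl fun i _ => ?_
    ring

/-- The smoothing operators at scale `2^{-k}`. -/
def smoothing {n : ℕ} {F : Type*} [NormedAddCommGroup F] [NormedSpace ℝ F] (k : ℕ)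
    (v : Rn n → F) (x : Rn n) : F :=
  ∑ i ∈ Finset.range (k + 1), coef k i • avg (bump n) (radius k i) v x

section smoothing
variable {n : ℕ} {F : Type*} [NormedAddCommGroup F] [NormedSpace ℝ F]
  {v w : Rn n → F} {x : Rn n}

theorem smoothing_sub (k : ℕ) (hv : ContinuousOn v (OmegaBar n))
    (hw : ContinuousOn w (OmegaBar n)) (hx : x ∈ OmegaBar n) :
    smoothing k (fun y => v y - w y) x = smoothing k v x - smoothing k w x := by
  simp only [smoothing]
  rw [← Finset.sum_sub_distrib]
  refine Finset.sum_congr rfl fun i hi => ?_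
  rw [avg_sub (contDiff_bump n).continuous (radius_mem_Icc hi) hv hw hx, smul_sub]

theorem contDiffOn_smoothing [CompleteSpace F] (k : ℕ) (hv : ContDiffOn ℝ ∞ v (OmegaBar n)) :
    ContDiffOn ℝ ∞ (smoothing k v) (OmegaBar n) :=
  ContDiffOn.sum fun i hi => (contDiffOn_avg (contDiff_bump n).continuous
    (radius_mem_Icc hi) hv).const_smul (coef k i)

theorem iteratedFDerivWithin_smoothing [CompleteSpace F] (k m : ℕ) (hv : ContDiffOn ℝ ∞ v (OmegaBar n))
    (hx : x ∈ OmegaBar n) :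
    iteratedFDerivWithin ℝ m (smoothing k v) (OmegaBar n) x =
      ∑ i ∈ Finset.range (k + 1), (coef k i * (1 - radius k i) ^ m) •
        avg (bump n) (radius k i) (iteratedFDerivWithin ℝ m v (OmegaBar n)) x := by
  have hm : ((m : ℕ∞) : WithTop ℕ∞) ≤ ∞ := by exact_mod_cast le_top
  have h0 : ∀ i ∈ Finset.range (k + 1), ContDiffOn ℝ m
      (fun y => coef k i • avg (bump n) (radius k i) v y) (OmegaBar n) := fun i hi =>
    ((contDiffOn_avg (contDiff_bump n).continuous
      (radius_mem_Icc hi) hv).const_smul (coef k i)).of_le hm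
  have h1 : iteratedFDerivWithin ℝ m (smoothing k v) (OmegaBar n) x =
      ∑ i ∈ Finset.range (k + 1), iteratedFDerivWithin ℝ m
        (fun y => coef k i • avg (bump n) (radius k i) v y) (OmegaBar n) x :=
    iteratedFDerivWithin_fun_sum_apply (uniqueDiffOn_omegaBar n) hx fun i hi => h0 i hi x hx
  rw [h1]
  refine Finset.sum_congr rfl fun i hi => ?_
  have h2 := iteratedFDerivWithin_const_smul_apply (𝕜 := ℝ) (a := coef k i) (i := m)
    (((contDiffOn_avg (contDiff_bump n).continuous
      (radius_mem_Icc hi) hv).of_le hm) x hx) (uniqueDiffOn_omegaBar n) hx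
  refine Eq.trans h2 ?_
  rw [iteratedFDerivWithin_avg (contDiff_bump n).continuous (radius_mem_Icc hi) hv m hx, smul_smul]

theorem norm_iteratedFDerivWithin_smoothing_le [CompleteSpace F] (k b : ℕ) (hv : ContDiffOn ℝ ∞ v (OmegaBar n))
    (hx : x ∈ OmegaBar n) {M : ℝ} (hM : ∀ i ∈ Finset.range (k + 1),
      ‖avg (bump n) (radius k i) (iteratedFDerivWithin ℝ b v (OmegaBar n)) x‖ ≤ M) :
    ‖iteratedFDerivWithin ℝ b (smoothing k v) (OmegaBar n) x‖ ≤
      (∑ i ∈ Finset.range (k + 1), |coef k i| * 1 ^ i) * M := by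
  rw [iteratedFDerivWithin_smoothing k b hv hx, Finset.sum_mul]
  refine (norm_sum_le _ _).trans (Finset.sum_le_sum fun i hi => ?_)
  rw [norm_smul, norm_mul, Real.norm_eq_abs, one_pow, norm_pow]
  have h1 := radius_mem hi
  have h2 : ‖1 - radius k i‖ ^ b ≤ 1 := pow_le_one₀ (norm_nonneg _) (by
    rw [Real.norm_of_nonneg (by linarith [h1.2])]; linarith [h1.1])
  have h3 := hM i hi
  gcongr

/-- The smoothing estimate with a Hölder seminorm on the right-hand side. -/
theorem exists_norm_smoothing_le_of_holder (n : ℕ) (F : Type*) [NormedAddCommGroup F]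
    [NormedSpace ℝ F] [CompleteSpace F] (κ : ℕ) (σ : ℝ) (hσ : σ ∈ Ioc (0 : ℝ) 1) (b : ℕ)
    (hb : κ + 1 ≤ b) :
    ∃ C : ℝ, 0 ≤ C ∧ ∀ (k : ℕ) (v : Rn n → F) (H : ℝ), 0 ≤ H → ContDiffOn ℝ ∞ v (OmegaBar n) →
      (∀ x ∈ OmegaBar n, ∀ y ∈ OmegaBar n, ‖iteratedFDerivWithin ℝ κ v (OmegaBar n) y -
        iteratedFDerivWithin ℝ κ v (OmegaBar n) x‖ ≤ H * ‖y - x‖ ^ σ) →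
      ∀ x ∈ OmegaBar n, ‖iteratedFDerivWithin ℝ b (smoothing k v) (OmegaBar n) x‖ ≤
        C * ((2 : ℝ) ^ (k * (b - (κ + σ))) * H) := by
  obtain ⟨m, rfl⟩ := Nat.exists_eq_add_of_le hb
  obtain ⟨C₁, hC₁, h1⟩ := exists_norm_avg_iteratedFDerivWithin_le F κ m (bump n)
    (contDiff_bump n) (tsupport_bump n)
  obtain ⟨C₂, hC₂, h2⟩ := exists_sum_abs_coef_le 1 zero_le_one
  refine ⟨C₂ * (C₁ * 2 ^ σ), by positivity, fun k v H hH hv hvH x hx => ?_⟩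
  have e : κ + 1 + m = κ + m + 1 := by ring
  have key : ∀ i ∈ Finset.range (k + 1),
      ‖avg (bump n) (radius k i) (iteratedFDerivWithin ℝ (κ + 1 + m) v (OmegaBar n)) x‖ ≤
        C₁ * 2 ^ σ * ((2 : ℝ) ^ (k * (((κ + 1 + m : ℕ) : ℝ) - (κ + σ))) * H) := by
    intro i hi
    have hr := radius_mem hi
    rw [e]
    have h3 := h1 (radius k i) x v (iteratedFDerivWithin ℝ κ v (OmegaBar n) x)
      (H * (2 * radius k i) ^ σ) hr hx hv (fun y hy hyx => (hvH x hx y hy).trans (by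
        have := hσ.1.le
        gcongr))
    refine h3.trans ?_
    have h4 : (radius k i)⁻¹ ^ (m + 1) * (radius k i) ^ σ ≤
        (2 : ℝ) ^ (k * (((κ + m + 1 : ℕ) : ℝ) - (κ + σ))) := by
      rw [inv_pow, ← Real.rpow_natCast, ← Real.rpow_neg hr.1.le, ← Real.rpow_add hr.1,
        radius_rpow]
      -- The exponent `σ - (m + 1)` is not positive, so the smallest radius `2^{-k}` is the worst
      -- one.
      have h5 : ((2 : ℝ) ^ (-((m + 1 : ℕ) : ℝ) + σ)) ^ i ≤ 1 := by
        refine pow_le_one₀ (by positivity) (Real.rpow_le_one_of_one_le_of_nonpos (by norm_num) ?_)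
        push_cast
        have := hσ.2
        have : (0 : ℝ) ≤ m := by positivity
        linarith
      refine (mul_le_of_le_one_right (by positivity) h5).trans (le_of_eq ?_)
      congr 1
      push_cast
      ring
    rw [Real.mul_rpow (by norm_num) hr.1.le]
    calc _ = C₁ * 2 ^ σ * (((radius k i)⁻¹ ^ (m + 1) * (radius k i) ^ σ) * H) := by ring
      _ ≤ _ := by gcongr
  refine (norm_iteratedFDerivWithin_smoothing_le k _ hv hx key).trans ?_
  rw [mul_assoc C₂]
  have := h2 k
  have : 0 ≤ C₁ * 2 ^ σ * ((2 : ℝ) ^ (k * (((κ + 1 + m : ℕ) : ℝ) - (κ + σ))) * H) := by positivity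
  refine (mul_le_mul_of_nonneg_right (h2 k) this).trans (le_of_eq ?_)
  ring

/-- The counterpart for order zero of the Hölder estimate: all `b` derivatives are moved onto the
weight and nothing is subtracted from `v`. -/
theorem exists_norm_smoothing_le_of_bound (n : ℕ) (F : Type*) [NormedAddCommGroup F]
    [NormedSpace ℝ F] [CompleteSpace F] (b : ℕ) :
    ∃ C : ℝ, 0 ≤ C ∧ ∀ (k : ℕ) (v : Rn n → F) (M : ℝ), 0 ≤ M → ContDiffOn ℝ ∞ v (OmegaBar n) →
      (∀ x ∈ OmegaBar n, ‖v x‖ ≤ M) →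
      ∀ x ∈ OmegaBar n, ‖iteratedFDerivWithin ℝ b (smoothing k v) (OmegaBar n) x‖ ≤
        C * ((2 : ℝ) ^ ((k : ℝ) * b) * M) := by
  obtain ⟨C₂, hC₂, h2⟩ := exists_sum_abs_coef_le 1 zero_le_one
  have main : ∃ C₁ : ℝ, 0 ≤ C₁ ∧ ∀ (k : ℕ) (v : Rn n → F) (M : ℝ), 0 ≤ M →
      ContDiffOn ℝ ∞ v (OmegaBar n) → (∀ x ∈ OmegaBar n, ‖v x‖ ≤ M) →
      ∀ x ∈ OmegaBar n, ∀ i ∈ Finset.range (k + 1),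
      ‖avg (bump n) (radius k i) (iteratedFDerivWithin ℝ b v (OmegaBar n)) x‖ ≤
        C₁ * ((2 : ℝ) ^ ((k : ℝ) * b) * M) := by
    cases b with
    | zero =>
      refine ⟨∫ z in OmegaBar n, |bump n z|, integral_nonneg fun _ => abs_nonneg _,
        fun k v M hM hv hvM x hx i hi => ?_⟩
      refine (norm_avg_le (contDiff_bump n).continuous (radius_mem_Icc hi) hx
        (fun y hy _ => ?_)).trans ?_ (b := (∫ z in OmegaBar n, |bump n z|) * M)
      · rw [norm_iteratedFDerivWithin_zero]; exact hvM y hy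
      · simp
    | succ m =>
      obtain ⟨C₁, hC₁, h1⟩ := exists_norm_avg_iteratedFDerivWithin_le F 0 m (bump n)
        (contDiff_bump n) (tsupport_bump n)
      refine ⟨C₁, hC₁, fun k v M hM hv hvM x hx i hi => ?_⟩
      have hr := radius_mem hi
      have h3 := h1 (radius k i) x v 0 M hr hx hv (fun y hy _ => by
        rw [sub_zero, norm_iteratedFDerivWithin_zero]; exact hvM y hy)
      rw [zero_add] at h3
      refine h3.trans ?_
      have h4 : (radius k i)⁻¹ ^ (m + 1) ≤ (2 : ℝ) ^ ((k : ℝ) * ((m + 1 : ℕ) : ℝ)) := by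
        rw [inv_pow, ← Real.rpow_natCast, ← Real.rpow_neg hr.1.le, radius_rpow]
        have h5 : ((2 : ℝ) ^ (-((m + 1 : ℕ) : ℝ))) ^ i ≤ 1 :=
          pow_le_one₀ (by positivity) (Real.rpow_le_one_of_one_le_of_nonpos (by norm_num)
            (neg_nonpos.2 (Nat.cast_nonneg _)))
        refine (mul_le_of_le_one_right (by positivity) h5).trans (le_of_eq ?_)
        congr 1
        ring
      gcongr
  obtain ⟨C₁, hC₁, h1⟩ := main
  refine ⟨C₂ * C₁, by positivity, fun k v M hM hv hvM x hx => ?_⟩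
  refine (norm_iteratedFDerivWithin_smoothing_le k _ hv hx (h1 k v M hM hv hvM x hx)).trans ?_
  rw [mul_assoc C₂]
  exact mul_le_mul_of_nonneg_right (h2 k) (by positivity)

/-- The direction `(w, …, w, e₁, …, e_b)`. -/
def consRepeat {E : Type*} {b : ℕ} (w : E) (e : Fin b → E) : (i : ℕ) → Fin (b + i) → E
  | 0 => e
  | i + 1 => Fin.cons w (consRepeat w e i)

theorem hasDerivWithinAt_iteratedFDerivWithin_line (hv : ContDiffOn ℝ ∞ v (OmegaBar n))
    {z : Rn n} (hx : x ∈ OmegaBar n) (hz : z ∈ OmegaBar n) (m : ℕ) (u : Fin m → Rn n) {s : ℝ}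
    (hs : s ∈ Icc (0 : ℝ) 1) :
    HasDerivWithinAt (fun s : ℝ => iteratedFDerivWithin ℝ m v (OmegaBar n) (x + s • (z - x)) u)
      (iteratedFDerivWithin ℝ (m + 1) v (OmegaBar n) (x + s • (z - x))
        (Fin.cons (z - x) u : Fin (m + 1) → Rn n)) (Icc 0 1) s := by
  have h1 : HasDerivWithinAt (fun s : ℝ => x + s • (z - x)) (z - x) (Icc 0 1) s := by
    have := (((hasDerivAt_id s).smul_const (z - x)).const_add x).hasDerivWithinAt (s := Icc 0 1)
    simpa using this
  have h2 := (hasFDerivWithinAt_iteratedFDerivWithin hv m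
    (mem_omegaBar_of_segment hs hx hz)).comp_hasDerivWithinAt s h1
    (fun r hr => mem_omegaBar_of_segment hr hx hz)
  have h3 := ((ContinuousMultilinearMap.apply ℝ (fun _ : Fin m => Rn n) F u).hasFDerivAt).comp_hasDerivWithinAt s h2
  exact h3

/-- The approximation estimate with a Hölder seminorm on the right-hand side. -/
theorem exists_norm_sub_smoothing_le_of_holder (n : ℕ) (F : Type*) [NormedAddCommGroup F]
    [NormedSpace ℝ F] [CompleteSpace F] (κ : ℕ) (σ : ℝ) (hσ : σ ∈ Ioc (0 : ℝ) 1) (b : ℕ)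
    (hb : b ≤ κ) :
    ∃ C : ℝ, 0 ≤ C ∧ ∀ (k : ℕ) (v : Rn n → F) (H : ℝ), κ ≤ k → 0 ≤ H →
      ContDiffOn ℝ ∞ v (OmegaBar n) →
      (∀ x ∈ OmegaBar n, ∀ y ∈ OmegaBar n, ‖iteratedFDerivWithin ℝ κ v (OmegaBar n) y -
        iteratedFDerivWithin ℝ κ v (OmegaBar n) x‖ ≤ H * ‖y - x‖ ^ σ) →
      ∀ x ∈ OmegaBar n, ‖iteratedFDerivWithin ℝ b v (OmegaBar n) x -
        iteratedFDerivWithin ℝ b (smoothing k v) (OmegaBar n) x‖ ≤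
        C * ((2 : ℝ) ^ (k * (b - (κ + σ))) * H) := by
  obtain ⟨p, rfl⟩ := Nat.exists_eq_add_of_le hb
  -- A Taylor remainder at radius `r_i` has size `r_i^(p+σ) = 2^{-k(p+σ)} y^i` with `y = 2^(p+σ)`,
  -- and the sum of `|coef k i| y^i` is bounded uniformly in `k`.
  obtain ⟨C₂, hC₂, h2⟩ := exists_sum_abs_coef_le (2 ^ ((p : ℝ) + σ)) (by positivity)
  set A := ∫ z in OmegaBar n, |bump n z| with hA
  have hA0 : 0 ≤ A := integral_nonneg fun _ => abs_nonneg _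
  refine ⟨A * (C₂ * (2 ^ σ * 2 ^ p)), by positivity, fun k v H hk hH hv hvH x hx => ?_⟩
  have hcont := continuousOn_iteratedFDerivWithin_omegaBar hv b
  have hφ := (contDiff_bump n).continuous
  -- Since the weight has integral one, the approximation error is the weighted mean over `z` of `B
  -- z`, and it can be estimated for each `z` separately.
  set B : Rn n → Rn n [×b]→L[ℝ] F := fun z => iteratedFDerivWithin ℝ b v (OmegaBar n) x -
    ∑ i ∈ Finset.range (k + 1), (coef k i * (1 - radius k i) ^ b) •
      iteratedFDerivWithin ℝ b v (OmegaBar n) (x + radius k i • (z - x)) with hB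
  have int1 : Integrable (fun z => bump n z • iteratedFDerivWithin ℝ b v (OmegaBar n) x)
      (volume.restrict (OmegaBar n)) :=
    (hφ.smul continuous_const).continuousOn.integrableOn_compact (isCompact_omegaBar n)
  have int2 : ∀ i ∈ Finset.range (k + 1), Integrable
      (fun z => (coef k i * (1 - radius k i) ^ b) • bump n z •
        iteratedFDerivWithin ℝ b v (OmegaBar n) (x + radius k i • (z - x)))
      (volume.restrict (OmegaBar n)) := fun i hi =>
    (integrableOn_avg_integrand hφ (radius_mem_Icc hi) hcont hx).smul
      (coef k i * (1 - radius k i) ^ b)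
  have e1 : iteratedFDerivWithin ℝ b v (OmegaBar n) x -
      iteratedFDerivWithin ℝ b (smoothing k v) (OmegaBar n) x =
      ∫ z in OmegaBar n, bump n z • B z := by
    have h1 := integral_sub int1 (integrable_finsetSum _ int2)
    rw [integral_smul_const, integral_bump, one_smul, integral_finsetSum _ int2] at h1
    simp only [integral_smul] at h1
    rw [iteratedFDerivWithin_smoothing k b hv hx]
    refine h1.symm.trans ?_
    congr 1
    ext1 z
    simp only [hB, smul_sub (bump n z), Finset.smul_sum]
    congr 1
    exact Finset.sum_congr rfl fun i _ => smul_comm _ _ _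
  set M := C₂ * (2 ^ σ * 2 ^ p) * ((2 : ℝ) ^ (k * (b - (((b + p : ℕ) : ℝ) + σ))) * H) with hM
  have hBM : ∀ z ∈ OmegaBar n, ‖B z‖ ≤ M := by
    intro z hz
    refine ContinuousMultilinearMap.opNorm_le_bound (by positivity) fun e => ?_
    have hzx : ‖z - x‖ ≤ 2 := by
      have h1 := mem_closedBall_zero_iff.1 hz
      have h2 := mem_closedBall_zero_iff.1 hx
      linarith [norm_sub_le z x]
    -- The successive derivatives of `s ↦ D^b v(x + s(z - x)) e` along the segment from `x` to `z`.
    set h : ℕ → ℝ → F := fun i s => iteratedFDerivWithin ℝ (b + i) v (OmegaBar n)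
      (x + s • (z - x)) (consRepeat (z - x) e i) with hh
    have hprod : ∀ i, ∏ l, ‖consRepeat (z - x) e i l‖ ≤ 2 ^ i * ∏ l, ‖e l‖ := by
      intro i
      induction i with
      | zero => simp [consRepeat]
      | succ i ih =>
        have : ∏ l, ‖consRepeat (z - x) e (i + 1) l‖ =
            ‖z - x‖ * ∏ l, ‖consRepeat (z - x) e i l‖ := Fin.prod_univ_succ _
        rw [this, pow_succ']
        calc _ ≤ 2 * (2 ^ i * ∏ l, ‖e l‖) := by gcongr
          _ = _ := by ring
    have hP : 0 ≤ ∏ l, ‖e l‖ := Finset.prod_nonneg fun _ _ => norm_nonneg _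
    have htay := norm_sub_taylor_le_of_holder
      (M := 2 ^ σ * 2 ^ p * H * ∏ l, ‖e l‖) (by positivity) hσ.1 p h
      (fun i _ s hs => hasDerivWithinAt_iteratedFDerivWithin_line hv hx hz _ _ hs)
      (fun s hs => by
        have h3 : h p s - h p 0 = (iteratedFDerivWithin ℝ (b + p) v (OmegaBar n)
          (x + s • (z - x)) - iteratedFDerivWithin ℝ (b + p) v (OmegaBar n) x)
            (consRepeat (z - x) e p) := by simp [hh]
        rw [h3]
        refine (ContinuousMultilinearMap.le_opNorm _ _).trans ?_
        have h4 := hvH x hx _ (mem_omegaBar_of_segment hs hx hz)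
        have h5 : ‖x + s • (z - x) - x‖ ^ σ ≤ 2 ^ σ * s ^ σ := by
          rw [add_sub_cancel_left, norm_smul, Real.norm_of_nonneg hs.1,
            ← Real.mul_rpow (by norm_num) hs.1, mul_comm]
          have := hσ.1.le
          have := hs.1
          gcongr
        calc _ ≤ (H * (2 ^ σ * s ^ σ)) * (2 ^ p * ∏ l, ‖e l‖) :=
              mul_le_mul (h4.trans (by gcongr)) (hprod p)
                (Finset.prod_nonneg fun _ _ => norm_nonneg _)
                (by have := hs.1; positivity)
          _ = _ := by ring)
    -- The combination of radii reproduces the constant term of the Taylor polynomial and kills the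
    -- rest. The required `b + l ≤ k` holds because `l ≤ p` and `b + p ≤ k`.
    have hmom : ∑ i ∈ Finset.range (k + 1), (coef k i * (1 - radius k i) ^ b) •
        ∑ l ∈ Finset.range (p + 1), (radius k i ^ l / (l.factorial : ℝ)) • h l 0 = h 0 0 := by
      simp only [Finset.smul_sum, smul_smul]
      rw [Finset.sum_comm]
      have : ∀ l ∈ Finset.range (p + 1), ∑ i ∈ Finset.range (k + 1),
          (coef k i * (1 - radius k i) ^ b * (radius k i ^ l / (l.factorial : ℝ))) • h l 0 =
          if l = 0 then h 0 0 else 0 := by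
        intro l hl
        have h6 := sum_coef_mul_radius_pow (k := k) (b := b) (l := l)
          (by have := Finset.mem_range.1 hl; omega)
        rw [← Finset.sum_smul]
        have h7 : ∑ i ∈ Finset.range (k + 1),
            coef k i * (1 - radius k i) ^ b * (radius k i ^ l / (l.factorial : ℝ)) =
            (if l = 0 then 1 else 0) * (l.factorial : ℝ)⁻¹ := by
          rw [← h6, Finset.sum_mul]
          exact Finset.sum_congr rfl fun i _ => by ring
        rw [h7]
        split_ifs with h0
        · subst h0; simp
        · simp
      rw [Finset.sum_congr rfl this]
      simp
    have hBe : B z e = -∑ i ∈ Finset.range (k + 1), (coef k i * (1 - radius k i) ^ b) •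
        (h 0 (radius k i) - ∑ l ∈ Finset.range (p + 1),
          (radius k i ^ l / (l.factorial : ℝ)) • h l 0) := by
      simp only [smul_sub]
      rw [Finset.sum_sub_distrib, hmom]
      simp [hB, hh, consRepeat]
    rw [hBe, norm_neg]
    refine (norm_sum_le _ _).trans ?_
    have hterm : ∀ i ∈ Finset.range (k + 1), ‖(coef k i * (1 - radius k i) ^ b) •
        (h 0 (radius k i) - ∑ l ∈ Finset.range (p + 1),
          (radius k i ^ l / (l.factorial : ℝ)) • h l 0)‖ ≤
        (|coef k i| * (2 ^ ((p : ℝ) + σ)) ^ i) * ((2 ^ σ * 2 ^ p * H * ∏ l, ‖e l‖) *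
          (2 : ℝ) ^ (-(k * ((p : ℝ) + σ)))) := by
      intro i hi
      have hr := radius_mem hi
      rw [norm_smul, norm_mul, Real.norm_eq_abs, norm_pow]
      have h2 : ‖1 - radius k i‖ ^ b ≤ 1 := pow_le_one₀ (norm_nonneg _) (by
        rw [Real.norm_of_nonneg (by linarith [hr.2])]; linarith [hr.1])
      have h8 := htay _ (radius_mem_Icc hi)
      rw [radius_rpow] at h8
      calc _ ≤ (|coef k i| * 1) * ((2 ^ σ * 2 ^ p * H * ∏ l, ‖e l‖) *
              (2 ^ (-(k * ((p : ℝ) + σ))) * (2 ^ ((p : ℝ) + σ)) ^ i)) := by gcongr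
        _ = _ := by ring
    refine (Finset.sum_le_sum hterm).trans ?_
    rw [← Finset.sum_mul]
    refine (mul_le_mul_of_nonneg_right (h2 k) (by positivity)).trans (le_of_eq ?_)
    have : (k : ℝ) * (b - (((b + p : ℕ) : ℝ) + σ)) = -(k * ((p : ℝ) + σ)) := by push_cast; ring
    rw [hM, this]
    ring
  rw [e1]
  calc _ ≤ ∫ z in OmegaBar n, |bump n z| * M := by
        refine norm_integral_le_of_norm_le ?_ ?_
        · exact ((hφ.abs.continuousOn).integrableOn_compact (isCompact_omegaBar n)).mul_const _
        · filter_upwards [ae_restrict_mem measurableSet_closedBall] with z hz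
          rw [norm_smul, Real.norm_eq_abs]
          exact mul_le_mul_of_nonneg_left (hBM z hz) (abs_nonneg _)
    _ = _ := by rw [integral_mul_const, hM]; ring

end smoothing
end NashMoser
end

/-! ### Symmetry of higher derivatives, and their differences. -/

noncomputable section
namespace NashMoser

section symmetry
variable {n : ℕ} {F : Type*} [NormedAddCommGroup F] [NormedSpace ℝ F] {v : Rn n → F} {x : Rn n}

theorem contDiffOn_iteratedFDerivWithin_omegaBar (hv : ContDiffOn ℝ ∞ v (OmegaBar n)) (m : ℕ) :
    ContDiffOn ℝ ∞ (iteratedFDerivWithin ℝ m v (OmegaBar n)) (OmegaBar n) := by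
  intro x hx
  exact (hv x hx).iteratedFDerivWithin_right (uniqueDiffOn_omegaBar n)
    (m := ∞) (i := m) (by exact_mod_cast le_top) hx

theorem omegaBar_subset_closure_interior (n : ℕ) :
    OmegaBar n ⊆ closure (interior (OmegaBar n)) := by
  rw [interior_closedBall _ one_ne_zero, closure_ball _ one_ne_zero]

/-- The exchange of the first two arguments is the symmetry of the second derivative of `D^m v`,
valid up to the boundary because `Ω̄` is the closure of its interior. Any other adjacent exchange
leaves the first argument alone and follows by differentiating the identity one order lower. -/
theorem iteratedFDerivWithin_comp_swap (hv : ContDiffOn ℝ ∞ v (OmegaBar n)) (m : ℕ) (i : Fin m)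
    (hx : x ∈ OmegaBar n) (u : Fin (m + 1) → Rn n) :
    iteratedFDerivWithin ℝ (m + 1) v (OmegaBar n) x (u ∘ Equiv.swap i.castSucc i.succ) =
      iteratedFDerivWithin ℝ (m + 1) v (OmegaBar n) x u := by
  induction m generalizing x with
  | zero => exact i.elim0
  | succ m ih =>
    refine Fin.cases ?_ (fun j => ?_) i
    · set g := iteratedFDerivWithin ℝ m v (OmegaBar n) with hg
      have hgc := contDiffOn_iteratedFDerivWithin_omegaBar hv m
      have hsym : IsSymmSndFDerivWithinAt ℝ g (OmegaBar n) x :=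
        (hgc x hx).isSymmSndFDerivWithinAt (by
          rw [minSmoothness_of_isRCLikeNormedField]
          exact WithTop.coe_le_coe.2 (le_top : (2 : ℕ∞) ≤ ⊤)) (uniqueDiffOn_omegaBar n)
          (omegaBar_subset_closure_interior n hx) hx
      have key : ∀ w : Fin (m + 2) → Rn n,
          iteratedFDerivWithin ℝ (m + 1 + 1) v (OmegaBar n) x w =
            fderivWithin ℝ (fderivWithin ℝ g (OmegaBar n)) (OmegaBar n) x (w 0) (w 1)
              (Fin.tail (Fin.tail w)) := by
        intro w
        have e1 : EqOn (fun y => iteratedFDerivWithin ℝ (m + 1) v (OmegaBar n) y (Fin.tail w))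
            (fun y => fderivWithin ℝ g (OmegaBar n) y (w 1) (Fin.tail (Fin.tail w)))
            (OmegaBar n) := fun y hy => iteratedFDerivWithin_succ_apply_left _
        have h1 := (ContinuousMultilinearMap.apply ℝ (fun _ : Fin (m + 1) => Rn n) F
          (Fin.tail w)).hasFDerivAt.comp_hasFDerivWithinAt x
          (hasFDerivWithinAt_iteratedFDerivWithin hv (m + 1) hx)
        have h2 : DifferentiableWithinAt ℝ (fderivWithin ℝ g (OmegaBar n)) (OmegaBar n) x :=
          ((hgc.fderivWithin (uniqueDiffOn_omegaBar n) (m := ∞) (by simp)).differentiableOn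
            (by simp)) x hx
        have h3 := (ContinuousMultilinearMap.apply ℝ (fun _ : Fin m => Rn n) F
          (Fin.tail (Fin.tail w))).hasFDerivAt.comp_hasFDerivWithinAt x
          (h2.hasFDerivWithinAt.clm_apply (hasFDerivWithinAt_const (w 1) x (OmegaBar n)))
        have h4 := (uniqueDiffOn_omegaBar n x hx).eq (h1.congr' (fun y hy => (e1 hy).symm) hx)
          h3
        have h5 := congrArg (fun L => L (w 0)) h4
        refine Eq.trans ?_ (h5.trans (by simp))
        change _ = iteratedFDerivWithin ℝ (m + 1 + 1) v (OmegaBar n) x (Fin.cons (w 0) (Fin.tail w))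
        rw [Fin.cons_self_tail]
      rw [key, key]
      have t : Fin.tail (Fin.tail (u ∘ Equiv.swap (0 : Fin (m + 1)).castSucc
          (0 : Fin (m + 1)).succ)) = Fin.tail (Fin.tail u) := by
        ext1 l
        simp only [Fin.tail, Function.comp_apply]
        rw [Equiv.swap_apply_of_ne_of_ne]
        · simp [Fin.ext_iff]
        · simp [Fin.ext_iff]
      rw [t]
      have a0 : (u ∘ Equiv.swap (0 : Fin (m + 1)).castSucc (0 : Fin (m + 1)).succ) 0 = u 1 := by
        simp
      have a1 : (u ∘ Equiv.swap (0 : Fin (m + 1)).castSucc (0 : Fin (m + 1)).succ) 1 = u 0 := by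
        have : (1 : Fin (m + 2)) = (0 : Fin (m + 1)).succ := rfl
        simp
      rw [a0, a1, hsym.eq]
    · set τ := Equiv.swap j.castSucc j.succ with hτ
      have e0 : (u ∘ Equiv.swap j.succ.castSucc j.succ.succ) 0 = u 0 := by
        rw [Function.comp_apply, Equiv.swap_apply_of_ne_of_ne]
        · simp [Fin.ext_iff]
        · simp [Fin.ext_iff]
      have et : Fin.tail (u ∘ Equiv.swap j.succ.castSucc j.succ.succ) = Fin.tail u ∘ τ := by
        ext1 l
        simp only [Fin.tail, Function.comp_apply]
        rw [hτ, ← Fin.succ_castSucc]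
        congr 1
        exact (Fin.succ_injective _).swap_apply _ _ _
      have h1 : ∀ w : Fin (m + 1) → Rn n, HasFDerivWithinAt
          (fun y => iteratedFDerivWithin ℝ (m + 1) v (OmegaBar n) y w)
          ((ContinuousMultilinearMap.apply ℝ (fun _ : Fin (m + 1) => Rn n) F w).comp
            (iteratedFDerivWithin ℝ (m + 1 + 1) v (OmegaBar n) x).curryLeft) (OmegaBar n) x :=
        fun w => (ContinuousMultilinearMap.apply ℝ (fun _ : Fin (m + 1) => Rn n) F
          w).hasFDerivAt.comp_hasFDerivWithinAt x
          (hasFDerivWithinAt_iteratedFDerivWithin hv (m + 1) hx)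
      -- By the induction hypothesis the two functions agree on `Ω̄`, hence so do their derivatives
      -- within `Ω̄`.
      have h2 := (uniqueDiffOn_omegaBar n x hx).eq
        ((h1 (Fin.tail u)).congr' (fun y hy => ih j hy (Fin.tail u)) hx)
        (h1 (Fin.tail u ∘ τ))
      have h3 := congrArg (fun L => L (u 0)) h2
      have h4 : iteratedFDerivWithin ℝ (m + 1 + 1) v (OmegaBar n) x (Fin.cons (u 0) (Fin.tail u)) =
          iteratedFDerivWithin ℝ (m + 1 + 1) v (OmegaBar n) x
            (Fin.cons (u 0) (Fin.tail u ∘ τ)) := h3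
      rw [← et, Fin.cons_self_tail] at h4
      rw [h4]
      congr 1
      rw [← e0, Fin.cons_self_tail]

theorem iteratedFDerivWithin_comp_perm (hv : ContDiffOn ℝ ∞ v (OmegaBar n)) (m : ℕ)
    (hx : x ∈ OmegaBar n) (τ : Equiv.Perm (Fin m)) (u : Fin m → Rn n) :
    iteratedFDerivWithin ℝ m v (OmegaBar n) x (u ∘ τ) =
      iteratedFDerivWithin ℝ m v (OmegaBar n) x u := by
  cases m with
  | zero => congr 1; exact Subsingleton.elim _ _
  | succ m =>
    have : τ ∈ Submonoid.closure (Set.range fun i : Fin m => Equiv.swap i.castSucc i.succ) := by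
      rw [Equiv.Perm.mclosure_swap_castSucc_succ]; trivial
    induction this using Submonoid.closure_induction generalizing u with
    | mem τ h =>
      obtain ⟨i, rfl⟩ := h
      exact iteratedFDerivWithin_comp_swap hv m i hx u
    | one => rfl
    | mul σ τ _ _ h1 h2 =>
      have : u ∘ ⇑(σ * τ) = (u ∘ σ) ∘ τ := rfl
      rw [this, h2, h1]

theorem norm_multilinear_le_sum {m : ℕ} (L : Rn n [×m]→L[ℝ] F) :
    ‖L‖ ≤ ∑ i : Fin m → Fin n, ‖L fun l => EuclideanSpace.single (i l) 1‖ := by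
  classical
  refine L.opNorm_le_bound (Finset.sum_nonneg fun _ _ => norm_nonneg _) fun e => ?_
  have he : e = fun l => ∑ j, e l j • EuclideanSpace.single j (1 : ℝ) := by
    ext l i
    simp [Finset.sum_apply, Pi.single_apply]
  conv_lhs => rw [he]
  rw [ContinuousMultilinearMap.map_sum, Finset.sum_mul]
  refine (norm_sum_le _ _).trans (Finset.sum_le_sum fun i _ => ?_)
  rw [ContinuousMultilinearMap.map_smul_univ, norm_smul, mul_comm, norm_prod]
  exact mul_le_mul_of_nonneg_left (Finset.prod_le_prod (fun _ _ => norm_nonneg _)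
    fun l _ => PiLp.norm_apply_le (e l) (i l)) (norm_nonneg _)

end symmetry

section derivDiff
variable {n : ℕ} {v w : Rn n → Rn n} {x y : Rn n}

theorem derivDiff_nonneg (k : ℕ) (v : Rn n → Rn n) (x y : Rn n) : 0 ≤ derivDiff k v x y :=
  Finset.sum_nonneg fun _ _ => norm_nonneg _

theorem derivDiff_le (k : ℕ) (v : Rn n → Rn n) (x y : Rn n) :
    derivDiff k v x y ≤ (Fintype.card (Fin k → Fin n) : ℝ) *
      ‖iteratedFDerivWithin ℝ k v (OmegaBar n) x - iteratedFDerivWithin ℝ k v (OmegaBar n) y‖ := by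
  classical
  unfold derivDiff
  refine (Finset.sum_le_sum_of_subset_of_nonneg (Finset.filter_subset _ _)
    fun _ _ _ => norm_nonneg _).trans ?_
  rw [← nsmul_eq_mul, ← Finset.card_univ]
  refine Finset.sum_le_card_nsmul _ _ _ fun i _ => ?_
  refine ((iteratedFDerivWithin ℝ k v (OmegaBar n) x - iteratedFDerivWithin ℝ k v (OmegaBar n) y
    ).le_opNorm fun l => EuclideanSpace.single (i l) 1).trans ?_
  simp

/-- The Hölder seminorm runs over sorted indices only. Symmetry of the derivatives lets any index be
sorted first, so these components control the whole multilinear map. -/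
theorem norm_sub_le_derivDiff (k : ℕ) (hv : ContDiffOn ℝ ∞ v (OmegaBar n)) (hx : x ∈ OmegaBar n)
    (hy : y ∈ OmegaBar n) :
    ‖iteratedFDerivWithin ℝ k v (OmegaBar n) x - iteratedFDerivWithin ℝ k v (OmegaBar n) y‖ ≤
      (Fintype.card (Fin k → Fin n) : ℝ) * derivDiff k v x y := by
  classical
  refine (norm_multilinear_le_sum _).trans ?_
  rw [← nsmul_eq_mul, ← Finset.card_univ]
  refine Finset.sum_le_card_nsmul _ _ _ fun i _ => ?_
  have h := Finset.single_le_sum (f := fun i : Fin k → Fin n =>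
    ‖partialDeriv i v x - partialDeriv i v y‖) (s := Finset.univ.filter Monotone)
    (fun _ _ => norm_nonneg _) (a := i ∘ Tuple.sort i)
    (Finset.mem_filter.2 ⟨Finset.mem_univ _, Tuple.monotone_sort i⟩)
  refine le_trans (le_of_eq ?_) h
  have e : (fun l => EuclideanSpace.single ((i ∘ Tuple.sort i) l) (1 : ℝ) : Fin k → Rn n) =
    (fun l => EuclideanSpace.single (i l) (1 : ℝ)) ∘ Tuple.sort i := rfl
  simp only [partialDeriv]
  rw [e, iteratedFDerivWithin_comp_perm hv k hx, iteratedFDerivWithin_comp_perm hv k hy]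
  rfl

theorem iteratedFDerivWithin_add_omegaBar (hv : ContDiffOn ℝ ∞ v (OmegaBar n))
    (hw : ContDiffOn ℝ ∞ w (OmegaBar n)) (k : ℕ) (hx : x ∈ OmegaBar n) :
    iteratedFDerivWithin ℝ k (v + w) (OmegaBar n) x =
      iteratedFDerivWithin ℝ k v (OmegaBar n) x + iteratedFDerivWithin ℝ k w (OmegaBar n) x :=
  iteratedFDerivWithin_add_apply ((hv x hx).of_le (by exact_mod_cast le_top))
    ((hw x hx).of_le (by exact_mod_cast le_top)) (uniqueDiffOn_omegaBar n) hx

theorem iteratedFDerivWithin_smul_omegaBar (hv : ContDiffOn ℝ ∞ v (OmegaBar n)) (c : ℝ)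
    (k : ℕ) (hx : x ∈ OmegaBar n) :
    iteratedFDerivWithin ℝ k (c • v) (OmegaBar n) x =
      c • iteratedFDerivWithin ℝ k v (OmegaBar n) x :=
  iteratedFDerivWithin_const_smul_apply ((hv x hx).of_le (by exact_mod_cast le_top))
    (uniqueDiffOn_omegaBar n) hx

theorem derivDiff_add_le (k : ℕ) (hv : ContDiffOn ℝ ∞ v (OmegaBar n))
    (hw : ContDiffOn ℝ ∞ w (OmegaBar n)) (hx : x ∈ OmegaBar n) (hy : y ∈ OmegaBar n) :
    derivDiff k (v + w) x y ≤ derivDiff k v x y + derivDiff k w x y := by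
  classical
  unfold derivDiff
  rw [← Finset.sum_add_distrib]
  refine Finset.sum_le_sum fun i _ => ?_
  simp only [partialDeriv, iteratedFDerivWithin_add_omegaBar hv hw k hx,
    iteratedFDerivWithin_add_omegaBar hv hw k hy, add_apply]
  rw [add_sub_add_comm]
  exact norm_add_le _ _

theorem derivDiff_smul (k : ℕ) (hv : ContDiffOn ℝ ∞ v (OmegaBar n)) (c : ℝ)
    (hx : x ∈ OmegaBar n) (hy : y ∈ OmegaBar n) :
    derivDiff k (c • v) x y = |c| * derivDiff k v x y := by
  classical
  unfold derivDiff
  rw [Finset.mul_sum]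
  refine Finset.sum_congr rfl fun i _ => ?_
  simp only [partialDeriv, iteratedFDerivWithin_smul_omegaBar hv c k hx,
    iteratedFDerivWithin_smul_omegaBar hv c k hy, smul_apply]
  rw [← smul_sub, norm_smul, Real.norm_eq_abs]

theorem derivDiff_congr (k : ℕ) (h : EqOn v w (OmegaBar n)) (hx : x ∈ OmegaBar n)
    (hy : y ∈ OmegaBar n) : derivDiff k v x y = derivDiff k w x y := by
  simp only [derivDiff, partialDeriv, iteratedFDerivWithin_congr h hx,
    iteratedFDerivWithin_congr h hy]

end derivDiff

section lipschitz
variable {n : ℕ} {F : Type*} [NormedAddCommGroup F] [NormedSpace ℝ F] {v : Rn n → F} {x y : Rn n}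

theorem norm_iteratedFDerivWithin_sub_le (hv : ContDiffOn ℝ ∞ v (OmegaBar n)) (m : ℕ) {M : ℝ}
    (hM : ∀ x ∈ OmegaBar n, ‖iteratedFDerivWithin ℝ (m + 1) v (OmegaBar n) x‖ ≤ M)
    (hx : x ∈ OmegaBar n) (hy : y ∈ OmegaBar n) :
    ‖iteratedFDerivWithin ℝ m v (OmegaBar n) x - iteratedFDerivWithin ℝ m v (OmegaBar n) y‖ ≤
      M * ‖x - y‖ :=
  (convex_closedBall (0 : Rn n) 1).norm_image_sub_le_of_norm_hasFDerivWithin_le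
    (fun _ hz => hasFDerivWithinAt_iteratedFDerivWithin hv m hz)
    (fun z hz => (ContinuousMultilinearMap.curryLeft_norm _).trans_le (hM z hz)) hy hx

/-- At interior points a Lipschitz constant bounds the Fréchet derivative; continuity carries the
bound to the sphere. -/
theorem norm_iteratedFDerivWithin_succ_le_of_lipschitz (hv : ContDiffOn ℝ ∞ v (OmegaBar n))
    (m : ℕ) {M : ℝ} (hM0 : 0 ≤ M)
    (hM : ∀ x ∈ OmegaBar n, ∀ y ∈ OmegaBar n, ‖iteratedFDerivWithin ℝ m v (OmegaBar n) x -
      iteratedFDerivWithin ℝ m v (OmegaBar n) y‖ ≤ M * ‖x - y‖)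
    (hx : x ∈ OmegaBar n) :
    ‖iteratedFDerivWithin ℝ (m + 1) v (OmegaBar n) x‖ ≤ M := by
  have hball : ∀ z ∈ Metric.ball (0 : Rn n) 1,
      ‖iteratedFDerivWithin ℝ (m + 1) v (OmegaBar n) z‖ ≤ M := by
    intro z hz
    have hn : OmegaBar n ∈ 𝓝 z :=
      Filter.mem_of_superset (Metric.isOpen_ball.mem_nhds hz) Metric.ball_subset_closedBall
    have h1 := (hasFDerivWithinAt_iteratedFDerivWithin hv m
      (Metric.ball_subset_closedBall hz)).hasFDerivAt hn
    rw [← ContinuousMultilinearMap.curryLeft_norm]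
    refine h1.le_of_lip' hM0 ?_
    filter_upwards [hn] with w hw
    exact hM w hw z (Metric.ball_subset_closedBall hz)
  have hc := continuousOn_iteratedFDerivWithin_omegaBar hv (m + 1)
  have hx' : x ∈ closure (Metric.ball (0 : Rn n) 1) := by rwa [closure_ball _ one_ne_zero]
  have hcl := (hc x hx).norm.mono Metric.ball_subset_closedBall
  have := hcl.mem_closure hx' (t := Iic M) (fun z hz => hball z hz)
  rwa [isClosed_Iic.closure_eq] at this

end lipschitz
end NashMoser
end

/-! ### Hölder norms: equivalent forms, interpolation and smoothing. -/

noncomputable section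
namespace NashMoser

/-- The order `k` of derivatives with `k < a ≤ k + 1`. -/
abbrev holderOrder (a : ℝ) : ℕ := ⌈a⌉₊ - 1

theorem holderOrder_add_one {a : ℝ} (ha : 0 < a) : holderOrder a + 1 = ⌈a⌉₊ :=
  Nat.sub_add_cancel (Nat.ceil_pos.2 ha)

theorem sub_holderOrder_mem {a : ℝ} (ha : 0 < a) : a - (holderOrder a : ℝ) ∈ Ioc (0 : ℝ) 1 := by
  have h1 : ((holderOrder a : ℝ) + 1) = ⌈a⌉₊ := by exact_mod_cast holderOrder_add_one ha
  have h2 := Nat.ceil_lt_add_one ha.le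
  have h3 := Nat.le_ceil a
  constructor <;> linarith

theorem holderOrder_nat (m : ℕ) : holderOrder ((m : ℝ) + 1) = m := by
  have : ((m : ℝ) + 1) = ((m + 1 : ℕ) : ℝ) := by push_cast; ring
  rw [holderOrder, this, Nat.ceil_natCast, Nat.add_sub_cancel]

section holderNorm
variable {n : ℕ} {v w : Rn n → Rn n} {x y : Rn n} {a : ℝ}

instance : Nonempty (OmegaBar n) := ⟨⟨0, by simp⟩⟩

theorem exists_bound_iteratedFDerivWithin (hv : ContDiffOn ℝ ∞ v (OmegaBar n)) (m : ℕ) :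
    ∃ M : ℝ, 0 ≤ M ∧ ∀ x ∈ OmegaBar n, ‖iteratedFDerivWithin ℝ m v (OmegaBar n) x‖ ≤ M := by
  obtain ⟨M, hM⟩ := (isCompact_omegaBar n).exists_bound_of_continuousOn
    (continuousOn_iteratedFDerivWithin_omegaBar hv m)
  exact ⟨M, (norm_nonneg _).trans (hM 0 (by simp)), hM⟩

theorem norm_sub_le_two (hx : x ∈ OmegaBar n) (hy : y ∈ OmegaBar n) : ‖x - y‖ ≤ 2 := by
  have h1 := mem_closedBall_zero_iff.1 hx
  have h2 := mem_closedBall_zero_iff.1 hy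
  linarith [norm_sub_le x y]

/-- As `Ω̄` has diameter 2, this converts a Lipschitz bound into a Hölder bound of any exponent `σ`,
and so shows that the suprema in the norms are finite. -/
theorem le_mul_rpow_of_le_two {r σ : ℝ} (hr : 0 ≤ r) (hr2 : r ≤ 2) (hσ : σ ∈ Ioc (0 : ℝ) 1) :
    r ≤ 2 * r ^ σ := by
  rcases hr.eq_or_lt with rfl | hr0
  · rw [Real.zero_rpow hσ.1.ne']; simp
  · have h1 : r = r ^ (1 - σ) * r ^ σ := by rw [← Real.rpow_add hr0]; simp
    have h2 : r ^ (1 - σ) ≤ 2 := by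
      calc r ^ (1 - σ) ≤ 2 ^ (1 - σ) := Real.rpow_le_rpow hr hr2 (by linarith [hσ.2])
        _ ≤ 2 ^ (1 : ℝ) := Real.rpow_le_rpow_of_exponent_le (by norm_num) (by linarith [hσ.1])
        _ = 2 := Real.rpow_one 2
    calc r = r ^ (1 - σ) * r ^ σ := h1
      _ ≤ _ := by gcongr

theorem div_rpow_le_of_le_mul {A H r σ : ℝ} (hH : 0 ≤ H) (hr : 0 ≤ r)
    (h : A ≤ H * r ^ σ) : A / r ^ σ ≤ H :=
  div_le_of_le_mul₀ (Real.rpow_nonneg hr _) hH h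

theorem bddAbove_derivDiff_div (hv : ContDiffOn ℝ ∞ v (OmegaBar n)) (k : ℕ) {σ : ℝ}
    (hσ : σ ∈ Ioc (0 : ℝ) 1) :
    BddAbove (range fun p : OmegaBar n × OmegaBar n =>
      derivDiff k v p.1 p.2 / ‖(p.1 : Rn n) - (p.2 : Rn n)‖ ^ σ) := by
  obtain ⟨M, hM0, hM⟩ := exists_bound_iteratedFDerivWithin hv (k + 1)
  refine ⟨(Fintype.card (Fin k → Fin n) : ℝ) * (M * 2), ?_⟩
  rintro _ ⟨p, rfl⟩
  refine div_rpow_le_of_le_mul (by positivity) (norm_nonneg _) ?_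
  refine (derivDiff_le k v _ _).trans ?_
  rw [mul_assoc, mul_assoc]
  gcongr
  refine (norm_iteratedFDerivWithin_sub_le hv k hM p.1.2 p.2.2).trans ?_
  gcongr
  exact le_mul_rpow_of_le_two (norm_nonneg _) (norm_sub_le_two p.1.2 p.2.2) hσ

theorem bddAbove_norm (hv : ContinuousOn v (OmegaBar n)) :
    BddAbove (range fun x : OmegaBar n => ‖v x‖) := by
  obtain ⟨M, hM⟩ := (isCompact_omegaBar n).exists_bound_of_continuousOn hv
  exact ⟨M, by rintro _ ⟨p, rfl⟩; exact hM p p.2⟩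

theorem iSup_norm_nonneg (v : Rn n → Rn n) : 0 ≤ ⨆ x : OmegaBar n, ‖v x‖ :=
  Real.iSup_nonneg fun _ => norm_nonneg _

theorem iSup_quot_nonneg (k : ℕ) (σ : ℝ) (v : Rn n → Rn n) :
    0 ≤ ⨆ p : OmegaBar n × OmegaBar n,
      derivDiff k v p.1 p.2 / ‖(p.1 : Rn n) - (p.2 : Rn n)‖ ^ σ :=
  Real.iSup_nonneg fun _ => div_nonneg (derivDiff_nonneg _ _ _ _) (Real.rpow_nonneg (norm_nonneg _) _)

theorem holderNorm_nonneg (a : ℝ) (v : Rn n → Rn n) : 0 ≤ holderNorm a v := by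
  unfold holderNorm
  split_ifs
  · exact iSup_norm_nonneg v
  · exact add_nonneg (iSup_quot_nonneg _ _ _) (iSup_norm_nonneg v)

theorem norm_le_holderNorm (a : ℝ) (hv : ContDiffOn ℝ ∞ v (OmegaBar n)) (hx : x ∈ OmegaBar n) :
    ‖v x‖ ≤ holderNorm a v := by
  have h := le_ciSup (bddAbove_norm hv.continuousOn) (⟨x, hx⟩ : OmegaBar n)
  unfold holderNorm
  split_ifs
  · exact h
  · exact h.trans (le_add_of_nonneg_left (iSup_quot_nonneg _ _ _))

theorem derivDiff_le_holderNorm (ha : 0 < a) (hv : ContDiffOn ℝ ∞ v (OmegaBar n))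
    (hx : x ∈ OmegaBar n) (hy : y ∈ OmegaBar n) :
    derivDiff (holderOrder a) v x y ≤ holderNorm a v * ‖x - y‖ ^ (a - (holderOrder a : ℝ)) := by
  have hσ := sub_holderOrder_mem ha
  have h := le_ciSup (bddAbove_derivDiff_div hv (holderOrder a) hσ)
    ((⟨x, hx⟩, ⟨y, hy⟩) : OmegaBar n × OmegaBar n)
  have h2 : _ ≤ holderNorm a v := h.trans (by
    unfold holderNorm
    rw [if_neg ha.ne']
    exact le_add_of_nonneg_right (iSup_norm_nonneg v))
  rcases eq_or_ne x y with rfl | hne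
  · simp only [derivDiff, sub_self, norm_zero, Finset.sum_const_zero]
    exact mul_nonneg (holderNorm_nonneg _ _) (Real.rpow_nonneg le_rfl _)
  · have hpos : 0 < ‖x - y‖ ^ (a - (holderOrder a : ℝ)) :=
      Real.rpow_pos_of_pos (norm_pos_iff.2 (sub_ne_zero.2 hne)) _
    exact (div_le_iff₀ hpos).1 h2

theorem norm_sub_le_holderNorm (ha : 0 < a) (hv : ContDiffOn ℝ ∞ v (OmegaBar n))
    (hx : x ∈ OmegaBar n) (hy : y ∈ OmegaBar n) :
    ‖iteratedFDerivWithin ℝ (holderOrder a) v (OmegaBar n) x -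
      iteratedFDerivWithin ℝ (holderOrder a) v (OmegaBar n) y‖ ≤
      (Fintype.card (Fin (holderOrder a) → Fin n) : ℝ) * holderNorm a v *
        ‖x - y‖ ^ (a - (holderOrder a : ℝ)) := by
  refine (norm_sub_le_derivDiff _ hv hx hy).trans ?_
  rw [mul_assoc]
  exact mul_le_mul_of_nonneg_left (derivDiff_le_holderNorm ha hv hx hy) (by positivity)

theorem holderNorm_zero_le {M : ℝ} (h : ∀ x ∈ OmegaBar n, ‖v x‖ ≤ M) : holderNorm 0 v ≤ M := by
  rw [holderNorm, if_pos rfl]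
  exact ciSup_le fun x => h x x.2

theorem holderNorm_le (ha : 0 < a) {H M : ℝ} (hH : 0 ≤ H)
    (h1 : ∀ x ∈ OmegaBar n, ∀ y ∈ OmegaBar n, derivDiff (holderOrder a) v x y ≤
      H * ‖x - y‖ ^ (a - (holderOrder a : ℝ)))
    (h0 : ∀ x ∈ OmegaBar n, ‖v x‖ ≤ M) : holderNorm a v ≤ H + M := by
  rw [holderNorm, if_neg ha.ne']
  exact add_le_add (ciSup_le fun p => div_rpow_le_of_le_mul hH (norm_nonneg _)
    (h1 _ p.1.2 _ p.2.2)) (ciSup_le fun x => h0 x x.2)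

theorem holderNorm_le' (ha : 0 < a) {H M : ℝ} (hH : 0 ≤ H)
    (h1 : ∀ x ∈ OmegaBar n, ∀ y ∈ OmegaBar n,
      ‖iteratedFDerivWithin ℝ (holderOrder a) v (OmegaBar n) x -
        iteratedFDerivWithin ℝ (holderOrder a) v (OmegaBar n) y‖ ≤
      H * ‖x - y‖ ^ (a - (holderOrder a : ℝ)))
    (h0 : ∀ x ∈ OmegaBar n, ‖v x‖ ≤ M) :
    holderNorm a v ≤ (Fintype.card (Fin (holderOrder a) → Fin n) : ℝ) * H + M := by
  refine holderNorm_le ha (by positivity) (fun x hx y hy => ?_) h0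
  refine (derivDiff_le _ _ _ _).trans ?_
  rw [mul_assoc]
  exact mul_le_mul_of_nonneg_left (h1 x hx y hy) (by positivity)

theorem holderNorm_congr (a : ℝ) (h : EqOn v w (OmegaBar n)) : holderNorm a v = holderNorm a w := by
  have h0 : (fun x : OmegaBar n => ‖v x‖) = fun x : OmegaBar n => ‖w x‖ :=
    funext fun x => by rw [h x.2]
  simp only [holderNorm, h0, fun p : OmegaBar n × OmegaBar n =>
    derivDiff_congr (⌈a⌉₊ - 1) h p.1.2 p.2.2]

theorem holderNorm_add_le (ha : 0 ≤ a) (hv : ContDiffOn ℝ ∞ v (OmegaBar n))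
    (hw : ContDiffOn ℝ ∞ w (OmegaBar n)) :
    holderNorm a (v + w) ≤ holderNorm a v + holderNorm a w := by
  rcases ha.eq_or_lt with rfl | ha
  · exact holderNorm_zero_le fun x hx => (norm_add_le _ _).trans
      (add_le_add (norm_le_holderNorm 0 hv hx) (norm_le_holderNorm 0 hw hx))
  · have e : holderNorm a v + holderNorm a w =
        ((⨆ p : OmegaBar n × OmegaBar n, derivDiff (⌈a⌉₊ - 1) v p.1 p.2 /
          ‖(p.1 : Rn n) - (p.2 : Rn n)‖ ^ (a - ((⌈a⌉₊ - 1 : ℕ) : ℝ))) +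
        (⨆ p : OmegaBar n × OmegaBar n, derivDiff (⌈a⌉₊ - 1) w p.1 p.2 /
          ‖(p.1 : Rn n) - (p.2 : Rn n)‖ ^ (a - ((⌈a⌉₊ - 1 : ℕ) : ℝ)))) +
        ((⨆ x : OmegaBar n, ‖v x‖) + ⨆ x : OmegaBar n, ‖w x‖) := by
      rw [holderNorm, holderNorm, if_neg ha.ne', if_neg ha.ne']; ring
    rw [e, holderNorm, if_neg ha.ne']
    have hσ := sub_holderOrder_mem ha
    refine add_le_add (ciSup_le fun p => ?_) (ciSup_le fun x => ?_)
    · refine le_trans ?_ (add_le_add (le_ciSup (bddAbove_derivDiff_div hv _ hσ) p)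
        (le_ciSup (bddAbove_derivDiff_div hw _ hσ) p))
      rw [← add_div]
      exact div_le_div_of_nonneg_right (derivDiff_add_le _ hv hw p.1.2 p.2.2)
        (Real.rpow_nonneg (norm_nonneg _) _)
    · exact (norm_add_le _ _).trans (add_le_add (le_ciSup (bddAbove_norm hv.continuousOn) x)
        (le_ciSup (bddAbove_norm hw.continuousOn) x))

theorem holderNorm_smul (a : ℝ) (hv : ContDiffOn ℝ ∞ v (OmegaBar n)) (c : ℝ) :
    holderNorm a (c • v) = |c| * holderNorm a v := by
  simp only [holderNorm, Pi.smul_apply, norm_smul, Real.norm_eq_abs,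
    fun p : OmegaBar n × OmegaBar n => derivDiff_smul (⌈a⌉₊ - 1) hv c p.1.2 p.2.2,
    mul_div_assoc, ← Real.mul_iSup_of_nonneg (abs_nonneg c)]
  split_ifs
  · rfl
  · rw [mul_add]

/-- For `m + 1` the norm is built on the Lipschitz constant of the derivatives of order `m`, because
its range of orders is `k < a ≤ k + 1`. At integers it is thus equivalent to a `C^m` norm. -/
theorem exists_norm_iteratedFDerivWithin_le_holderNorm (n m : ℕ) :
    ∃ C : ℝ, 0 ≤ C ∧ ∀ v : Rn n → Rn n, ContDiffOn ℝ ∞ v (OmegaBar n) → ∀ x ∈ OmegaBar n,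
      ‖iteratedFDerivWithin ℝ m v (OmegaBar n) x‖ ≤ C * holderNorm (m : ℝ) v := by
  cases m with
  | zero =>
    refine ⟨1, zero_le_one, fun v hv x hx => ?_⟩
    rw [norm_iteratedFDerivWithin_zero, one_mul]
    exact norm_le_holderNorm _ hv hx
  | succ m =>
    refine ⟨(Fintype.card (Fin m → Fin n) : ℝ), by positivity, fun v hv x hx => ?_⟩
    refine norm_iteratedFDerivWithin_succ_le_of_lipschitz hv m
      (mul_nonneg (by positivity) (holderNorm_nonneg _ _)) (fun x hx y hy => ?_) hx
    have h := norm_sub_le_holderNorm (a := (m : ℝ) + 1) (by positivity) hv hx hy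
    rw [holderOrder_nat, add_sub_cancel_left, Real.rpow_one] at h
    rw [Nat.cast_succ]
    exact h

theorem exists_holderNorm_nat_le (n m : ℕ) :
    ∃ C : ℝ, 0 ≤ C ∧ ∀ (v : Rn n → Rn n) (M : ℝ), 0 ≤ M → ContDiffOn ℝ ∞ v (OmegaBar n) →
      (∀ x ∈ OmegaBar n, ‖v x‖ ≤ M) →
      (∀ x ∈ OmegaBar n, ‖iteratedFDerivWithin ℝ m v (OmegaBar n) x‖ ≤ M) →
      holderNorm (m : ℝ) v ≤ C * M := by
  cases m with
  | zero =>
    refine ⟨1, zero_le_one, fun v M hM hv h0 _ => ?_⟩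
    rw [one_mul, Nat.cast_zero]
    exact holderNorm_zero_le h0
  | succ m =>
    refine ⟨(Fintype.card (Fin m → Fin n) : ℝ) + 1, by positivity, fun v M hM hv h0 h1 => ?_⟩
    rw [Nat.cast_succ]
    refine (holderNorm_le' (a := (m : ℝ) + 1) (by positivity) hM (fun x hx y hy => ?_) h0).trans
      (le_of_eq ?_)
    · rw [holderOrder_nat, add_sub_cancel_left, Real.rpow_one]
      exact norm_iteratedFDerivWithin_sub_le hv m h1 hx hy
    · rw [holderOrder_nat]; ring

/-- Interpolation of a fractional Hölder norm between the neighbouring integers. -/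
theorem exists_holderNorm_le_interp (n m : ℕ) (a : ℝ) (ha : a ∈ Ioo (m : ℝ) (m + 1)) :
    ∃ C : ℝ, 0 ≤ C ∧ ∀ (v : Rn n → Rn n) (R : ℝ), 1 ≤ R → ContDiffOn ℝ ∞ v (OmegaBar n) →
      holderNorm a v ≤ C * (R ^ (a - m) * holderNorm (m : ℝ) v +
        R ^ (a - (m + 1)) * holderNorm ((m + 1 : ℕ) : ℝ) v) := by
  have ha0 : 0 < a := lt_of_le_of_lt (Nat.cast_nonneg m) ha.1
  have hord : holderOrder a = m := by
    have : ⌈a⌉₊ = m + 1 := by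
      rw [Nat.ceil_eq_iff (by omega)]
      simpa using ⟨ha.1, ha.2.le⟩
    rw [holderOrder, this, Nat.add_sub_cancel]
  obtain ⟨C₀, hC₀, h0⟩ := exists_norm_iteratedFDerivWithin_le_holderNorm n m
  obtain ⟨C₁, hC₁, h1⟩ := exists_norm_iteratedFDerivWithin_le_holderNorm n (m + 1)
  set c : ℝ := (Fintype.card (Fin (holderOrder a) → Fin n) : ℝ)
  refine ⟨c * (2 * C₀ + C₁) + 1, by positivity, fun v R hR hv => ?_⟩
  have hR0 : 0 < R := by linarith
  set N₀ := holderNorm (m : ℝ) v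
  set N₁ := holderNorm ((m + 1 : ℕ) : ℝ) v
  have hN₀ : 0 ≤ N₀ := holderNorm_nonneg _ _
  have hN₁ : 0 ≤ N₁ := holderNorm_nonneg _ _
  set X := R ^ (a - m) * N₀
  set Y := R ^ (a - (m + 1)) * N₁
  have hX : 0 ≤ X := by positivity
  have hY : 0 ≤ Y := by positivity
  refine (holderNorm_le' ha0 (H := 2 * C₀ * X + C₁ * Y) (M := X) (by positivity)
    (fun x hx y hy => ?_) (fun x hx => ?_)).trans ?_
  · rw [hord]
    -- Pairs closer than `R⁻¹` are handled by the derivative of order `m + 1`, the others by the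
    -- supremum of the derivative of order `m`.
    rcases le_total ‖x - y‖ R⁻¹ with h | h
    · refine (norm_iteratedFDerivWithin_sub_le hv m (h1 v hv) hx hy).trans ?_
      rcases eq_or_ne x y with rfl | hne
      · simp only [sub_self, norm_zero, mul_zero]
        exact mul_nonneg (by positivity) (Real.rpow_nonneg le_rfl _)
      have hr : 0 < ‖x - y‖ := norm_pos_iff.2 (sub_ne_zero.2 hne)
      have e : ‖x - y‖ = ‖x - y‖ ^ (1 - (a - m)) * ‖x - y‖ ^ (a - m) := by
        rw [← Real.rpow_add hr]; simp
      have h2 : ‖x - y‖ ^ (1 - (a - m)) ≤ R ^ (a - (m + 1)) := by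
        calc _ ≤ (R⁻¹) ^ (1 - (a - m)) := Real.rpow_le_rpow hr.le h (by linarith [ha.2])
          _ = R ^ (a - (m + 1)) := by
            rw [Real.inv_rpow hR0.le, ← Real.rpow_neg hR0.le]; congr 1; ring
      calc C₁ * N₁ * ‖x - y‖ = C₁ * N₁ * (‖x - y‖ ^ (1 - (a - m)) * ‖x - y‖ ^ (a - m)) := by
            rw [← e]
        _ ≤ C₁ * N₁ * (R ^ (a - (m + 1)) * ‖x - y‖ ^ (a - m)) := by gcongr
        _ = (C₁ * Y) * ‖x - y‖ ^ (a - m) := by ring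
        _ ≤ _ := by
          gcongr
          exact le_add_of_nonneg_left (by positivity)
    · have h2 : 1 ≤ R ^ (a - m) * ‖x - y‖ ^ (a - m) := by
        rw [← Real.mul_rpow hR0.le (norm_nonneg _)]
        refine Real.one_le_rpow ?_ (by linarith [ha.1])
        rwa [← div_le_iff₀' hR0, one_div]
      calc _ ≤ C₀ * N₀ + C₀ * N₀ := (norm_sub_le _ _).trans (add_le_add (h0 v hv x hx) (h0 v hv y hy))
        _ = 2 * C₀ * N₀ * 1 := by ring
        _ ≤ 2 * C₀ * N₀ * (R ^ (a - m) * ‖x - y‖ ^ (a - m)) := by gcongr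
        _ = (2 * C₀ * X) * ‖x - y‖ ^ (a - m) := by ring
        _ ≤ _ := by
          gcongr
          exact le_add_of_nonneg_right (by positivity)
  · refine (norm_le_holderNorm (m : ℝ) hv hx).trans ?_
    exact le_mul_of_one_le_left hN₀ (Real.one_le_rpow hR (by linarith [ha.1]))
  · have hc : 0 ≤ c := by positivity
    nlinarith [mul_nonneg hc (mul_nonneg hC₀ hY), mul_nonneg hc (mul_nonneg hC₁ hX)]

/-- The smoothing estimate in Hölder norms. -/
theorem exists_holderNorm_smoothing_le (n b : ℕ) (a : ℝ) (ha : 0 ≤ a) (hab : a ≤ b) :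
    ∃ C : ℝ, 0 ≤ C ∧ ∀ (k : ℕ) (v : Rn n → Rn n), ContDiffOn ℝ ∞ v (OmegaBar n) →
      holderNorm (b : ℝ) (smoothing k v) ≤ C * ((2 : ℝ) ^ (k * (b - a)) * holderNorm a v) := by
  obtain ⟨C₀, hC₀, h0⟩ := exists_norm_smoothing_le_of_bound n (Rn n) 0
  obtain ⟨C₂, hC₂, h2⟩ := exists_holderNorm_nat_le n b
  have main : ∃ C₁ : ℝ, 0 ≤ C₁ ∧ ∀ (k : ℕ) (v : Rn n → Rn n), ContDiffOn ℝ ∞ v (OmegaBar n) →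
      ∀ x ∈ OmegaBar n, ‖iteratedFDerivWithin ℝ b (smoothing k v) (OmegaBar n) x‖ ≤
        C₁ * ((2 : ℝ) ^ (k * (b - a)) * holderNorm a v) := by
    rcases ha.eq_or_lt with rfl | ha
    · obtain ⟨C₁, hC₁, h1⟩ := exists_norm_smoothing_le_of_bound n (Rn n) b
      refine ⟨C₁, hC₁, fun k v hv x hx => ?_⟩
      rw [sub_zero]
      exact h1 k v _ (holderNorm_nonneg _ _) hv (fun x hx => norm_le_holderNorm 0 hv hx) x hx
    · have hb : holderOrder a + 1 ≤ b := by
        rw [holderOrder_add_one ha]; exact Nat.ceil_le.2 hab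
      obtain ⟨C₁, hC₁, h1⟩ := exists_norm_smoothing_le_of_holder n (Rn n) (holderOrder a)
        (a - holderOrder a) (sub_holderOrder_mem ha) b hb
      refine ⟨C₁ * (Fintype.card (Fin (holderOrder a) → Fin n) : ℝ), by positivity,
        fun k v hv x hx => ?_⟩
      refine (h1 k v _ (mul_nonneg (Nat.cast_nonneg _) (holderNorm_nonneg a v)) hv
        (fun x hx y hy => norm_sub_le_holderNorm ha hv hy hx) x hx).trans (le_of_eq ?_)
      rw [add_sub_cancel]
      ring
  obtain ⟨C₁, hC₁, h1⟩ := main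
  refine ⟨C₂ * (C₀ + C₁), by positivity, fun k v hv => ?_⟩
  have hN := holderNorm_nonneg a v
  rw [mul_assoc]
  refine h2 _ _ (by positivity) (contDiffOn_smoothing k hv) (fun x hx => ?_) (fun x hx => ?_)
  · have h3 := h0 k v _ hN hv (fun x hx => norm_le_holderNorm a hv hx) x hx
    rw [norm_iteratedFDerivWithin_zero, Nat.cast_zero, mul_zero, Real.rpow_zero, one_mul] at h3
    have : (1 : ℝ) ≤ (2 : ℝ) ^ (k * (b - a)) :=
      Real.one_le_rpow one_le_two (mul_nonneg (Nat.cast_nonneg _) (by linarith))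
    calc _ ≤ C₀ * holderNorm a v := h3
      _ ≤ C₀ * ((2 : ℝ) ^ (k * (b - a)) * holderNorm a v) := by
        gcongr
        exact le_mul_of_one_le_left hN this
      _ ≤ _ := by
        gcongr
        exact le_add_of_nonneg_right hC₁
  · refine (h1 k v hv x hx).trans ?_
    gcongr
    exact le_add_of_nonneg_left hC₀

theorem iteratedFDerivWithin_sub_smoothing (k m : ℕ) (hv : ContDiffOn ℝ ∞ v (OmegaBar n))
    (hx : x ∈ OmegaBar n) :
    iteratedFDerivWithin ℝ m (v - smoothing k v) (OmegaBar n) x =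
      iteratedFDerivWithin ℝ m v (OmegaBar n) x -
        iteratedFDerivWithin ℝ m (smoothing k v) (OmegaBar n) x :=
  iteratedFDerivWithin_sub_apply ((hv x hx).of_le (by exact_mod_cast le_top))
    ((contDiffOn_smoothing k hv x hx).of_le (by exact_mod_cast le_top))
    (uniqueDiffOn_omegaBar n) hx

/-- The moment argument needs at least `κ` vanishing moments, that is `k ≥ κ`. The finitely many
smaller `k` are compared with `k = κ`, and the powers of 2 that arise are absorbed in the constant.
-/
theorem exists_norm_sub_smoothing_le (n b : ℕ) (a : ℝ) (hab : b < a) :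
    ∃ C : ℝ, 0 ≤ C ∧ ∀ (k : ℕ) (v : Rn n → Rn n), ContDiffOn ℝ ∞ v (OmegaBar n) →
      ∀ x ∈ OmegaBar n, ‖iteratedFDerivWithin ℝ b v (OmegaBar n) x -
        iteratedFDerivWithin ℝ b (smoothing k v) (OmegaBar n) x‖ ≤
        C * ((2 : ℝ) ^ (k * (b - a)) * holderNorm a v) := by
  have ha : 0 < a := lt_of_le_of_lt (Nat.cast_nonneg b) hab
  have hb : b ≤ holderOrder a := by
    have h1 : b < ⌈a⌉₊ := Nat.lt_ceil.2 hab
    rw [← holderOrder_add_one ha] at h1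
    omega
  obtain ⟨C₁, hC₁, h1⟩ := exists_norm_sub_smoothing_le_of_holder n (Rn n) (holderOrder a)
    (a - holderOrder a) (sub_holderOrder_mem ha) b hb
  obtain ⟨C₀, hC₀, h0⟩ := exists_norm_smoothing_le_of_bound n (Rn n) b
  set κ := holderOrder a with hκ
  set c : ℝ := (Fintype.card (Fin κ → Fin n) : ℝ)
  have h1' : ∀ (k : ℕ) (v : Rn n → Rn n), κ ≤ k → ContDiffOn ℝ ∞ v (OmegaBar n) →
      ∀ x ∈ OmegaBar n, ‖iteratedFDerivWithin ℝ b v (OmegaBar n) x -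
        iteratedFDerivWithin ℝ b (smoothing k v) (OmegaBar n) x‖ ≤
        C₁ * c * ((2 : ℝ) ^ (k * (b - a)) * holderNorm a v) := by
    intro k v hk hv x hx
    refine (h1 k v _ hk (mul_nonneg (Nat.cast_nonneg _) (holderNorm_nonneg a v)) hv
        (fun x hx y hy => norm_sub_le_holderNorm ha hv hy hx) x hx).trans (le_of_eq ?_)
    rw [add_sub_cancel]
    ring
  have h0' : ∀ (k : ℕ) (v : Rn n → Rn n), k ≤ κ → ContDiffOn ℝ ∞ v (OmegaBar n) →
      ∀ x ∈ OmegaBar n, ‖iteratedFDerivWithin ℝ b (smoothing k v) (OmegaBar n) x‖ ≤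
        C₀ * ((2 : ℝ) ^ ((κ : ℝ) * b) * holderNorm a v) := by
    intro k v hk hv x hx
    refine (h0 k v _ (holderNorm_nonneg a v) hv (fun x hx => norm_le_holderNorm a hv hx) x
      hx).trans ?_
    have := holderNorm_nonneg a v
    have : (k : ℝ) ≤ κ := Nat.cast_le.2 hk
    gcongr
    exact one_le_two
  set D : ℝ := C₁ * c * (2 : ℝ) ^ (κ * (b - a)) + C₀ * (2 : ℝ) ^ ((κ : ℝ) * b) +
    C₀ * (2 : ℝ) ^ ((κ : ℝ) * b) with hD
  have hD0 : 0 ≤ D := by positivity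
  refine ⟨C₁ * c + D * (2 : ℝ) ^ (κ * (a - b)), by positivity, fun k v hv x hx => ?_⟩
  have hN := holderNorm_nonneg a v
  rcases le_total κ k with hk | hk
  · refine (h1' k v hk hv x hx).trans ?_
    gcongr
    exact le_add_of_nonneg_right (by positivity)
  · have e : iteratedFDerivWithin ℝ b v (OmegaBar n) x -
        iteratedFDerivWithin ℝ b (smoothing k v) (OmegaBar n) x =
        (iteratedFDerivWithin ℝ b v (OmegaBar n) x -
          iteratedFDerivWithin ℝ b (smoothing κ v) (OmegaBar n) x) +
        iteratedFDerivWithin ℝ b (smoothing κ v) (OmegaBar n) x -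
        iteratedFDerivWithin ℝ b (smoothing k v) (OmegaBar n) x := by abel
    have h3 : ‖iteratedFDerivWithin ℝ b v (OmegaBar n) x -
        iteratedFDerivWithin ℝ b (smoothing k v) (OmegaBar n) x‖ ≤ D * holderNorm a v := by
      rw [e]
      refine (norm_sub_le _ _).trans ((add_le_add ((norm_add_le _ _).trans
        (add_le_add (h1' κ v le_rfl hv x hx) (h0' κ v le_rfl hv x hx)))
        (h0' k v hk hv x hx)).trans (le_of_eq ?_))
      rw [hD]
      ring
    refine h3.trans ?_
    have h4 : (1 : ℝ) ≤ (2 : ℝ) ^ (κ * (a - b)) * (2 : ℝ) ^ (k * (b - a)) := by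
      rw [← Real.rpow_add two_pos]
      refine Real.one_le_rpow one_le_two ?_
      have : (k : ℝ) ≤ κ := Nat.cast_le.2 hk
      nlinarith
    calc D * holderNorm a v = 0 + D * (1 * holderNorm a v) := by ring
      _ ≤ C₁ * c * ((2 : ℝ) ^ (k * (b - a)) * holderNorm a v) +
          D * ((2 : ℝ) ^ (κ * (a - b)) * (2 : ℝ) ^ (k * (b - a)) * holderNorm a v) := by
        gcongr
        positivity
      _ = _ := by ring

/-- The approximation estimate in Hölder norms. -/
theorem exists_holderNorm_sub_smoothing_le (n b : ℕ) (a : ℝ) (hab : b ≤ a) :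
    ∃ C : ℝ, 0 ≤ C ∧ ∀ (k : ℕ) (v : Rn n → Rn n), ContDiffOn ℝ ∞ v (OmegaBar n) →
      holderNorm (b : ℝ) (v - smoothing k v) ≤
        C * ((2 : ℝ) ^ (k * (b - a)) * holderNorm a v) := by
  rcases hab.eq_or_lt with rfl | hab
  -- For `a = b` nothing is gained and boundedness of the smoothing is enough; the Taylor argument
  -- needs `b` strictly below `a`.
  · obtain ⟨C, hC, h⟩ := exists_holderNorm_smoothing_le n b b (Nat.cast_nonneg b) le_rfl
    refine ⟨1 + C, by positivity, fun k v hv => ?_⟩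
    have h1 := h k v hv
    rw [sub_self, mul_zero, Real.rpow_zero, one_mul] at h1 ⊢
    have h2 := holderNorm_add_le (a := b) (Nat.cast_nonneg b) hv
      ((contDiffOn_smoothing k hv).const_smul (-1 : ℝ))
    have e : (v + fun y => (-1 : ℝ) • smoothing k v y) = v - smoothing k v := by
      ext1 y; simp [sub_eq_add_neg]
    have h3 := holderNorm_smul (b : ℝ) (contDiffOn_smoothing k hv) (-1)
    have e' : ((-1 : ℝ) • smoothing k v) = fun y => (-1 : ℝ) • smoothing k v y := rfl
    rw [abs_neg, abs_one, one_mul, e'] at h3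
    rw [e, h3] at h2
    linarith
  · obtain ⟨C₁, hC₁, h1⟩ := exists_norm_sub_smoothing_le n b a hab
    obtain ⟨C₀, hC₀, h0⟩ := exists_norm_sub_smoothing_le n 0 a
      (by simpa using lt_of_le_of_lt (Nat.cast_nonneg b) hab)
    obtain ⟨C₂, hC₂, h2⟩ := exists_holderNorm_nat_le n b
    refine ⟨C₂ * (C₀ + C₁), by positivity, fun k v hv => ?_⟩
    have hN := holderNorm_nonneg a v
    rw [mul_assoc]
    refine h2 _ _ (by positivity) (hv.sub (contDiffOn_smoothing k hv)) (fun x hx => ?_)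
      (fun x hx => ?_)
    · have h3 := h0 k v hv x hx
      rw [← iteratedFDerivWithin_sub_smoothing k 0 hv hx, norm_iteratedFDerivWithin_zero] at h3
      refine h3.trans ?_
      have h4 : (2 : ℝ) ^ (k * (((0 : ℕ) : ℝ) - a)) ≤ (2 : ℝ) ^ (k * (b - a)) := by
        refine Real.rpow_le_rpow_of_exponent_le one_le_two ?_
        gcongr
        exact Nat.zero_le b
      have : C₀ ≤ C₀ + C₁ := le_add_of_nonneg_right hC₁
      gcongr
    · rw [iteratedFDerivWithin_sub_smoothing k b hv hx]
      refine (h1 k v hv x hx).trans ?_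
      gcongr
      exact le_add_of_nonneg_left hC₀

end holderNorm
end NashMoser
end

/-! ### Functions of time and space: norms and smoothing at each time. -/

noncomputable section
namespace NashMoser
open MeasureTheory

section time
variable {n : ℕ} {T : ℝ} {u v : Fun n T} {k : ℕ∞} {j J : ℕ} {t : ℝ} {x : Rn n}

theorem extend_add (u v : Fun n T) (t : ℝ) (x : Rn n) :
    extend (u + v) t x = extend u t x + extend v t x := by
  unfold extend; split_ifs <;> simp

theorem extend_smul (c : ℝ) (u : Fun n T) (t : ℝ) (x : Rn n) :
    extend (c • u) t x = c • extend u t x := by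
  unfold extend; split_ifs <;> simp

theorem extend_of_mem (u : Fun n T) (ht : t ∈ Icc (0 : ℝ) T) (hx : x ∈ OmegaBar n) :
    extend u t x = u (⟨t, ht⟩, ⟨x, hx⟩) := dif_pos ⟨ht, hx⟩

theorem timeDeriv_zero (u : Fun n T) : timeDeriv 0 u = extend u := by
  ext1 t; ext1 x; simp [timeDeriv]

theorem IsCkCinf.mono {k l : ℕ∞} (h : IsCkCinf k u) (hl : l ≤ k) : IsCkCinf l u :=
  ⟨fun x hx => (h.1 x hx).of_le (by exact_mod_cast hl), fun j hj => h.2 j (hj.trans hl)⟩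

theorem timeDeriv_add (hT : 0 < T) (hu : IsCkCinf k u) (hv : IsCkCinf k v) (hj : (j : ℕ∞) ≤ k)
    (ht : t ∈ Icc (0 : ℝ) T) (hx : x ∈ OmegaBar n) :
    timeDeriv j (u + v) t x = timeDeriv j u t x + timeDeriv j v t x := by
  have e : (fun s => extend (u + v) s x) = (fun s => extend u s x) + fun s => extend v s x :=
    funext fun s => extend_add u v s x
  rw [timeDeriv, e, iteratedDerivWithin_add ht (uniqueDiffOn_Icc hT)
    ((hu.1 x hx t ht).of_le (by exact_mod_cast hj)) ((hv.1 x hx t ht).of_le (by exact_mod_cast hj))]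
  rfl

theorem timeDeriv_smul (hT : 0 < T) (hu : IsCkCinf k u) (c : ℝ) (hj : (j : ℕ∞) ≤ k)
    (ht : t ∈ Icc (0 : ℝ) T) (hx : x ∈ OmegaBar n) :
    timeDeriv j (c • u) t x = c • timeDeriv j u t x := by
  have e : (fun s => extend (c • u) s x) = c • (fun s => extend u s x) :=
    funext fun s => extend_smul c u s x
  rw [timeDeriv, e, iteratedDerivWithin_const_smul ht (uniqueDiffOn_Icc hT) c
    ((hu.1 x hx t ht).of_le (by exact_mod_cast hj))]
  rfl

theorem IsCkCinf.add (hT : 0 < T) (hu : IsCkCinf k u) (hv : IsCkCinf k v) :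
    IsCkCinf k (u + v) := by
  refine ⟨fun x hx => ?_, fun j hj => ⟨fun t ht => ?_, fun i => ?_⟩⟩
  · exact ((hu.1 x hx).add (hv.1 x hx)).congr fun s _ => extend_add u v s x
  · exact (((hu.2 j hj).1 t ht).add ((hv.2 j hj).1 t ht)).congr
      fun x hx => timeDeriv_add hT hu hv hj ht hx
  · refine (((hu.2 j hj).2 i).add ((hv.2 j hj).2 i)).congr fun p hp => ?_
    have e : EqOn (timeDeriv j (u + v) p.1) (timeDeriv j u p.1 + timeDeriv j v p.1)
        (OmegaBar n) := fun x hx => timeDeriv_add hT hu hv hj hp.1 hx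
    rw [iteratedFDerivWithin_congr e hp.2]
    exact iteratedFDerivWithin_add_omegaBar ((hu.2 j hj).1 _ hp.1) ((hv.2 j hj).1 _ hp.1) i hp.2

theorem IsCkCinf.smul (hT : 0 < T) (hu : IsCkCinf k u) (c : ℝ) : IsCkCinf k (c • u) := by
  refine ⟨fun x hx => ?_, fun j hj => ⟨fun t ht => ?_, fun i => ?_⟩⟩
  · exact ((hu.1 x hx).const_smul c).congr fun s _ => extend_smul c u s x
  · exact (((hu.2 j hj).1 t ht).const_smul c).congr
      fun x hx => timeDeriv_smul hT hu c hj ht hx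
  · refine (((hu.2 j hj).2 i).const_smul c).congr fun p hp => ?_
    have e : EqOn (timeDeriv j (c • u) p.1) (c • timeDeriv j u p.1)
        (OmegaBar n) := fun x hx => timeDeriv_smul hT hu c hj hp.1 hx
    rw [iteratedFDerivWithin_congr e hp.2]
    exact iteratedFDerivWithin_smul_omegaBar ((hu.2 j hj).1 _ hp.1) c i hp.2

theorem extend_zero (t : ℝ) (x : Rn n) : extend (0 : Fun n T) t x = 0 := by
  unfold extend; split_ifs <;> rfl

theorem timeDeriv_zero_fun (j : ℕ) : timeDeriv j (0 : Fun n T) = fun _ _ => 0 := by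
  ext1 t; ext1 x
  have e : (fun s => extend (0 : Fun n T) s x) = fun _ => 0 := funext fun s => extend_zero s x
  rw [timeDeriv, e]
  simp

theorem isCkCinf_zero (k : ℕ∞) : IsCkCinf k (0 : Fun n T) := by
  refine ⟨fun x _ => ?_, fun j _ => ⟨fun t _ => ?_, fun i => ?_⟩⟩
  · exact contDiffOn_const (c := (0 : Rn n)) |>.congr fun s _ => extend_zero s x
  · rw [timeDeriv_zero_fun]; exact contDiffOn_const
  · simp only [timeDeriv_zero_fun]
    refine (continuousOn_const (c := (0 : Rn n [×i]→L[ℝ] Rn n))).congr fun p _ => ?_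
    exact congrFun iteratedFDerivWithin_fun_zero p.2

/-- The space `C^k([0,T], C^∞(Ω̄))`. -/
def ckCinf (n : ℕ) {T : ℝ} (hT : 0 < T) (k : ℕ∞) : Submodule ℝ (Fun n T) where
  carrier := {u | IsCkCinf k u}
  add_mem' := IsCkCinf.add hT
  zero_mem' := isCkCinf_zero k
  smul_mem' c _ hu := hu.smul hT c

theorem IsCkCinf.exists_bound (hu : IsCkCinf k u) (hj : (j : ℕ∞) ≤ k) (i : ℕ) :
    ∃ M : ℝ, 0 ≤ M ∧ ∀ t ∈ Icc (0 : ℝ) T, ∀ x ∈ OmegaBar n,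
      ‖iteratedFDerivWithin ℝ i (timeDeriv j u t) (OmegaBar n) x‖ ≤ M := by
  obtain ⟨M, hM⟩ := ((isCompact_Icc (a := (0 : ℝ)) (b := T)).prod
    (isCompact_omegaBar n)).exists_bound_of_continuousOn ((hu.2 j hj).2 i)
  exact ⟨max M 0, le_max_right _ _, fun t ht x hx => (hM (t, x) ⟨ht, hx⟩).trans (le_max_left _ _)⟩

theorem IsCkCinf.exists_holderNorm_le (hu : IsCkCinf k u) (hj : (j : ℕ∞) ≤ k) {a : ℝ}
    (ha : 0 ≤ a) : ∃ M : ℝ, ∀ t ∈ Icc (0 : ℝ) T, holderNorm a (timeDeriv j u t) ≤ M := by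
  obtain ⟨M₀, hM₀, h0⟩ := hu.exists_bound hj 0
  simp only [norm_iteratedFDerivWithin_zero] at h0
  rcases ha.eq_or_lt with rfl | ha
  · exact ⟨M₀, fun t ht => holderNorm_zero_le (h0 t ht)⟩
  · obtain ⟨M₁, hM₁, h1⟩ := hu.exists_bound hj (holderOrder a + 1)
    refine ⟨_, fun t ht => holderNorm_le' ha (H := M₁ * 2) (by positivity)
      (fun x hx y hy => ?_) (h0 t ht)⟩
    refine (norm_iteratedFDerivWithin_sub_le ((hu.2 j hj).1 t ht) _ (h1 t ht) hx hy).trans ?_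
    rw [mul_assoc]
    gcongr
    exact le_mul_rpow_of_le_two (norm_nonneg _) (norm_sub_le_two hx hy) (sub_holderOrder_mem ha)

theorem IsCkCinf.bddAbove_tnorm (hu : IsCkCinf J u) {a : ℝ} (ha : 0 ≤ a) :
    BddAbove (range fun t : Icc (0 : ℝ) T =>
      ∑ j ∈ Finset.range (J + 1), holderNorm a (timeDeriv j u t)) := by
  have : ∀ j ∈ Finset.range (J + 1), ∃ M : ℝ, ∀ t ∈ Icc (0 : ℝ) T,
      holderNorm a (timeDeriv j u t) ≤ M := fun j hj =>
    hu.exists_holderNorm_le (by exact_mod_cast Nat.lt_succ_iff.1 (Finset.mem_range.1 hj)) ha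
  choose! M hM using this
  refine ⟨∑ j ∈ Finset.range (J + 1), M j, ?_⟩
  rintro _ ⟨t, rfl⟩
  exact Finset.sum_le_sum fun j hj => hM j hj t t.2

theorem tnorm_nonneg (a : ℝ) (J : ℕ) (u : Fun n T) : 0 ≤ tnorm a J u :=
  Real.iSup_nonneg fun _ => Finset.sum_nonneg fun _ _ => holderNorm_nonneg _ _

theorem sum_holderNorm_le_tnorm (hu : IsCkCinf J u) {a : ℝ} (ha : 0 ≤ a)
    (ht : t ∈ Icc (0 : ℝ) T) :
    ∑ j ∈ Finset.range (J + 1), holderNorm a (timeDeriv j u t) ≤ tnorm a J u :=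
  le_ciSup (hu.bddAbove_tnorm ha) (⟨t, ht⟩ : Icc (0 : ℝ) T)

theorem holderNorm_le_tnorm (hu : IsCkCinf J u) {a : ℝ} (ha : 0 ≤ a)
    (ht : t ∈ Icc (0 : ℝ) T) (hj : j ≤ J) : holderNorm a (timeDeriv j u t) ≤ tnorm a J u :=
  (Finset.single_le_sum (f := fun j => holderNorm a (timeDeriv j u t))
    (fun _ _ => holderNorm_nonneg _ _)
    (Finset.mem_range.2 (Nat.lt_succ_of_le hj))).trans (sum_holderNorm_le_tnorm hu ha ht)

theorem tnorm_le (hT : 0 < T) {a M : ℝ} (h : ∀ t ∈ Icc (0 : ℝ) T,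
    ∑ j ∈ Finset.range (J + 1), holderNorm a (timeDeriv j u t) ≤ M) : tnorm a J u ≤ M := by
  have : Nonempty (Icc (0 : ℝ) T) := ⟨⟨0, le_rfl, hT.le⟩⟩
  exact ciSup_le fun t => h t t.2

theorem tnorm_le_mul (hT : 0 < T) {a b c : ℝ} (hc : 0 ≤ c) (ha : 0 ≤ a) (hu : IsCkCinf J u)
    (h : ∀ t ∈ Icc (0 : ℝ) T, ∀ j ≤ J,
      holderNorm b (timeDeriv j v t) ≤ c * holderNorm a (timeDeriv j u t)) :
    tnorm b J v ≤ c * tnorm a J u := by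
  refine tnorm_le hT fun t ht => ?_
  refine le_trans ?_ (mul_le_mul_of_nonneg_left (sum_holderNorm_le_tnorm hu ha ht) hc)
  rw [Finset.mul_sum]
  exact Finset.sum_le_sum fun j hj => h t ht j (Nat.lt_succ_iff.1 (Finset.mem_range.1 hj))

theorem tnorm_add_le (hT : 0 < T) {a : ℝ} (ha : 0 ≤ a) (hu : IsCkCinf J u) (hv : IsCkCinf J v) :
    tnorm a J (u + v) ≤ tnorm a J u + tnorm a J v := by
  refine tnorm_le hT fun t ht => ?_
  refine le_trans ?_ (add_le_add (sum_holderNorm_le_tnorm hu ha ht)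
    (sum_holderNorm_le_tnorm hv ha ht))
  rw [← Finset.sum_add_distrib]
  refine Finset.sum_le_sum fun j hj => ?_
  have hj' : (j : ℕ∞) ≤ J := by exact_mod_cast Nat.lt_succ_iff.1 (Finset.mem_range.1 hj)
  rw [holderNorm_congr a (w := timeDeriv j u t + timeDeriv j v t)
    fun x hx => timeDeriv_add hT hu hv hj' ht hx]
  exact holderNorm_add_le ha ((hu.2 j hj').1 t ht) ((hv.2 j hj').1 t ht)

theorem tnorm_smul (hT : 0 < T) (a : ℝ) (hu : IsCkCinf J u) (c : ℝ) :
    tnorm a J (c • u) = |c| * tnorm a J u := by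
  rw [tnorm, tnorm, Real.mul_iSup_of_nonneg (abs_nonneg c)]
  congr 1
  ext1 t
  rw [Finset.mul_sum]
  refine Finset.sum_congr rfl fun j hj => ?_
  have hj' : (j : ℕ∞) ≤ J := by exact_mod_cast Nat.lt_succ_iff.1 (Finset.mem_range.1 hj)
  rw [holderNorm_congr a (w := c • timeDeriv j u t)
    fun x hx => timeDeriv_smul hT hu c hj' t.2 hx]
  exact holderNorm_smul a ((hu.2 j hj').1 t t.2) c

theorem exists_tnorm_le_interp (n : ℕ) {T : ℝ} (hT : 0 < T) (J m : ℕ) (a : ℝ)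
    (ha : a ∈ Ioo (m : ℝ) (m + 1)) :
    ∃ C : ℝ, 0 ≤ C ∧ ∀ (u : Fun n T) (R : ℝ), 1 ≤ R → IsCkCinf J u →
      tnorm a J u ≤ C * (R ^ (a - m) * tnorm (m : ℝ) J u +
        R ^ (a - (m + 1)) * tnorm ((m + 1 : ℕ) : ℝ) J u) := by
  obtain ⟨C, hC, h⟩ := exists_holderNorm_le_interp n m a ha
  refine ⟨C, hC, fun u R hR hu => tnorm_le hT fun t ht => ?_⟩
  have hR0 : 0 < R := by linarith
  have h1 := sum_holderNorm_le_tnorm hu (Nat.cast_nonneg (α := ℝ) m) ht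
  have h2 := sum_holderNorm_le_tnorm hu (Nat.cast_nonneg (α := ℝ) (m + 1)) ht
  calc _ ≤ ∑ j ∈ Finset.range (J + 1), C * (R ^ (a - m) * holderNorm (m : ℝ) (timeDeriv j u t) +
        R ^ (a - (m + 1)) * holderNorm ((m + 1 : ℕ) : ℝ) (timeDeriv j u t)) :=
        Finset.sum_le_sum fun j hj => h _ R hR ((hu.2 j (by
          exact_mod_cast Nat.lt_succ_iff.1 (Finset.mem_range.1 hj))).1 t ht)
    _ = C * (R ^ (a - m) * ∑ j ∈ Finset.range (J + 1), holderNorm (m : ℝ) (timeDeriv j u t) +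
        R ^ (a - (m + 1)) * ∑ j ∈ Finset.range (J + 1),
          holderNorm ((m + 1 : ℕ) : ℝ) (timeDeriv j u t)) := by
        rw [← Finset.mul_sum, Finset.sum_add_distrib, ← Finset.mul_sum, ← Finset.mul_sum]
    _ ≤ _ := by gcongr

theorem IsCkCinf.continuousOn_timeDeriv (hu : IsCkCinf k u) (hj : (j : ℕ∞) ≤ k) :
    ContinuousOn (fun p : ℝ × Rn n => timeDeriv j u p.1 p.2) (Icc (0 : ℝ) T ×ˢ OmegaBar n) :=
  ((continuousMultilinearCurryFin0 ℝ (Rn n) (Rn n)).continuous.comp_continuousOn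
    ((hu.2 j hj).2 0)).congr fun _ _ => rfl

theorem IsCkCinf.hasDerivWithinAt_timeDeriv (hT : 0 < T) (hu : IsCkCinf k u)
    (hj : ((j + 1 : ℕ) : ℕ∞) ≤ k) (ht : t ∈ Icc (0 : ℝ) T) (hx : x ∈ OmegaBar n) :
    HasDerivWithinAt (fun s => timeDeriv j u s x) (timeDeriv (j + 1) u t x) (Icc 0 T) t := by
  have h1 := (hu.1 x hx).differentiableOn_iteratedDerivWithin (m := j)
    (by exact_mod_cast lt_of_lt_of_le (by exact_mod_cast Nat.lt_succ_self j) hj)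
    (uniqueDiffOn_Icc hT) t ht
  have h2 := h1.hasDerivWithinAt
  rw [timeDeriv, iteratedDerivWithin_succ]
  exact h2

theorem continuousOn_avg_param {G : Type*} [NormedAddCommGroup G] [NormedSpace ℝ G]
    {φ : Rn n → ℝ} (hφ : Continuous φ) {r : ℝ} (hr : r ∈ Icc (0 : ℝ) 1)
    {w : ℝ → Rn n → G} (hw : ContinuousOn (fun p : ℝ × Rn n => w p.1 p.2)
      (Icc (0 : ℝ) T ×ˢ OmegaBar n)) :
    ContinuousOn (fun p : ℝ × Rn n => avg φ r (w p.1) p.2) (Icc (0 : ℝ) T ×ˢ OmegaBar n) := by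
  obtain ⟨M, hM⟩ := ((isCompact_Icc (a := (0 : ℝ)) (b := T)).prod
    (isCompact_omegaBar n)).exists_bound_of_continuousOn hw
  have hslice : ∀ t ∈ Icc (0 : ℝ) T, ContinuousOn (w t) (OmegaBar n) := fun t ht =>
    hw.comp (f := fun x => (t, x)) (by fun_prop) fun x hx => ⟨ht, hx⟩
  refine continuousOn_of_dominated (bound := fun z => |φ z| * M) (fun p hp => ?_)
    (fun p hp => ?_) ?_ ?_
  · exact (integrableOn_avg_integrand hφ hr (hslice _ hp.1) hp.2).aestronglyMeasurable
  · filter_upwards [ae_restrict_mem measurableSet_closedBall] with z hz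
    rw [norm_smul, Real.norm_eq_abs]
    exact mul_le_mul_of_nonneg_left
      (hM (p.1, p.2 + r • (z - p.2)) ⟨hp.1, mem_omegaBar_of_segment hr hp.2 hz⟩) (abs_nonneg _)
  · exact ((hφ.abs.continuousOn).integrableOn_compact (isCompact_omegaBar n)).mul_const _
  · filter_upwards [ae_restrict_mem measurableSet_closedBall] with z hz
    refine ContinuousOn.const_smul ?_ _
    exact hw.comp (f := fun p : ℝ × Rn n => (p.1, p.2 + r • (z - p.2))) (by fun_prop)
      fun p hp => ⟨hp.1, mem_omegaBar_of_segment hr hp.2 hz⟩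

theorem hasDerivWithinAt_avg_param {φ : Rn n → ℝ} (hφ : Continuous φ) {r : ℝ}
    (hr : r ∈ Icc (0 : ℝ) 1) {w w' : ℝ → Rn n → Rn n}
    (hw : ContinuousOn (fun p : ℝ × Rn n => w p.1 p.2) (Icc (0 : ℝ) T ×ˢ OmegaBar n))
    (hw' : ContinuousOn (fun p : ℝ × Rn n => w' p.1 p.2) (Icc (0 : ℝ) T ×ˢ OmegaBar n))
    (h : ∀ t ∈ Icc (0 : ℝ) T, ∀ x ∈ OmegaBar n,
      HasDerivWithinAt (fun s => w s x) (w' t x) (Icc 0 T) t)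
    (ht : t ∈ Icc (0 : ℝ) T) (hx : x ∈ OmegaBar n) :
    HasDerivWithinAt (fun s => avg φ r (w s) x) (avg φ r (w' t) x) (Icc 0 T) t := by
  obtain ⟨M, hM⟩ := ((isCompact_Icc (a := (0 : ℝ)) (b := T)).prod
    (isCompact_omegaBar n)).exists_bound_of_continuousOn hw'
  have hslice : ∀ {w : ℝ → Rn n → Rn n}, ContinuousOn (fun p : ℝ × Rn n => w p.1 p.2)
      (Icc (0 : ℝ) T ×ˢ OmegaBar n) → ∀ t ∈ Icc (0 : ℝ) T, ContinuousOn (w t) (OmegaBar n) :=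
    fun hw t ht => hw.comp (f := fun x => (t, x)) (by fun_prop) fun x hx => ⟨ht, hx⟩
  have hint := integrableOn_avg_integrand hφ hr (hslice hw' t ht) hx
  have hL : Continuous fun y : Rn n => ContinuousLinearMap.toSpanSingleton ℝ y :=
    (ContinuousLinearMap.toSpanSingletonCLE (𝕜 := ℝ) (E := Rn n)).continuous
  have key := hasFDerivWithinAt_integral_of_convex (ν := volume.restrict (OmegaBar n))
    (convex_Icc (0 : ℝ) T) (F := fun s z => φ z • w s (x + r • (z - x)))
    (F' := fun s z => ContinuousLinearMap.toSpanSingleton ℝ (φ z • w' s (x + r • (z - x))))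
    (bound := fun z => |φ z| * M) (x₀ := t)
    (((hφ.abs.continuousOn).integrableOn_compact (isCompact_omegaBar n)).mul_const _)
    (fun s hs => integrableOn_avg_integrand hφ hr (hslice hw s hs) hx) ht
    (hL.comp_aestronglyMeasurable hint.aestronglyMeasurable) ?_
  · have := key.hasDerivWithinAt
    refine this.congr_deriv ?_
    have hint' : Integrable (fun z => ContinuousLinearMap.toSpanSingleton ℝ
        (φ z • w' t (x + r • (z - x)))) (volume.restrict (OmegaBar n)) := by
      exact (ContinuousLinearMap.toSpanSingletonCLE (𝕜 := ℝ) (E := Rn n)).toContinuousLinearMap.integrable_comp hint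
    rw [ContinuousLinearMap.integral_apply hint']
    simp [avg]
  · filter_upwards [ae_restrict_mem measurableSet_closedBall] with z hz s hs
    have hy := mem_omegaBar_of_segment hr hx hz
    refine ⟨((h s hs _ hy).const_smul (φ z)).hasFDerivWithinAt, ?_⟩
    rw [ContinuousLinearMap.norm_toSpanSingleton, norm_smul, Real.norm_eq_abs]
    exact mul_le_mul_of_nonneg_left (hM (s, _) ⟨hs, hy⟩) (abs_nonneg _)

/-- The smoothing operators, acting at each time. -/
def smoothFun (k : ℕ) (u : Fun n T) : Fun n T := fun p => smoothing k (extend u p.1) p.2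

theorem extend_smoothFun (l : ℕ) (u : Fun n T) (ht : t ∈ Icc (0 : ℝ) T) (hx : x ∈ OmegaBar n) :
    extend (smoothFun l u) t x = smoothing l (extend u t) x := extend_of_mem _ ht hx

theorem hasDerivWithinAt_smoothing_timeDeriv (hT : 0 < T) (l : ℕ) (hu : IsCkCinf k u)
    (hj : ((j + 1 : ℕ) : ℕ∞) ≤ k) (ht : t ∈ Icc (0 : ℝ) T) (hx : x ∈ OmegaBar n) :
    HasDerivWithinAt (fun s => smoothing l (timeDeriv j u s) x)
      (smoothing l (timeDeriv (j + 1) u t) x) (Icc 0 T) t := by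
  have hj' : (j : ℕ∞) ≤ k := le_trans (by exact_mod_cast Nat.le_succ j) hj
  exact HasDerivWithinAt.fun_sum fun i hi => (hasDerivWithinAt_avg_param
    (contDiff_bump n).continuous (radius_mem_Icc hi) (hu.continuousOn_timeDeriv hj')
    (hu.continuousOn_timeDeriv hj) (fun t ht x hx => hu.hasDerivWithinAt_timeDeriv hT hj ht hx)
    ht hx).const_smul (coef l i)

/-- The smoothing acts in `x` alone, so time derivatives pass under the integral. This transfers all
spatial estimates to the norms with time derivatives. -/
theorem timeDeriv_smoothFun (hT : 0 < T) (l : ℕ) (hu : IsCkCinf k u) (hj : (j : ℕ∞) ≤ k)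
    (ht : t ∈ Icc (0 : ℝ) T) (hx : x ∈ OmegaBar n) :
    timeDeriv j (smoothFun l u) t x = smoothing l (timeDeriv j u t) x := by
  induction j generalizing t with
  | zero => rw [timeDeriv_zero, timeDeriv_zero, extend_smoothFun l u ht hx]
  | succ j ih =>
    have hj' : (j : ℕ∞) ≤ k := le_trans (by exact_mod_cast Nat.le_succ j) hj
    rw [timeDeriv, iteratedDerivWithin_succ]
    have h1 := (hasDerivWithinAt_smoothing_timeDeriv hT l hu hj ht hx).congr
      (f₁ := iteratedDerivWithin j (fun s => extend (smoothFun l u) s x) (Icc 0 T))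
      (fun s hs => ih hj' hs) (ih hj' ht)
    exact h1.derivWithin (uniqueDiffOn_Icc hT t ht)

theorem IsCkCinf.smoothFun (hT : 0 < T) (l : ℕ) (hu : IsCkCinf ⊤ u) :
    IsCkCinf ⊤ (smoothFun l u) := by
  refine ⟨fun x hx => ?_, fun j hj => ⟨fun t ht => ?_, fun i => ?_⟩⟩
  · refine contDiffOn_of_differentiableOn_deriv fun m _ t ht => ?_
    exact ((hasDerivWithinAt_smoothing_timeDeriv hT l hu (j := m) le_top ht
      hx).differentiableWithinAt).congr (fun s hs => timeDeriv_smoothFun hT l hu le_top hs hx)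
      (timeDeriv_smoothFun hT l hu le_top ht hx)
  · exact (contDiffOn_smoothing l ((hu.2 j hj).1 t ht)).congr
      fun x hx => timeDeriv_smoothFun hT l hu hj ht hx
  · have h1 : ContinuousOn (fun p : ℝ × Rn n => ∑ q ∈ Finset.range (l + 1),
        (coef l q * (1 - radius l q) ^ i) • avg (bump n) (radius l q)
          (iteratedFDerivWithin ℝ i (timeDeriv j u p.1) (OmegaBar n)) p.2)
        (Icc (0 : ℝ) T ×ˢ OmegaBar n) :=
      continuousOn_finsetSum _ fun q hq => ContinuousOn.fun_const_smul (continuousOn_avg_param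
        (w := fun s => iteratedFDerivWithin ℝ i (timeDeriv j u s) (OmegaBar n))
        (contDiff_bump n).continuous (radius_mem_Icc hq) ((hu.2 j hj).2 i))
        (coef l q * (1 - radius l q) ^ i)
    refine h1.congr fun p hp => ?_
    simp only
    rw [iteratedFDerivWithin_congr (fun x hx => timeDeriv_smoothFun hT l hu hj hp.1 hx) hp.2]
    exact iteratedFDerivWithin_smoothing l i ((hu.2 j hj).1 _ hp.1) hp.2

theorem IsCkCinf.continuousOn_extend (hu : IsCkCinf k u) (ht : t ∈ Icc (0 : ℝ) T) :
    ContinuousOn (extend u t) (OmegaBar n) := by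
  have := ((hu.2 0 (by simp)).1 t ht).continuousOn
  rwa [timeDeriv_zero] at this

theorem smoothFun_sub (l : ℕ) (hu : IsCkCinf k u) (hv : IsCkCinf k v) :
    smoothFun l (u - v) = smoothFun l u - smoothFun l v := by
  ext1 p
  have e : extend (u - v) p.1 = fun y => extend u p.1 y - extend v p.1 y := by
    ext1 y
    rw [sub_eq_add_neg, ← neg_one_smul ℝ v, extend_add, extend_smul]
    simp [sub_eq_add_neg]
  rw [smoothFun, e, smoothing_sub l (hu.continuousOn_extend p.1.2) (hv.continuousOn_extend p.1.2)
    p.2.2]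
  rfl

theorem exists_tnorm_smoothFun_le (n : ℕ) {T : ℝ} (hT : 0 < T) (J b : ℕ) (a : ℝ) (ha : 0 ≤ a)
    (hab : a ≤ b) :
    ∃ C : ℝ, 0 ≤ C ∧ ∀ (k : ℕ) (u : Fun n T), IsCkCinf ⊤ u →
      tnorm (b : ℝ) J (smoothFun k u) ≤ C * ((2 : ℝ) ^ (k * (b - a)) * tnorm a J u) := by
  obtain ⟨C, hC, h⟩ := exists_holderNorm_smoothing_le n b a ha hab
  refine ⟨C, hC, fun k u hu => ?_⟩
  rw [← mul_assoc]
  refine tnorm_le_mul hT (by positivity) ha (hu.mono le_top) fun t ht j _ => ?_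
  rw [holderNorm_congr _ fun x hx => timeDeriv_smoothFun hT k hu le_top ht hx, mul_assoc]
  exact h k _ ((hu.2 j le_top).1 t ht)

theorem exists_tnorm_sub_smoothFun_le (n : ℕ) {T : ℝ} (hT : 0 < T) (J b : ℕ) (a : ℝ)
    (hab : b ≤ a) :
    ∃ C : ℝ, 0 ≤ C ∧ ∀ (k : ℕ) (u : Fun n T), IsCkCinf ⊤ u →
      tnorm (b : ℝ) J (u - smoothFun k u) ≤ C * ((2 : ℝ) ^ (k * (b - a)) * tnorm a J u) := by
  obtain ⟨C, hC, h⟩ := exists_holderNorm_sub_smoothing_le n b a hab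
  refine ⟨C, hC, fun k u hu => ?_⟩
  rw [← mul_assoc]
  refine tnorm_le_mul hT (by positivity) ((Nat.cast_nonneg b).trans hab) (hu.mono le_top)
    fun t ht j _ => ?_
  have e : EqOn (timeDeriv j (u - smoothFun k u) t)
      (timeDeriv j u t - smoothing k (timeDeriv j u t)) (OmegaBar n) := fun x hx => by
    have hs := hu.smoothFun hT k
    rw [sub_eq_add_neg, ← neg_one_smul ℝ (smoothFun k u),
      timeDeriv_add hT hu (hs.smul hT _) le_top ht hx, timeDeriv_smul hT hs _ le_top ht hx,
      timeDeriv_smoothFun hT k hu le_top ht hx]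
    simp [sub_eq_add_neg]
  rw [holderNorm_congr _ e, mul_assoc]
  exact h k _ ((hu.2 j le_top).1 t ht)

end time
end NashMoser
end

/-! ### The abstract iteration and its estimates. -/

noncomputable section
namespace NashMoser

/-- `2^{k x}`. -/
def scale (k : ℕ) (x : ℝ) : ℝ := (2 : ℝ) ^ ((k : ℝ) * x)

theorem scale_pos (k : ℕ) (x : ℝ) : 0 < scale k x := Real.rpow_pos_of_pos two_pos _

theorem scale_add (k : ℕ) (x y : ℝ) : scale k (x + y) = scale k x * scale k y := by
  rw [scale, mul_add, Real.rpow_add two_pos]; rfl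

theorem scale_le (k : ℕ) {x y : ℝ} (h : x ≤ y) : scale k x ≤ scale k y :=
  Real.rpow_le_rpow_of_exponent_le one_le_two (mul_le_mul_of_nonneg_left h (Nat.cast_nonneg k))

theorem scale_zero_left (x : ℝ) : scale 0 x = 1 := by simp [scale]

theorem scale_zero_right (k : ℕ) : scale k 0 = 1 := by simp [scale]

theorem scale_le_one (k : ℕ) {x : ℝ} (h : x ≤ 0) : scale k x ≤ 1 :=
  (scale_le k h).trans_eq (scale_zero_right k)

theorem one_le_scale (k : ℕ) {x : ℝ} (h : 0 ≤ x) : 1 ≤ scale k x :=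
  (scale_zero_right k).symm.trans_le (scale_le k h)

theorem scale_succ (k : ℕ) (x : ℝ) : scale (k + 1) x = 2 ^ x * scale k x := by
  rw [scale, scale, ← Real.rpow_add two_pos]
  congr 1
  push_cast
  ring

theorem scale_eq_pow (k : ℕ) (x : ℝ) : scale k x = ((2 : ℝ) ^ x) ^ k := by
  rw [scale, mul_comm, Real.rpow_mul two_pos.le, Real.rpow_natCast]

theorem exists_sum_scale_le_of_pos {x : ℝ} (hx : 0 < x) :
    ∃ C : ℝ, 0 ≤ C ∧ ∀ k, ∑ j ∈ Finset.range k, scale j x ≤ C * scale k x := by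
  have hq : (1 : ℝ) < 2 ^ x := Real.one_lt_rpow one_lt_two hx
  refine ⟨(2 ^ x - 1)⁻¹, inv_nonneg.2 (by linarith), fun k => ?_⟩
  induction k with
  | zero => simpa using mul_nonneg (inv_nonneg.2 (by linarith)) (scale_pos 0 x).le
  | succ k ih =>
    rw [Finset.sum_range_succ, scale_succ]
    have h1 : ((2 : ℝ) ^ x - 1)⁻¹ * (2 ^ x * scale k x) =
        (2 ^ x - 1)⁻¹ * scale k x + scale k x := by
      have : (2 : ℝ) ^ x - 1 ≠ 0 := by linarith
      field_simp
      ring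
    linarith

theorem summable_scale {x : ℝ} (hx : x < 0) : Summable fun k => scale k x := by
  simp only [scale_eq_pow]
  exact summable_geometric_of_lt_one (by positivity) (Real.rpow_lt_one_of_one_lt_of_neg one_lt_two hx)

theorem exists_sum_scale_le_of_neg {x : ℝ} (hx : x < 0) :
    ∃ C : ℝ, 0 ≤ C ∧ ∀ k, ∑ j ∈ Finset.range k, scale j x ≤ C :=
  ⟨∑' j, scale j x, tsum_nonneg fun j => (scale_pos j x).le, fun _ =>
    (summable_scale hx).sum_le_tsum _ fun j _ => (scale_pos j x).le⟩

theorem tendsto_scale {x : ℝ} (hx : x < 0) : Tendsto (fun k => scale k x) atTop (𝓝 0) :=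
  (summable_scale hx).tendsto_atTop_zero

/-- The data of the Nash–Moser iteration in a scale of norms `P m` on the unknowns and `Q m` on
the right-hand sides, with smoothing operators `S k` at scale `2^{-k}`. -/
structure TameData (V : Type*) [AddCommGroup V] [Module ℝ V] where
  X : Submodule ℝ V
  P : ℕ → V → ℝ
  Q : ℕ → V → ℝ
  S : ℕ → V → V
  N : V → ℝ
  Φ : V → V
  D : V → V → V
  ψ : V → V → V
  μ : ℕ
  l : ℕ
  d : ℕ
  α : ℝ
  hμ : μ < α
  hd : d < α
  hl : l + 2 * μ < α
  P_nonneg : ∀ m u, 0 ≤ P m u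
  Q_nonneg : ∀ m u, 0 ≤ Q m u
  N_nonneg : ∀ u, 0 ≤ N u
  P_zero : ∀ m, P m 0 = 0
  Q_zero : ∀ m, Q m 0 = 0
  P_add : ∀ m, ∀ u ∈ X, ∀ v ∈ X, P m (u + v) ≤ P m u + P m v
  Q_add : ∀ m, ∀ u ∈ X, ∀ v ∈ X, Q m (u + v) ≤ Q m u + Q m v
  Q_sub : ∀ m, ∀ u ∈ X, ∀ v ∈ X, Q m (u - v) ≤ Q m u + Q m v
  S_mem : ∀ k, ∀ u ∈ X, S k u ∈ X
  S_sub : ∀ k, ∀ u ∈ X, ∀ v ∈ X, S k (u - v) = S k u - S k v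
  P_smooth : ∀ a b : ℕ, a ≤ b → ∃ C, 0 ≤ C ∧ ∀ k, ∀ u ∈ X,
    P b (S k u) ≤ C * (scale k (b - a) * P a u)
  P_approx : ∀ a b : ℕ, b ≤ a → ∃ C, 0 ≤ C ∧ ∀ k, ∀ u ∈ X,
    P b (u - S k u) ≤ C * (scale k (b - a) * P a u)
  Q_smooth : ∀ a b : ℕ, a ≤ b → ∃ C, 0 ≤ C ∧ ∀ k, ∀ u ∈ X,
    Q b (S k u) ≤ C * (scale k (b - a) * Q a u)
  Q_approx : ∀ a b : ℕ, b ≤ a → ∃ C, 0 ≤ C ∧ ∀ k, ∀ u ∈ X,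
    Q b (u - S k u) ≤ C * (scale k (b - a) * Q a u)
  N_zero : ∀ m, ∃ C, 0 ≤ C ∧ ∀ f ∈ X, Q m (S 0 f) ≤ C * N f
  N_succ : ∀ m, ∃ C, 0 ≤ C ∧ ∀ k, ∀ f ∈ X,
    Q m (S (k + 1) f - S k f) ≤ C * (scale (k + 1) (m - (α + l)) * N f)
  Φ_zero : Φ 0 = 0
  Φ_mem : ∀ u ∈ X, P μ u ≤ 1 → Φ u ∈ X
  ψ_mem : ∀ v ∈ X, P μ v ≤ 1 → ∀ g ∈ X, ψ v g ∈ X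
  D_ψ : ∀ v ∈ X, P μ v ≤ 1 → ∀ g ∈ X, D v (ψ v g) = g
  ψ_le : ∀ a, ∃ C, 0 ≤ C ∧ ∀ v ∈ X, P μ v ≤ 1 → ∀ g ∈ X,
    P a (ψ v g) ≤ C * (Q (a + l) g + Q l g * P (a + d) v)
  err : ∀ a, ∃ C, 0 ≤ C ∧ ∀ u ∈ X, ∀ v ∈ X, ∀ w ∈ X, P μ u ≤ 1 → P μ v ≤ 1 → P μ (u + w) ≤ 1 →
    Q a (Φ (u + w) - Φ u - D v w) ≤ C * (P (a + μ) w * P μ w + P (a + μ) (u - v) * P μ w +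
      P μ (u - v) * P (a + μ) w +
      (P (a + μ) u + P (a + μ) v + P (a + μ) w) * ((P μ (u - v) + P μ w) * P μ w))

namespace TameData
variable {V : Type*} [AddCommGroup V] [Module ℝ V] (t : TameData V) (f : V)

/-- The iterates `u_k` and the sums `G_k = ∑_{j < k} g_j` of the modified right-hand sides. -/
def state : ℕ → V × V
  | 0 => (0, 0)
  | k + 1 =>
    ((state k).1 + t.ψ (t.S k (state k).1) (t.S k (f - (t.Φ (state k).1 - (state k).2)) -
      (state k).2), t.S k (f - (t.Φ (state k).1 - (state k).2)))

/-- The iterate `u_k`. -/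
def u (k : ℕ) : V := (t.state f k).1

/-- The sum `G_k = ∑_{j < k} g_j`. -/
def G (k : ℕ) : V := (t.state f k).2

/-- The right-hand side `g_k` of the linearized equation. -/
def g (k : ℕ) : V := t.G f (k + 1) - t.G f k

/-- The increment `w_k`. -/
def w (k : ℕ) : V := t.ψ (t.S k (t.u f k)) (t.g f k)

/-- The accumulated error `E_k`. -/
def E (k : ℕ) : V := t.Φ (t.u f k) - t.G f k

/-- The error `e_k` of a single step. -/
def e (k : ℕ) : V := t.Φ (t.u f (k + 1)) - t.Φ (t.u f k) - t.g f k

theorem u_zero : t.u f 0 = 0 := rfl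

theorem u_succ (k : ℕ) : t.u f (k + 1) = t.u f k + t.w f k := rfl

/-- The right-hand sides are arranged so that `G_{k+1} + S_k E_k` smooths to `f`: the part of the
past errors visible at scale `2^{-k}` is corrected at each step. -/
theorem G_succ (k : ℕ) : t.G f (k + 1) = t.S k (f - t.E f k) := rfl

theorem u_eq_sum (k : ℕ) : t.u f k = ∑ j ∈ Finset.range k, t.w f j := by
  induction k with
  | zero => rfl
  | succ k ih => rw [u_succ, Finset.sum_range_succ, ih]

theorem E_zero : t.E f 0 = 0 := by
  change t.Φ 0 - 0 = 0
  rw [t.Φ_zero, sub_zero]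

theorem E_succ (k : ℕ) : t.E f (k + 1) = t.E f k + t.e f k := by
  simp only [E, e, g]; abel

theorem g_zero : t.g f 0 = t.S 0 f := by
  have h : t.G f 0 = 0 := rfl
  rw [g, G_succ, E_zero, h, sub_zero, sub_zero]

/-- The iterate is so small that the linearized equation can be solved there. -/
structure Adm (k : ℕ) : Prop where
  u_mem : t.u f k ∈ t.X
  G_mem : t.G f k ∈ t.X
  P_u : t.P t.μ (t.u f k) ≤ 1
  P_Su : t.P t.μ (t.S k (t.u f k)) ≤ 1
  P_d : t.P t.d (t.u f k) ≤ 1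

variable {t f} {k : ℕ}

theorem Adm.E_mem (h : t.Adm f k) : t.E f k ∈ t.X :=
  t.X.sub_mem (t.Φ_mem _ h.u_mem h.P_u) h.G_mem

theorem Adm.G_succ_mem (h : t.Adm f k) (hf : f ∈ t.X) : t.G f (k + 1) ∈ t.X :=
  t.S_mem k _ (t.X.sub_mem hf h.E_mem)

theorem Adm.g_mem (h : t.Adm f k) (hf : f ∈ t.X) : t.g f k ∈ t.X :=
  t.X.sub_mem (h.G_succ_mem hf) h.G_mem

theorem Adm.w_mem (h : t.Adm f k) (hf : f ∈ t.X) : t.w f k ∈ t.X :=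
  t.ψ_mem _ (t.S_mem k _ h.u_mem) h.P_Su _ (h.g_mem hf)

theorem Adm.D_w (h : t.Adm f k) (hf : f ∈ t.X) :
    t.D (t.S k (t.u f k)) (t.w f k) = t.g f k :=
  t.D_ψ _ (t.S_mem k _ h.u_mem) h.P_Su _ (h.g_mem hf)

theorem Adm.u_succ_mem (h : t.Adm f k) (hf : f ∈ t.X) : t.u f (k + 1) ∈ t.X :=
  t.X.add_mem h.u_mem (h.w_mem hf)

theorem Adm.e_mem (h : t.Adm f k) (hf : f ∈ t.X) (h1 : t.P t.μ (t.u f (k + 1)) ≤ 1) :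
    t.e f k ∈ t.X :=
  t.X.sub_mem (t.X.sub_mem (t.Φ_mem _ (h.u_succ_mem hf) h1) (t.Φ_mem _ h.u_mem h.P_u))
    (h.g_mem hf)

theorem P_u_le_sum (hf : f ∈ t.X) (m : ℕ) (h : ∀ j < k, t.Adm f j) :
    t.P m (t.u f k) ≤ ∑ j ∈ Finset.range k, t.P m (t.w f j) := by
  induction k with
  | zero => simp [u_zero, t.P_zero]
  | succ k ih =>
    rw [Finset.sum_range_succ, u_succ]
    exact (t.P_add m _ (h k (by omega)).u_mem _ ((h k (by omega)).w_mem hf)).trans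
      (by linarith [ih fun j hj => h j (by omega)])

theorem P_u_le (hf : f ∈ t.X) (m : ℕ) (h : ∀ j < k, t.Adm f j) {R x : ℝ}
    (hw : ∀ j < k, t.P m (t.w f j) ≤ R * scale j x) :
    t.P m (t.u f k) ≤ R * ∑ j ∈ Finset.range k, scale j x := by
  refine (P_u_le_sum hf m h).trans ?_
  rw [Finset.mul_sum]
  exact Finset.sum_le_sum fun j hj => hw j (Finset.mem_range.1 hj)

variable (t)

/-- Bounds for the errors, when the increments decay like `2^{k (m - α')}`. -/
theorem exists_error_le (α' : ℝ) (hα' : t.α ≤ α') (s : ℕ) (hs : 2 * α' - 2 * t.μ < s) :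
    ∃ C, 0 ≤ C ∧ ∀ f ∈ t.X, ∀ (k : ℕ) (R : ℝ), 0 ≤ R → (∀ j ≤ k, t.Adm f j) →
      t.P t.μ (t.u f (k + 1)) ≤ 1 →
      (∀ j ≤ k, t.P t.μ (t.w f j) ≤ R * scale j (t.μ - α')) →
      (∀ j ≤ k, t.P (s + t.μ) (t.w f j) ≤ R * scale j (((s + t.μ : ℕ) : ℝ) - α')) →
      t.Q 0 (t.e f k) ≤ C * (R ^ 2 * (1 + R) * scale k (2 * t.μ - 2 * α')) ∧
      t.Q s (t.e f k) ≤ C * (R ^ 2 * (1 + R) * scale k (s + 2 * t.μ - 2 * α')) := by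
  have hμα : (t.μ : ℝ) < α' := t.hμ.trans_le hα'
  have hμ0 : (0 : ℝ) ≤ t.μ := Nat.cast_nonneg _
  -- With a positive exponent the geometric sum over the increments is dominated by its last term,
  -- so in the norm of order `s + μ` the iterate `u_k` is no worse than `w_k`.
  have hA : (0 : ℝ) < ((s + t.μ : ℕ) : ℝ) - α' := by push_cast; linarith
  obtain ⟨c₁, hc₁, h1⟩ := exists_sum_scale_le_of_pos hA
  obtain ⟨c₂, hc₂, h2⟩ := t.P_smooth (s + t.μ) (s + t.μ) le_rfl
  obtain ⟨c₃, hc₃, h3⟩ := t.P_approx (s + t.μ) t.μ (by omega)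
  obtain ⟨c₄, hc₄, h4⟩ := t.P_approx (s + t.μ) (s + t.μ) le_rfl
  obtain ⟨C₀, hC₀, e0⟩ := t.err 0
  obtain ⟨C₁, hC₁, e1⟩ := t.err s
  set b₀ : ℝ := 1 + 2 * (c₃ * c₁) + 3 * (c₃ * c₁ + 1) with hb₀
  set b₁ : ℝ := 1 + c₄ * c₁ + c₃ * c₁ + (c₁ + c₂ * c₁ + 1) * (c₃ * c₁ + 1) with hb₁
  refine ⟨C₀ * b₀ + C₁ * b₁, by positivity, fun f hf k R hR hadm hu1 hw hwA => ?_⟩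
  have hk := hadm k le_rfl
  have hum := hk.u_mem
  have hvm := t.S_mem k _ hum
  have hwm := hk.w_mem hf
  set u := t.u f k
  set v := t.S k u
  set w := t.w f k
  -- The linearized equation is solved exactly at `v = S_k u`, so `g_k` may be replaced by `D v w`.
  -- What remains is the Taylor error and the shift of the base point from `u` to `v`.
  have he : t.e f k = t.Φ (u + w) - t.Φ u - t.D v w := by
    rw [hk.D_w hf]; rfl
  set W := R * scale k (t.μ - α') with hW
  set Z := R * scale k (((s + t.μ : ℕ) : ℝ) - α') with hZ
  have hW0 : 0 ≤ W := mul_nonneg hR (scale_pos _ _).le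
  have hZ0 : 0 ≤ Z := mul_nonneg hR (scale_pos _ _).le
  have hWR : W ≤ R := mul_le_of_le_one_right hR (scale_le_one k (by linarith))
  have pw : t.P t.μ w ≤ W := hw k le_rfl
  have pwA : t.P (s + t.μ) w ≤ Z := hwA k le_rfl
  have puA : t.P (s + t.μ) u ≤ c₁ * Z := by
    refine (P_u_le hf (s + t.μ) (fun j hj => hadm j hj.le) fun j hj => hwA j hj.le).trans ?_
    refine (mul_le_mul_of_nonneg_left (h1 k) hR).trans (le_of_eq ?_)
    rw [hZ]; ring
  have pvA : t.P (s + t.μ) v ≤ c₂ * c₁ * Z := by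
    refine (h2 k u hum).trans ?_
    rw [sub_self, scale_zero_right, one_mul, mul_assoc]
    gcongr
  -- The approximation estimate trades the large norm of order `s + μ` for decay, which makes `u -
  -- S_k u` as small as `w_k` in the norm of order `μ`.
  have pd : t.P t.μ (u - v) ≤ c₃ * c₁ * W := by
    refine (h3 k u hum).trans ?_
    have : scale k (t.μ - ((s + t.μ : ℕ) : ℝ)) * (c₁ * Z) = c₁ * W := by
      rw [hZ, hW, show (t.μ : ℝ) - α' = (t.μ - ((s + t.μ : ℕ) : ℝ)) + (((s + t.μ : ℕ) : ℝ) - α') by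
        ring, scale_add]
      ring
    rw [mul_assoc c₃, ← this]
    have := (scale_pos k (t.μ - ((s + t.μ : ℕ) : ℝ))).le
    gcongr
  have pdA : t.P (s + t.μ) (u - v) ≤ c₄ * c₁ * Z := by
    refine (h4 k u hum).trans ?_
    rw [sub_self, scale_zero_right, one_mul, mul_assoc]
    gcongr
  have n1 := t.P_nonneg t.μ w
  have n2 := t.P_nonneg t.μ (u - v)
  have n3 := t.P_nonneg (s + t.μ) w
  have n4 := t.P_nonneg (s + t.μ) (u - v)
  have n5 := t.P_nonneg (s + t.μ) u
  have n6 := t.P_nonneg (s + t.μ) v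
  have n7 := t.P_nonneg t.μ u
  have n8 := t.P_nonneg t.μ v
  have hcc : 0 ≤ c₃ * c₁ := by positivity
  rw [he]
  constructor
  · refine (e0 u hum v hvm w hwm hk.P_u hk.P_Su hu1).trans ?_
    rw [zero_add]
    have hWW : W * W = R ^ 2 * scale k (2 * t.μ - 2 * α') := by
      rw [hW, show 2 * (t.μ : ℝ) - 2 * α' = (t.μ - α') + (t.μ - α') by ring, scale_add]; ring
    have hpu := hk.P_u
    have hpv := hk.P_Su
    calc _ ≤ C₀ * (W * W + (c₃ * c₁ * W) * W + (c₃ * c₁ * W) * W +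
          (1 + 1 + R) * ((c₃ * c₁ * W + W) * W)) := by
          have := pw.trans hWR
          gcongr
      _ = C₀ * ((1 + 2 * (c₃ * c₁) + (2 + R) * (c₃ * c₁ + 1)) * (W * W)) := by ring
      _ ≤ C₀ * ((b₀ * (1 + R)) * (W * W)) := by
          gcongr
          rw [hb₀]
          nlinarith [mul_nonneg hR hcc]
      _ = C₀ * b₀ * (R ^ 2 * (1 + R) * scale k (2 * t.μ - 2 * α')) := by rw [hWW]; ring
      _ ≤ _ := by
          have := (scale_pos k (2 * t.μ - 2 * α')).le
          gcongr
          exact le_add_of_nonneg_right (by positivity)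
  · refine (e1 u hum v hvm w hwm hk.P_u hk.P_Su hu1).trans ?_
    have hZW : Z * W = R ^ 2 * scale k (s + 2 * t.μ - 2 * α') := by
      rw [hW, hZ, show (s : ℝ) + 2 * t.μ - 2 * α' = (((s + t.μ : ℕ) : ℝ) - α') + (t.μ - α') by
        push_cast; ring, scale_add]
      ring
    calc _ ≤ C₁ * (Z * W + (c₄ * c₁ * Z) * W + (c₃ * c₁ * W) * Z +
          (c₁ * Z + c₂ * c₁ * Z + Z) * ((c₃ * c₁ * W + W) * R)) := by
          have := pw.trans hWR
          gcongr
      _ = C₁ * ((1 + c₄ * c₁ + c₃ * c₁ + (c₁ + c₂ * c₁ + 1) * (c₃ * c₁ + 1) * R) * (Z * W)) := by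
          ring
      _ ≤ C₁ * ((b₁ * (1 + R)) * (Z * W)) := by
          gcongr
          rw [hb₁]
          have h5 : 0 ≤ (1 + c₄ * c₁ + c₃ * c₁) * R := by positivity
          have h6 : 0 ≤ (c₁ + c₂ * c₁ + 1) * (c₃ * c₁ + 1) := by positivity
          nlinarith
      _ = C₁ * b₁ * (R ^ 2 * (1 + R) * scale k (s + 2 * t.μ - 2 * α')) := by rw [hZW]; ring
      _ ≤ _ := by
          have := (scale_pos k (s + 2 * t.μ - 2 * α')).le
          gcongr
          exact le_add_of_nonneg_left (by positivity)

/-- Above order `s` each of the two operators is estimated by itself; below `s` the difference is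
rewritten through the approximation errors. The difference thus behaves like a frequency band, with
the right power in both directions. -/
theorem exists_Q_smooth_diff_le (s m : ℕ) :
    ∃ C, 0 ≤ C ∧ ∀ k, ∀ u ∈ t.X,
      t.Q m (t.S (k + 1) u - t.S k u) ≤ C * (scale k (m - s) * t.Q s u) := by
  rcases le_total s m with h | h
  · obtain ⟨C, hC, h1⟩ := t.Q_smooth s m h
    refine ⟨C * 2 ^ ((m : ℝ) - s) + C, by positivity, fun k u hu => ?_⟩
    refine (t.Q_sub m _ (t.S_mem _ _ hu) _ (t.S_mem _ _ hu)).trans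
      ((add_le_add (h1 _ u hu) (h1 k u hu)).trans (le_of_eq ?_))
    rw [scale_succ]; ring
  · obtain ⟨C, hC, h1⟩ := t.Q_approx s m h
    refine ⟨C * 2 ^ ((m : ℝ) - s) + C, by positivity, fun k u hu => ?_⟩
    have e : t.S (k + 1) u - t.S k u = (u - t.S k u) - (u - t.S (k + 1) u) := by abel
    rw [e]
    refine (t.Q_sub m _ (t.X.sub_mem hu (t.S_mem _ _ hu)) _ (t.X.sub_mem hu (t.S_mem _ _ hu))).trans
      ((add_le_add (h1 _ u hu) (h1 _ u hu)).trans (le_of_eq ?_))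
    rw [scale_succ]; ring

theorem scale_le_scale_succ (k : ℕ) (x : ℝ) : scale k x = 2 ^ (-x) * scale (k + 1) x := by
  rw [scale_succ, ← mul_assoc, ← Real.rpow_add two_pos]; simp

/-- The accumulated error. -/
theorem exists_Q_E_le (α' : ℝ) (hα' : t.α ≤ α') (s : ℕ) (hs : 2 * α' - 2 * t.μ < s) :
    ∃ C, 0 ≤ C ∧ ∀ f ∈ t.X, ∀ (k : ℕ) (R : ℝ), 0 ≤ R → (∀ j ≤ k, t.Adm f j) →
      (∀ j < k, t.P t.μ (t.w f j) ≤ R * scale j (t.μ - α')) →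
      (∀ j < k, t.P (s + t.μ) (t.w f j) ≤ R * scale j (((s + t.μ : ℕ) : ℝ) - α')) →
      t.Q s (t.E f k) ≤ C * (R ^ 2 * (1 + R) * scale k (s + 2 * t.μ - 2 * α')) := by
  obtain ⟨C₁, hC₁, h1⟩ := t.exists_error_le α' hα' s hs
  -- The lower bound on `s` makes this exponent positive, so the sum of the errors is comparable
  -- with its last term.
  obtain ⟨c, hc, h2⟩ := exists_sum_scale_le_of_pos (x := s + 2 * t.μ - 2 * α') (by linarith)
  refine ⟨C₁ * c, by positivity, fun f hf k R hR hadm hw hwA => ?_⟩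
  have key : t.Q s (t.E f k) ≤ C₁ * (R ^ 2 * (1 + R)) *
      ∑ j ∈ Finset.range k, scale j (s + 2 * t.μ - 2 * α') := by
    induction k with
    | zero => simp [E_zero, t.Q_zero]
    | succ k ih =>
      rw [E_succ, Finset.sum_range_succ, mul_add]
      have hk := hadm k (by omega)
      have hk1 := (hadm (k + 1) le_rfl).P_u
      refine (t.Q_add s _ hk.E_mem _ (hk.e_mem hf hk1)).trans (add_le_add
        (ih (fun j hj => hadm j (by omega)) (fun j hj => hw j (by omega))
          (fun j hj => hwA j (by omega))) ?_)
      refine (h1 f hf k R hR (fun j hj => hadm j (by omega)) hk1 (fun j hj => hw j (by omega))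
          (fun j hj => hwA j (by omega))).2.trans (le_of_eq (by ring))
  refine key.trans ((mul_le_mul_of_nonneg_left (h2 k) (by positivity)).trans (le_of_eq (by ring)))

/-- Bounds for the right-hand sides `g_k`. -/
theorem exists_Q_g_le (α' : ℝ) (hα' : t.α ≤ α') (s : ℕ) (hs : 2 * α' - 2 * t.μ < s) (m : ℕ) :
    ∃ C, 0 ≤ C ∧ ∀ f ∈ t.X, ∀ (k : ℕ) (R : ℝ), 0 ≤ R → (∀ j ≤ k + 1, t.Adm f j) →
      (∀ j ≤ k, t.P t.μ (t.w f j) ≤ R * scale j (t.μ - α')) →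
      (∀ j ≤ k, t.P (s + t.μ) (t.w f j) ≤ R * scale j (((s + t.μ : ℕ) : ℝ) - α')) →
      t.Q m (t.g f (k + 1)) ≤ t.Q m (t.S (k + 1) f - t.S k f) +
        C * (R ^ 2 * (1 + R) * scale (k + 1) (m + 2 * t.μ - 2 * α')) := by
  obtain ⟨C₁, hC₁, h1⟩ := t.exists_error_le α' hα' s hs
  obtain ⟨C₂, hC₂, h2⟩ := t.exists_Q_E_le α' hα' s hs
  obtain ⟨C₃, hC₃, h3⟩ := t.exists_Q_smooth_diff_le s m
  obtain ⟨C₄, hC₄, h4⟩ := t.Q_smooth 0 m (Nat.zero_le _)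
  refine ⟨C₃ * C₂ * 2 ^ (-(m + 2 * t.μ - 2 * α')) + C₄ * C₁ * 2 ^ (-(2 * t.μ - 2 * α')),
    by positivity, fun f hf k R hR hadm hw hwA => ?_⟩
  have hk := hadm k (by omega)
  have hk1 := hadm (k + 1) le_rfl
  have hem := hk.e_mem hf hk1.P_u
  have hEm := hk.E_mem
  have hE1 : t.S (k + 1) (t.E f k) = t.S (k + 1) (t.E f (k + 1)) - t.S (k + 1) (t.e f k) := by
    rw [← t.S_sub _ _ hk1.E_mem _ hem, E_succ, add_sub_cancel_right]
  -- From `E_{k+1} = E_k + e_k`: the band of `f`, the band of the old error, and the smoothed new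
  -- error. The old error is used in the high norm `Q s`, the new one in `Q 0`.
  have hg : t.g f (k + 1) = (t.S (k + 1) f - t.S k f) -
      ((t.S (k + 1) (t.E f k) - t.S k (t.E f k)) + t.S (k + 1) (t.e f k)) := by
    rw [g, G_succ, G_succ, t.S_sub _ _ hf _ hk1.E_mem, t.S_sub _ _ hf _ hEm, hE1]
    abel
  have m1 := t.X.sub_mem (t.S_mem (k + 1) _ hf) (t.S_mem k _ hf)
  have m2 := t.X.sub_mem (t.S_mem (k + 1) _ hEm) (t.S_mem k _ hEm)
  have m3 := t.S_mem (k + 1) _ hem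
  rw [hg]
  refine (t.Q_sub m _ m1 _ (t.X.add_mem m2 m3)).trans (add_le_add le_rfl
    ((t.Q_add m _ m2 _ m3).trans ?_))
  have b1 := (h3 k _ hEm).trans (mul_le_mul_of_nonneg_left (mul_le_mul_of_nonneg_left
    (h2 f hf k R hR (fun j hj => hadm j (by omega)) (fun j hj => hw j hj.le)
      (fun j hj => hwA j hj.le)) (scale_pos _ _).le) hC₃)
  have b2 := (h4 (k + 1) _ hem).trans (mul_le_mul_of_nonneg_left (mul_le_mul_of_nonneg_left
    (h1 f hf k R hR (fun j hj => hadm j (by omega)) hk1.P_u hw hwA).1 (scale_pos _ _).le) hC₄)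
  refine (add_le_add b1 b2).trans (le_of_eq ?_)
  have e1 : scale k ((m : ℝ) - s) * scale k (s + 2 * t.μ - 2 * α') =
      2 ^ (-(m + 2 * t.μ - 2 * α')) * scale (k + 1) (m + 2 * t.μ - 2 * α') := by
    rw [← scale_add, ← scale_le_scale_succ]; congr 1; ring
  have e2 : scale (k + 1) ((m : ℝ) - ((0 : ℕ) : ℝ)) * scale k (2 * t.μ - 2 * α') =
      2 ^ (-(2 * t.μ - 2 * α')) * scale (k + 1) (m + 2 * t.μ - 2 * α') := by
    rw [scale_le_scale_succ k, show (m : ℝ) + 2 * t.μ - 2 * α' =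
      (m - ((0 : ℕ) : ℝ)) + (2 * t.μ - 2 * α') by push_cast; ring, scale_add]
    ring
  calc _ = C₃ * C₂ * (R ^ 2 * (1 + R)) *
        (scale k ((m : ℝ) - s) * scale k (s + 2 * t.μ - 2 * α')) +
        C₄ * C₁ * (R ^ 2 * (1 + R)) *
        (scale (k + 1) ((m : ℝ) - ((0 : ℕ) : ℝ)) * scale k (2 * t.μ - 2 * α')) := by ring
    _ = _ := by rw [e1, e2]; ring

/-- Bounds for the increments `w_k`. -/
theorem exists_P_w_le (a : ℕ) :
    ∃ C, 0 ≤ C ∧ ∀ f ∈ t.X, ∀ (k : ℕ) (B α' : ℝ), 0 ≤ B → t.Adm f k →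
      t.Q (a + t.l) (t.g f k) ≤ B * scale k (a - α') → t.Q t.l (t.g f k) ≤ B * scale k (-α') →
      t.P a (t.w f k) ≤ C * (B * scale k (a - α')) := by
  obtain ⟨C₁, hC₁, h1⟩ := t.ψ_le a
  obtain ⟨C₂, hC₂, h2⟩ := t.P_smooth t.d (a + t.d) (by omega)
  refine ⟨C₁ * (1 + C₂), by positivity, fun f hf k B α' hB hk q1 q2 => ?_⟩
  -- Smoothing lifts the bound of order `d` by `a` orders at the cost `2^{ka}`. The loss `d`
  -- therefore does not accumulate in the course of the iteration.
  have p : t.P (a + t.d) (t.S k (t.u f k)) ≤ C₂ * scale k a := by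
    refine (h2 k _ hk.u_mem).trans ?_
    have : ((a + t.d : ℕ) : ℝ) - t.d = a := by push_cast; ring
    rw [this]
    have := (scale_pos k a).le
    have := hk.P_d
    gcongr
    exact mul_le_of_le_one_right (scale_pos k a).le hk.P_d
  refine (h1 _ (t.S_mem k _ hk.u_mem) hk.P_Su _ (hk.g_mem hf)).trans ?_
  have n1 := t.P_nonneg (a + t.d) (t.S k (t.u f k))
  have n2 := (scale_pos k (-α')).le
  calc _ ≤ C₁ * (B * scale k (a - α') + B * scale k (-α') * (C₂ * scale k a)) := by gcongr
    _ = _ := by rw [sub_eq_add_neg, scale_add]; ring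

end TameData
end NashMoser
end

/-! ### Convergence of the abstract iteration. -/

noncomputable section
namespace NashMoser
namespace TameData
variable {V : Type*} [AddCommGroup V] [Module ℝ V] (t : TameData V)

theorem adm_zero (f : V) : t.Adm f 0 := by
  have h0 := t.u_zero f
  refine ⟨?_, ?_, ?_, ?_, ?_⟩
  · rw [h0]; exact t.X.zero_mem
  · exact t.X.zero_mem
  · rw [h0, t.P_zero]; exact zero_le_one
  · obtain ⟨C, -, h⟩ := t.P_smooth t.μ t.μ le_rfl
    have := h 0 0 t.X.zero_mem
    rw [t.P_zero, mul_zero, mul_zero] at this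
    rw [h0]
    exact this.trans zero_le_one
  · rw [h0, t.P_zero]; exact zero_le_one

theorem exists_P_w_zero_le (m : ℕ) :
    ∃ C, 0 ≤ C ∧ ∀ f ∈ t.X, t.P m (t.w f 0) ≤ C * t.N f := by
  obtain ⟨C₁, hC₁, h1⟩ := t.exists_P_w_le m
  obtain ⟨C₂, hC₂, h2⟩ := t.N_zero (m + t.l)
  obtain ⟨C₃, hC₃, h3⟩ := t.N_zero t.l
  refine ⟨C₁ * (C₂ + C₃), by positivity, fun f hf => ?_⟩
  have hN := t.N_nonneg f
  have := h1 f hf 0 ((C₂ + C₃) * t.N f) 0 (by positivity) (t.adm_zero f)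
    (by
      rw [scale_zero_left, mul_one, g_zero]
      exact (h2 f hf).trans (mul_le_mul_of_nonneg_right (by linarith) hN))
    (by
      rw [scale_zero_left, mul_one, g_zero]
      exact (h3 f hf).trans (mul_le_mul_of_nonneg_right (by linarith) hN))
  rw [scale_zero_left, mul_one, ← mul_assoc] at this
  exact this

/-- The norm of `f` includes `l` extra orders that pay exactly for `ψ`, so `f` contributes the rate
`m - α`. The errors contribute `m + l + 2μ - 2α`, which is no larger because `l + 2μ < α`, and they
are quadratic in `R`. -/
theorem exists_P_w_succ_le (s : ℕ) (hs : 2 * t.α - 2 * t.μ < s) (m : ℕ) :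
    ∃ C, 0 ≤ C ∧ ∀ f ∈ t.X, ∀ (k : ℕ) (R : ℝ), 0 ≤ R → (∀ j ≤ k + 1, t.Adm f j) →
      (∀ j ≤ k, t.P t.μ (t.w f j) ≤ R * scale j (t.μ - t.α)) →
      (∀ j ≤ k, t.P (s + t.μ) (t.w f j) ≤ R * scale j (((s + t.μ : ℕ) : ℝ) - t.α)) →
      t.P m (t.w f (k + 1)) ≤ C * ((t.N f + R ^ 2 * (1 + R)) * scale (k + 1) (m - t.α)) := by
  have key : ∀ m : ℕ, ∃ C, 0 ≤ C ∧ ∀ f ∈ t.X, ∀ (k : ℕ) (R : ℝ), 0 ≤ R →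
      (∀ j ≤ k + 1, t.Adm f j) →
      (∀ j ≤ k, t.P t.μ (t.w f j) ≤ R * scale j (t.μ - t.α)) →
      (∀ j ≤ k, t.P (s + t.μ) (t.w f j) ≤ R * scale j (((s + t.μ : ℕ) : ℝ) - t.α)) →
      t.Q (m + t.l) (t.g f (k + 1)) ≤
        C * ((t.N f + R ^ 2 * (1 + R)) * scale (k + 1) (m - t.α)) := by
    intro m
    obtain ⟨C₁, hC₁, h1⟩ := t.exists_Q_g_le t.α le_rfl s hs (m + t.l)
    obtain ⟨C₂, hC₂, h2⟩ := t.N_succ (m + t.l)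
    refine ⟨C₁ + C₂, by positivity, fun f hf k R hR hadm hw hwA => ?_⟩
    have hN := t.N_nonneg f
    refine (h1 f hf k R hR hadm hw hwA).trans ((add_le_add (h2 k f hf) le_rfl).trans ?_)
    have e1 : scale (k + 1) (((m + t.l : ℕ) : ℝ) - (t.α + t.l)) = scale (k + 1) (m - t.α) := by
      congr 1; push_cast; ring
    have e2 : scale (k + 1) (((m + t.l : ℕ) : ℝ) + 2 * t.μ - 2 * t.α) ≤
        scale (k + 1) (m - t.α) := by
      apply scale_le
      push_cast
      linarith [t.hl]
    have p := (scale_pos (k + 1) (m - t.α)).le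
    rw [e1]
    calc _ ≤ C₂ * (scale (k + 1) (m - t.α) * t.N f) +
          C₁ * (R ^ 2 * (1 + R) * scale (k + 1) (m - t.α)) := by gcongr
      _ ≤ C₂ * (scale (k + 1) (m - t.α) * (t.N f + R ^ 2 * (1 + R))) +
          C₁ * ((t.N f + R ^ 2 * (1 + R)) * scale (k + 1) (m - t.α)) := by
          gcongr
          · exact le_add_of_nonneg_right (by positivity)
          · exact le_add_of_nonneg_left hN
      _ = _ := by ring
  obtain ⟨C₁, hC₁, h1⟩ := t.exists_P_w_le m
  obtain ⟨C₂, hC₂, h2⟩ := key m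
  obtain ⟨C₃, hC₃, h3⟩ := key 0
  refine ⟨C₁ * (C₂ + C₃), by positivity, fun f hf k R hR hadm hw hwA => ?_⟩
  have hN := t.N_nonneg f
  have hA : 0 ≤ t.N f + R ^ 2 * (1 + R) := by positivity
  have := h1 f hf (k + 1) ((C₂ + C₃) * (t.N f + R ^ 2 * (1 + R))) t.α (by positivity)
    (hadm _ le_rfl)
    (by
      refine (h2 f hf k R hR hadm hw hwA).trans ?_
      have p := (scale_pos (k + 1) (m - t.α)).le
      rw [mul_assoc]
      exact mul_le_mul_of_nonneg_right (by linarith) (by positivity))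
    (by
      have h := h3 f hf k R hR hadm hw hwA
      rw [zero_add, Nat.cast_zero, zero_sub] at h
      refine h.trans ?_
      have p := (scale_pos (k + 1) (-t.α)).le
      rw [mul_assoc]
      exact mul_le_mul_of_nonneg_right (by linarith) (by positivity))
  exact this.trans (le_of_eq (by ring))

/-- For small data the iteration never stops, and its increments decay. -/
theorem exists_forall_adm (s : ℕ) (hs : 2 * t.α - 2 * t.μ < s) :
    ∃ δ, 0 < δ ∧ ∃ K, 0 ≤ K ∧ ∀ f ∈ t.X, t.N f ≤ δ → K * t.N f ≤ 1 ∧ ∀ k, t.Adm f k ∧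
      t.P t.μ (t.u f k) ≤ 1 / 2 ∧
      t.P t.μ (t.w f k) ≤ K * t.N f * scale k (t.μ - t.α) ∧
      t.P t.d (t.w f k) ≤ K * t.N f * scale k (t.d - t.α) ∧
      t.P (s + t.μ) (t.w f k) ≤ K * t.N f * scale k (((s + t.μ : ℕ) : ℝ) - t.α) := by
  obtain ⟨a₁, ha₁, z1⟩ := t.exists_P_w_zero_le t.μ
  obtain ⟨a₂, ha₂, z2⟩ := t.exists_P_w_zero_le t.d
  obtain ⟨a₃, ha₃, z3⟩ := t.exists_P_w_zero_le (s + t.μ)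
  obtain ⟨b₁, hb₁, s1⟩ := t.exists_P_w_succ_le s hs t.μ
  obtain ⟨b₂, hb₂, s2⟩ := t.exists_P_w_succ_le s hs t.d
  obtain ⟨b₃, hb₃, s3⟩ := t.exists_P_w_succ_le s hs (s + t.μ)
  obtain ⟨c₁, hc₁, t1⟩ := exists_sum_scale_le_of_neg (x := t.μ - t.α) (by linarith [t.hμ])
  obtain ⟨c₂, hc₂, t2⟩ := exists_sum_scale_le_of_neg (x := t.d - t.α) (by linarith [t.hd])
  obtain ⟨c₃, hc₃, t3⟩ := t.P_smooth t.μ t.μ le_rfl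
  -- `K` is twice the sum of the constants, which leaves room for the quadratic term. `D` collects
  -- every smallness condition on `N f`, so that a single inequality `D * N f ≤ 1` yields them all.
  set K : ℝ := 2 * (a₁ + a₂ + a₃ + b₁ + b₂ + b₃) with hK
  have hK0 : 0 ≤ K := by positivity
  set D : ℝ := 2 * K ^ 2 + K + 2 * K * (c₁ + c₃ * c₁ + c₂) + 1 with hD
  have hD0 : 0 < D := by positivity
  refine ⟨1 / D, by positivity, K, hK0, fun f hf hfδ => ?_⟩
  have hN := t.N_nonneg f
  have hND : D * t.N f ≤ 1 := by rwa [le_div_iff₀ hD0, mul_comm] at hfδ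
  have q1 : 0 ≤ K ^ 2 * t.N f := by positivity
  have q2 : 0 ≤ K * t.N f := by positivity
  have q3 : 0 ≤ K * t.N f * c₁ := by positivity
  have q4 : 0 ≤ K * t.N f * (c₃ * c₁) := by positivity
  have q5 : 0 ≤ K * t.N f * c₂ := by positivity
  have hND' : 2 * (K ^ 2 * t.N f) + K * t.N f + 2 * (K * t.N f * c₁) +
      2 * (K * t.N f * (c₃ * c₁)) + 2 * (K * t.N f * c₂) + t.N f ≤ 1 :=
    le_trans (le_of_eq (by rw [hD]; ring)) hND
  refine ⟨by linarith, fun k => ?_⟩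
  induction k using Nat.strong_induction_on with
  | _ k ih =>
    have w1 : t.P t.μ (t.u f k) ≤ K * t.N f * c₁ :=
      (P_u_le hf t.μ (fun j hj => (ih j hj).1) fun j hj => (ih j hj).2.2.1).trans
        (mul_le_mul_of_nonneg_left (t1 k) q2)
    have w2 : t.P t.d (t.u f k) ≤ K * t.N f * c₂ :=
      (P_u_le hf t.d (fun j hj => (ih j hj).1) fun j hj => (ih j hj).2.2.2.1).trans
        (mul_le_mul_of_nonneg_left (t2 k) q2)
    rcases k with - | k
    · refine ⟨t.adm_zero f, by linarith, ?_, ?_, ?_⟩ <;> rw [scale_zero_left, mul_one]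
      · exact (z1 f hf).trans (mul_le_mul_of_nonneg_right (by linarith) hN)
      · exact (z2 f hf).trans (mul_le_mul_of_nonneg_right (by linarith) hN)
      · exact (z3 f hf).trans (mul_le_mul_of_nonneg_right (by linarith) hN)
    · have hk := (ih k (by omega)).1
      have hm := hk.u_succ_mem hf
      have w3 : t.P t.μ (t.S (k + 1) (t.u f (k + 1))) ≤ K * t.N f * (c₃ * c₁) := by
        refine (t3 (k + 1) _ hm).trans ?_
        rw [sub_self, scale_zero_right, one_mul]
        exact (mul_le_mul_of_nonneg_left w1 hc₃).trans (le_of_eq (by ring))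
      have hadm : t.Adm f (k + 1) :=
        ⟨hm, hk.G_succ_mem hf, by linarith, by linarith, by linarith⟩
      have hall : ∀ j ≤ k + 1, t.Adm f j := fun j hj => by
        rcases hj.eq_or_lt with rfl | h
        · exact hadm
        · exact (ih j h).1
      have i1 : ∀ j ≤ k, t.P t.μ (t.w f j) ≤ K * t.N f * scale j (t.μ - t.α) := fun j hj =>
        (ih j (by omega)).2.2.1
      have i2 : ∀ j ≤ k, t.P (s + t.μ) (t.w f j) ≤
          K * t.N f * scale j (((s + t.μ : ℕ) : ℝ) - t.α) := fun j hj =>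
        (ih j (by omega)).2.2.2.2
      -- With `R = K * N f` the quadratic error is at most `N f`, so the total is at most `2 * N f`.
      -- The factor 2 in `K` then restores the inductive bound with the same `K`.
      have hR : t.N f + (K * t.N f) ^ 2 * (1 + K * t.N f) ≤ 2 * t.N f := by
        have h1 : (K * t.N f) ^ 2 * (1 + K * t.N f) ≤ (K * t.N f) ^ 2 * 2 :=
          mul_le_mul_of_nonneg_left (by linarith) (by positivity)
        have h2 : (K * t.N f) ^ 2 * 2 = (2 * (K ^ 2 * t.N f)) * t.N f := by ring
        have h3 : (2 * (K ^ 2 * t.N f)) * t.N f ≤ t.N f :=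
          mul_le_of_le_one_left hN (by linarith)
        linarith
      have fin : ∀ (b x : ℝ), 0 ≤ b → 2 * b ≤ K →
          b * ((t.N f + (K * t.N f) ^ 2 * (1 + K * t.N f)) * scale (k + 1) x) ≤
            K * t.N f * scale (k + 1) x := by
        intro b x hb hbK
        have p := (scale_pos (k + 1) x).le
        calc _ ≤ b * ((2 * t.N f) * scale (k + 1) x) := by gcongr
          _ = 2 * b * (t.N f * scale (k + 1) x) := by ring
          _ ≤ K * (t.N f * scale (k + 1) x) := by gcongr
          _ = _ := by ring
      refine ⟨hadm, by linarith, ?_, ?_, ?_⟩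
      · exact (s1 f hf k _ q2 hall i1 i2).trans (fin _ _ hb₁ (by linarith))
      · exact (s2 f hf k _ q2 hall i1 i2).trans (fin _ _ hb₂ (by linarith))
      · exact (s3 f hf k _ q2 hall i1 i2).trans (fin _ _ hb₃ (by linarith))

/-- The errors already decay at twice the old rate, up to the loss `2μ + l`. For a fixed `f` with
all norms finite the contribution of `f` decays as fast as desired, so this rate passes to the
increments. The constants now depend on `f`. -/
theorem exists_rate_succ (f : V) (hf : f ∈ t.X) (hadm : ∀ k, t.Adm f k) (α' : ℝ)
    (hα' : t.α ≤ α')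
    (h : ∀ m, ∃ C, 0 ≤ C ∧ ∀ k, t.P m (t.w f k) ≤ C * scale k (m - α')) (m : ℕ) :
    ∃ C, 0 ≤ C ∧ ∀ k, t.P m (t.w f k) ≤ C * scale k (m - (2 * α' - 2 * t.μ - t.l)) := by
  -- This `s` is also the order in which `f` is measured: the band of `f` then decays faster than
  -- the target rate, at the cost of a constant containing `Q s f`.
  obtain ⟨s, hs⟩ := exists_nat_gt (2 * α' - 2 * t.μ)
  obtain ⟨r₁, hr₁, i1⟩ := h t.μ
  obtain ⟨r₂, hr₂, i2⟩ := h (s + t.μ)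
  have key : ∀ m : ℕ, ∃ C, 0 ≤ C ∧ ∀ k, t.Q (m + t.l) (t.g f (k + 1)) ≤
      C * scale (k + 1) (m - (2 * α' - 2 * t.μ - t.l)) := by
    intro m
    obtain ⟨C₁, hC₁, h1⟩ := t.exists_Q_g_le α' hα' s hs (m + t.l)
    obtain ⟨C₂, hC₂, h2⟩ := t.exists_Q_smooth_diff_le s (m + t.l)
    have hQ := t.Q_nonneg s f
    refine ⟨C₂ * 2 ^ (-(((m + t.l : ℕ) : ℝ) - s)) * t.Q s f +
      C₁ * ((r₁ + r₂) ^ 2 * (1 + (r₁ + r₂))), by positivity, fun k => ?_⟩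
    have := h1 f hf k (r₁ + r₂) (by positivity) (fun j _ => hadm j)
      (fun j _ => (i1 j).trans (mul_le_mul_of_nonneg_right (by linarith) (scale_pos _ _).le))
      (fun j _ => (i2 j).trans (mul_le_mul_of_nonneg_right (by linarith) (scale_pos _ _).le))
    refine this.trans ((add_le_add (h2 k f hf) le_rfl).trans ?_)
    have e : ((m + t.l : ℕ) : ℝ) + 2 * t.μ - 2 * α' = m - (2 * α' - 2 * t.μ - t.l) := by
      push_cast; ring
    have e2 : scale (k + 1) (((m + t.l : ℕ) : ℝ) - s) ≤
        scale (k + 1) (m - (2 * α' - 2 * t.μ - t.l)) := by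
      apply scale_le
      push_cast
      linarith
    rw [e, scale_le_scale_succ k, add_mul]
    refine add_le_add ?_ (le_of_eq (by ring))
    calc _ = C₂ * 2 ^ (-(((m + t.l : ℕ) : ℝ) - s)) * t.Q s f *
          scale (k + 1) (((m + t.l : ℕ) : ℝ) - s) := by ring
      _ ≤ _ := by gcongr
  obtain ⟨C₁, hC₁, h1⟩ := t.exists_P_w_le m
  obtain ⟨C₂, hC₂, h2⟩ := key m
  obtain ⟨C₃, hC₃, h3⟩ := key 0
  have hP := t.P_nonneg m (t.w f 0)
  refine ⟨C₁ * (C₂ + C₃) + t.P m (t.w f 0), by positivity, fun k => ?_⟩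
  rcases k with - | k
  · rw [scale_zero_left, mul_one]
    exact le_add_of_nonneg_left (by positivity)
  · have := h1 f hf (k + 1) (C₂ + C₃) (2 * α' - 2 * t.μ - t.l) (by positivity) (hadm _)
      ((h2 k).trans (mul_le_mul_of_nonneg_right (by linarith) (scale_pos _ _).le))
      (by
        have h := h3 k
        rw [zero_add, Nat.cast_zero, zero_sub] at h
        exact h.trans (mul_le_mul_of_nonneg_right (by linarith) (scale_pos _ _).le))
    refine this.trans ?_
    rw [← mul_assoc]
    exact mul_le_mul_of_nonneg_right (le_add_of_nonneg_right hP) (scale_pos _ _).le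

/-- Each improvement raises the rate by at least `α - l - 2μ`, which is positive, so finitely many
of them push it beyond `m`. -/
theorem summable_P_w (f : V) (hf : f ∈ t.X) (hadm : ∀ k, t.Adm f k)
    (h : ∀ m, ∃ C, 0 ≤ C ∧ ∀ k, t.P m (t.w f k) ≤ C * scale k (m - t.α)) (m : ℕ) :
    Summable fun k => t.P m (t.w f k) := by
  have hβ : 0 < t.α - t.l - 2 * t.μ := by linarith [t.hl]
  have key : ∀ i : ℕ, ∃ α', t.α + i * (t.α - t.l - 2 * t.μ) ≤ α' ∧
      ∀ m, ∃ C, 0 ≤ C ∧ ∀ k, t.P m (t.w f k) ≤ C * scale k (m - α') := by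
    intro i
    induction i with
    | zero => exact ⟨t.α, by simp, h⟩
    | succ i ih =>
      obtain ⟨α', h1, h2⟩ := ih
      have h3 : (0 : ℝ) ≤ i * (t.α - t.l - 2 * t.μ) := by positivity
      exact ⟨2 * α' - 2 * t.μ - t.l, by push_cast; linarith,
        t.exists_rate_succ f hf hadm α' (by linarith) h2⟩
  obtain ⟨i, hi⟩ := exists_nat_gt ((m - t.α) / (t.α - t.l - 2 * t.μ))
  rw [div_lt_iff₀ hβ] at hi
  obtain ⟨α', h1, h2⟩ := key i
  obtain ⟨C, -, h3⟩ := h2 m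
  exact Summable.of_nonneg_of_le (fun k => t.P_nonneg _ _) h3
    ((summable_scale (by linarith)).mul_left C)

/-- The residual at step `k + 1` is `e_k + (E_k - S_k E_k) - (f - S_k f)`. The error terms decay
like `2^{k(2μ-2α)}`, and `f` is approximated by its smoothings. -/
theorem tendsto_Q_residual (f : V) (hf : f ∈ t.X) (hadm : ∀ k, t.Adm f k) (s : ℕ)
    (hs : 2 * t.α - 2 * t.μ < s) (R : ℝ) (hR : 0 ≤ R)
    (hw : ∀ j, t.P t.μ (t.w f j) ≤ R * scale j (t.μ - t.α))
    (hwA : ∀ j, t.P (s + t.μ) (t.w f j) ≤ R * scale j (((s + t.μ : ℕ) : ℝ) - t.α)) :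
    Tendsto (fun k => t.Q 0 (t.Φ (t.u f k) - f)) atTop (𝓝 0) := by
  obtain ⟨C₁, hC₁, h1⟩ := t.exists_error_le t.α le_rfl s hs
  obtain ⟨C₂, hC₂, h2⟩ := t.exists_Q_E_le t.α le_rfl s hs
  obtain ⟨C₃, hC₃, h3⟩ := t.Q_approx s 0 (Nat.zero_le _)
  obtain ⟨C₄, hC₄, h4⟩ := t.Q_approx 1 0 (Nat.zero_le _)
  rw [← tendsto_add_atTop_iff_nat 1]
  have lim : Tendsto (fun k => (C₁ + C₃ * C₂) * (R ^ 2 * (1 + R)) *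
      scale k (2 * t.μ - 2 * t.α) + C₄ * t.Q 1 f * scale k (-1)) atTop (𝓝 0) := by
    simpa using ((tendsto_scale (x := 2 * t.μ - 2 * t.α) (by linarith [t.hμ])).const_mul
      ((C₁ + C₃ * C₂) * (R ^ 2 * (1 + R)))).add
      ((tendsto_scale (x := -1) (by norm_num)).const_mul (C₄ * t.Q 1 f))
  refine squeeze_zero (fun k => t.Q_nonneg _ _) (fun k => ?_) lim
  have hk := hadm k
  have he := hk.e_mem hf (hadm (k + 1)).P_u
  have hE := hk.E_mem
  have mE := t.X.sub_mem hE (t.S_mem k _ hE)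
  have mf := t.X.sub_mem hf (t.S_mem k _ hf)
  have id : t.Φ (t.u f (k + 1)) - f =
      (t.e f k + (t.E f k - t.S k (t.E f k))) - (f - t.S k f) := by
    have h5 : t.Φ (t.u f (k + 1)) = t.E f (k + 1) + t.G f (k + 1) := by
      rw [E]; abel
    rw [h5, E_succ, G_succ, t.S_sub k _ hf _ hE]
    abel
  rw [id]
  refine (t.Q_sub 0 _ (t.X.add_mem he mE) _ mf).trans (add_le_add
    ((t.Q_add 0 _ he _ mE).trans ?_) ?_)
  · have b1 := (h1 f hf k R hR (fun j _ => hadm j) (hadm (k + 1)).P_u (fun j _ => hw j)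
      (fun j _ => hwA j)).1
    have b2 := (h3 k _ hE).trans (mul_le_mul_of_nonneg_left (mul_le_mul_of_nonneg_left
      (h2 f hf k R hR (fun j _ => hadm j) (fun j _ => hw j) (fun j _ => hwA j))
      (scale_pos _ _).le) hC₃)
    refine (add_le_add b1 b2).trans (le_of_eq ?_)
    have e1 : scale k (((0 : ℕ) : ℝ) - s) * scale k (s + 2 * t.μ - 2 * t.α) =
        scale k (2 * t.μ - 2 * t.α) := by
      rw [← scale_add]; congr 1; push_cast; ring
    rw [← e1]; ring
  · refine (h4 k f hf).trans (le_of_eq ?_)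
    rw [show ((0 : ℕ) : ℝ) - ((1 : ℕ) : ℝ) = -1 by norm_num]
    ring

/-- The iteration converges for small data. -/
theorem exists_iteration : ∃ δ, 0 < δ ∧ ∃ C : ℕ → ℝ, (∀ m, 0 ≤ C m) ∧ ∀ f ∈ t.X, t.N f ≤ δ →
    (∀ k, t.w f k ∈ t.X) ∧ (∀ m k, t.P m (t.w f k) ≤ C m * (t.N f * scale k (m - t.α))) ∧
    (∀ m, Summable fun k => t.P m (t.w f k)) ∧ (∀ k, t.P t.μ (t.u f k) ≤ 1 / 2) ∧
    Tendsto (fun k => t.Q 0 (t.Φ (t.u f k) - f)) atTop (𝓝 0) := by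
  obtain ⟨s, hs⟩ := exists_nat_gt (2 * t.α - 2 * t.μ)
  obtain ⟨δ, hδ, K, hK, h⟩ := t.exists_forall_adm s hs
  choose A hA a using t.exists_P_w_zero_le
  choose B hB b using t.exists_P_w_succ_le s hs
  refine ⟨δ, hδ, fun m => A m + B m * (1 + 2 * K), fun m => ?_, fun f hf hfδ => ?_⟩
  · have := hA m
    have := hB m
    positivity
  obtain ⟨hK1, hk⟩ := h f hf hfδ
  have hN := t.N_nonneg f
  have hadm : ∀ k, t.Adm f k := fun k => (hk k).1
  have hw := fun k => (hk k).2.2.1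
  have hwA := fun k => (hk k).2.2.2.2
  have bound : ∀ m k, t.P m (t.w f k) ≤
      (A m + B m * (1 + 2 * K)) * (t.N f * scale k (m - t.α)) := by
    intro m k
    have hAm := hA m
    have hBm := hB m
    rcases k with - | k
    · rw [scale_zero_left, mul_one]
      exact (a m f hf).trans (mul_le_mul_of_nonneg_right
        (le_add_of_nonneg_right (by positivity)) hN)
    · have p := (scale_pos (k + 1) (m - t.α)).le
      have hR0 : 0 ≤ K * t.N f := by positivity
      have h2 : (K * t.N f) ^ 2 * (1 + K * t.N f) ≤ 2 * (K * t.N f) := by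
        have : (K * t.N f) * (1 + K * t.N f) ≤ 2 := by nlinarith
        nlinarith
      calc _ ≤ B m * ((t.N f + (K * t.N f) ^ 2 * (1 + K * t.N f)) *
            scale (k + 1) (m - t.α)) :=
            b m f hf k _ hR0 (fun j _ => hadm j) (fun j _ => hw j) (fun j _ => hwA j)
        _ ≤ B m * ((t.N f + 2 * (K * t.N f)) * scale (k + 1) (m - t.α)) := by gcongr
        _ = B m * (1 + 2 * K) * (t.N f * scale (k + 1) (m - t.α)) := by ring
        _ ≤ _ := mul_le_mul_of_nonneg_right (le_add_of_nonneg_left hAm) (by positivity)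
  refine ⟨fun k => (hadm k).w_mem hf, bound, t.summable_P_w f hf hadm fun m =>
    ⟨(A m + B m * (1 + 2 * K)) * t.N f, ?_, fun k => (bound m k).trans (le_of_eq (by ring))⟩,
    fun k => (hk k).2.1, t.tendsto_Q_residual f hf hadm s hs _ (by positivity) hw hwA⟩
  have := hA m
  have := hB m
  positivity

end TameData
end NashMoser
end

/-! ### Mean value inequality and quadratic error estimates. -/

noncomputable section
namespace NashMoser

attribute [local irreducible] tnorm

section meanValue
variable {n : ℕ} {T : ℝ} {k : ℕ∞} {J : ℕ} {u v w : Fun n T}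

theorem IsCkCinf.sub (hT : 0 < T) (hu : IsCkCinf k u) (hv : IsCkCinf k v) : IsCkCinf k (u - v) :=
  (ckCinf n hT k).sub_mem hu hv

theorem tnorm_zero_fun (hT : 0 < T) (a : ℝ) (J : ℕ) : tnorm a J (0 : Fun n T) = 0 := by
  have := tnorm_smul hT a (isCkCinf_zero (n := n) (T := T) J) 0
  rwa [abs_zero, zero_mul, zero_smul] at this

theorem tnorm_sub_le (hT : 0 < T) {a : ℝ} (ha : 0 ≤ a) (hu : IsCkCinf J u) (hv : IsCkCinf J v) :
    tnorm a J (u - v) ≤ tnorm a J u + tnorm a J v := by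
  have := tnorm_add_le hT ha hu (hv.smul hT (-1))
  rwa [tnorm_smul hT a hv, abs_neg, abs_one, one_mul, neg_one_smul, ← sub_eq_add_neg] at this

theorem tnorm_sub_comm (hT : 0 < T) (a : ℝ) (hu : IsCkCinf J u) (hv : IsCkCinf J v) :
    tnorm a J (u - v) = tnorm a J (v - u) := by
  have := tnorm_smul hT a (hu.sub hT hv) (-1)
  rwa [abs_neg, abs_one, one_mul, neg_one_smul, neg_sub, eq_comm] at this

/-- The mean value inequality for a curve in `C^J([0,T], C^∞(Ω̄))`. -/
theorem tnorm_sub_le_of_tendsto (hT : 0 < T) {a M : ℝ} (ha : 0 ≤ a) {φ G : ℝ → Fun n T}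
    (hφ : ∀ r ∈ Icc (0 : ℝ) 1, IsCkCinf J (φ r)) (hG : ∀ r ∈ Icc (0 : ℝ) 1, IsCkCinf J (G r))
    (h : ∀ r ∈ Icc (0 : ℝ) 1,
      Tendsto (fun s : ℝ => tnorm a J (s⁻¹ • (φ (r + s) - φ r) - G r)) (𝓝[≠] 0) (𝓝 0))
    (hM : ∀ r ∈ Icc (0 : ℝ) 1, tnorm a J (G r) ≤ M) :
    tnorm a J (φ 1 - φ 0) ≤ M := by
  have h0 : (0 : ℝ) ∈ Icc (0 : ℝ) 1 := ⟨le_rfl, zero_le_one⟩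
  have h1 : (1 : ℝ) ∈ Icc (0 : ℝ) 1 := ⟨zero_le_one, le_rfl⟩
  set q : ℝ → ℝ → ℝ := fun r s => tnorm a J (s⁻¹ • (φ (r + s) - φ r) - G r) with hq
  have key : ∀ r ∈ Icc (0 : ℝ) 1, ∀ z ∈ Icc (0 : ℝ) 1, z ≠ r →
      tnorm a J (φ z - φ r) ≤ |z - r| * (q r (z - r) + M) := by
    intro r hr z hz hzr
    have hzr' : z - r ≠ 0 := sub_ne_zero.2 hzr
    have m1 := (hφ z hz).sub hT (hφ r hr)
    have m2 := (m1.smul hT (z - r)⁻¹).sub hT (hG r hr)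
    have e : φ z - φ r = (z - r) • (((z - r)⁻¹ • (φ z - φ r) - G r) + G r) := by
      rw [sub_add_cancel, smul_smul, mul_inv_cancel₀ hzr', one_smul]
    rw [e, tnorm_smul hT a (m2.add hT (hG r hr))]
    have := tnorm_add_le hT ha m2 (hG r hr)
    simp only [hq, add_sub_cancel]
    gcongr
    linarith [hM r hr]
  have shift : ∀ r ∈ Icc (0 : ℝ) 1, Tendsto (fun z => q r (z - r)) (𝓝[≠] r) (𝓝 0) := by
    intro r hr
    refine (h r hr).comp (tendsto_nhdsWithin_iff.2 ⟨?_, ?_⟩)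
    · have : Tendsto (fun z : ℝ => z - r) (𝓝 r) (𝓝 (r - r)) :=
        (continuous_id.sub continuous_const).tendsto r
      rw [sub_self] at this
      exact this.mono_left nhdsWithin_le_nhds
    · filter_upwards [self_mem_nhdsWithin] with z hz using sub_ne_zero.2 hz
  -- The vector-valued statement is reduced to this scalar function. Its right slopes are
  -- asymptotically at most `M`, so it stays below `M * r`; no integral in the Fréchet space is
  -- needed.
  set f : ℝ → ℝ := fun r => tnorm a J (φ r - φ 0) with hf
  have tri : ∀ r ∈ Icc (0 : ℝ) 1, ∀ z ∈ Icc (0 : ℝ) 1,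
      f z ≤ f r + tnorm a J (φ z - φ r) := by
    intro r hr z hz
    have := tnorm_add_le hT ha ((hφ r hr).sub hT (hφ 0 h0)) ((hφ z hz).sub hT (hφ r hr))
    rwa [show φ r - φ 0 + (φ z - φ r) = φ z - φ 0 by abel] at this
  have dist : ∀ r ∈ Icc (0 : ℝ) 1, ∀ z ∈ Icc (0 : ℝ) 1, |f z - f r| ≤ tnorm a J (φ z - φ r) := by
    intro r hr z hz
    have h2 := tri z hz r hr
    rw [tnorm_sub_comm hT a (hφ r hr) (hφ z hz)] at h2
    rw [abs_le]
    constructor <;> linarith [tri r hr z hz]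
  have cont : ContinuousOn f (Icc 0 1) := by
    intro r hr
    have hd : Tendsto f (𝓝[Icc 0 1 \ {r}] r) (𝓝 (f r)) := by
      rw [tendsto_iff_dist_tendsto_zero]
      have l1 : Tendsto (fun z => |z - r| * (q r (z - r) + M)) (𝓝[≠] r) (𝓝 0) := by
        have l2 : Tendsto (fun z : ℝ => |z - r|) (𝓝[≠] r) (𝓝 0) := by
          have : Tendsto (fun z : ℝ => |z - r|) (𝓝 r) (𝓝 |r - r|) :=
            (continuous_id.sub continuous_const).abs.tendsto r
          rw [sub_self, abs_zero] at this
          exact this.mono_left nhdsWithin_le_nhds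
        simpa using l2.mul ((shift r hr).add_const M)
      refine squeeze_zero' (Eventually.of_forall fun _ => dist_nonneg) ?_
        (l1.mono_left (nhdsWithin_mono r fun z hz => hz.2))
      filter_upwards [self_mem_nhdsWithin] with z hz
      exact (dist r hr z hz.1).trans (key r hr z hz.1 hz.2)
    exact continuousWithinAt_sdiff_self.1 hd
  have fin := image_le_of_liminf_slope_right_le_deriv_boundary (f := f) (a := 0) (b := 1)
    (B := fun r => M * r) (B' := fun _ => M) cont
    (by simp [hf, tnorm_zero_fun hT]) (by fun_prop)
    (fun x _ => by simpa using ((hasDerivAt_id x).const_mul M).hasDerivWithinAt)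
    (fun x hx r hr => by
      have hx' : x ∈ Icc (0 : ℝ) 1 := ⟨hx.1, hx.2.le⟩
      have l1 : ∀ᶠ z in 𝓝[>] x, q x (z - x) < r - M :=
        ((shift x hx').mono_left (nhdsWithin_mono x fun z (hz : x < z) => ne_of_gt hz)).eventually
          (gt_mem_nhds (by linarith))
      have l2 : ∀ᶠ z in 𝓝[>] x, z ∈ Ioo x 1 := Ioo_mem_nhdsGT hx.2
      refine (l1.and l2).frequently.mono fun z hz => ?_
      have hz' : z ∈ Icc (0 : ℝ) 1 := ⟨hx.1.trans hz.2.1.le, hz.2.2.le⟩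
      have hpos : 0 < z - x := sub_pos.2 hz.2.1
      have h2 := (le_abs_self _).trans ((dist x hx' z hz').trans (key x hx' z hz' hz.2.1.ne'))
      rw [abs_of_pos hpos] at h2
      rw [slope_def_field, div_lt_iff₀ hpos, mul_comm]
      refine h2.trans_lt (mul_lt_mul_of_pos_left ?_ hpos)
      linarith [hz.1])
    h1
  simpa using fin

theorem tnorm_segment_le (hT : 0 < T) {a : ℝ} (ha : 0 ≤ a) (hu : IsCkCinf J u)
    (hv : IsCkCinf J (u + v)) {r : ℝ} (hr : r ∈ Icc (0 : ℝ) 1) :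
    tnorm a J (u + r • v) ≤ (1 - r) * tnorm a J u + r * tnorm a J (u + v) := by
  have e : u + r • v = (1 - r) • u + r • (u + v) := by
    rw [smul_add, sub_smul, one_smul]; abel
  rw [e]
  refine (tnorm_add_le hT ha (hu.smul hT _) (hv.smul hT _)).trans (le_of_eq ?_)
  rw [tnorm_smul hT a hu, tnorm_smul hT a hv, abs_of_nonneg hr.1,
    abs_of_nonneg (sub_nonneg.2 hr.2)]

end meanValue

section errorEstimate
variable {n : ℕ} {T : ℝ} {U : Set (Fun n T)} {Φ : Fun n T → Fun n T}
  {Φ₁ : Fun n T → Fun n T →ₗ[ℝ] Fun n T}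
  {Φ₂ : Fun n T → Fun n T →ₗ[ℝ] Fun n T →ₗ[ℝ] Fun n T} {μ : ℝ}

/-- Along the segment the curve `r ↦ Φ₁ (u + r v) w` has derivative `Φ₂ (u + r v) v w`. Convexity of
the norms keeps the segment in the unit ball, where (H1) bounds this derivative. -/
theorem exists_tnorm_first_sub_le (hT : 0 < T) (hμ : 0 ≤ μ)
    (hball : ∀ u : Fun n T, IsCkCinf 2 u → tnorm μ 2 u ≤ 1 → u ∈ U)
    (hdiff : IsTwiceDifferentiable Φ U Φ₁ Φ₂) (hH1 : TameSecondDerivative μ Φ₂)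
    {a : ℝ} (ha : 0 ≤ a) :
    ∃ C, 0 ≤ C ∧ ∀ u v w : Fun n T, IsCkCinf ⊤ u → IsCkCinf ⊤ v → IsCkCinf ⊤ w →
      tnorm μ 2 u ≤ 1 → tnorm μ 2 (u + v) ≤ 1 →
      tnorm a 0 (Φ₁ (u + v) w - Φ₁ u w) ≤
        C * (tnorm (a + μ) 2 v * tnorm μ 2 w + tnorm μ 2 v * tnorm (a + μ) 2 w +
          (tnorm (a + μ) 2 u + tnorm (a + μ) 2 (u + v)) * (tnorm μ 2 v * tnorm μ 2 w)) := by
  obtain ⟨C, hC⟩ := hH1 a ha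
  refine ⟨max C 0, le_max_right _ _, fun u v w hu hv hw hu1 huv1 => ?_⟩
  have huv := hu.add hT hv
  have seg : ∀ r ∈ Icc (0 : ℝ) 1, IsCkCinf ⊤ (u + r • v) ∧ tnorm μ 2 (u + r • v) ≤ 1 := by
    intro r hr
    refine ⟨hu.add hT (hv.smul hT r), ?_⟩
    refine (tnorm_segment_le hT hμ (hu.mono le_top) (huv.mono le_top) hr).trans ?_
    nlinarith [mul_le_mul_of_nonneg_left hu1 (sub_nonneg.2 hr.2),
      mul_le_mul_of_nonneg_left huv1 hr.1]
  have segU : ∀ r ∈ Icc (0 : ℝ) 1, u + r • v ∈ U := fun r hr =>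
    hball _ ((seg r hr).1.mono le_top) (seg r hr).2
  have main := tnorm_sub_le_of_tendsto hT (J := 0) ha (φ := fun r => Φ₁ (u + r • v) w)
    (G := fun r => Φ₂ (u + r • v) v w)
    (M := max C 0 * (tnorm (a + μ) 2 v * tnorm μ 2 w + tnorm μ 2 v * tnorm (a + μ) 2 w +
          (tnorm (a + μ) 2 u + tnorm (a + μ) 2 (u + v)) * (tnorm μ 2 v * tnorm μ 2 w)))
    (fun r hr => hdiff.mem_first _ (segU r hr) (seg r hr).1 w hw)
    (fun r hr => hdiff.mem_second _ (segU r hr) (seg r hr).1 v w hv hw)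
    (fun r hr => by
      have := hdiff.second _ (segU r hr) (seg r hr).1 v w hv hw a ha
      simpa only [add_smul, add_assoc] using this)
    (fun r hr => by
      have n1 := tnorm_nonneg (a + μ) 2 v
      have n2 := tnorm_nonneg (a + μ) 2 w
      have n3 := tnorm_nonneg (a + μ) 2 u
      have n4 := tnorm_nonneg (a + μ) 2 (u + v)
      have n5 := tnorm_nonneg μ 2 v
      have n6 := tnorm_nonneg μ 2 w
      have n7 := tnorm_nonneg (a + μ) 2 (u + r • v)
      have h2 := (tnorm_segment_le hT (a := a + μ) (by positivity)
        (hu.mono (l := (2 : ℕ)) le_top) (huv.mono le_top) hr)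
      have h3 : tnorm (a + μ) 2 (u + r • v) ≤
          tnorm (a + μ) 2 u + tnorm (a + μ) 2 (u + v) := by
        nlinarith [mul_nonneg hr.1 n3, mul_nonneg (sub_nonneg.2 hr.2) n4]
      have hC0 : 0 ≤ max C 0 := le_max_right _ _
      refine (hC _ v w (seg r hr).1 hv hw (seg r hr).2).trans ?_
      rw [← mul_add]
      refine (mul_le_mul_of_nonneg_right (le_max_left C 0) (by positivity)).trans ?_
      rw [mul_assoc (tnorm (a + μ) 2 (u + r • v))]
      gcongr)
  simpa using main

/-- The curve `Φ(u + r w) - r Φ₁ u w` has derivative `Φ₁ (u + r w) w - Φ₁ u w`. The estimate for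
differences of first derivatives, with increment `r w`, makes it quadratic in `w`. -/
theorem exists_tnorm_taylor_le (hT : 0 < T) (hμ : 0 ≤ μ)
    (hball : ∀ u : Fun n T, IsCkCinf 2 u → tnorm μ 2 u ≤ 1 → u ∈ U)
    (hsmooth : ∀ u ∈ U, IsCkCinf ⊤ u → IsCkCinf ⊤ (Φ u))
    (hdiff : IsTwiceDifferentiable Φ U Φ₁ Φ₂) (hH1 : TameSecondDerivative μ Φ₂)
    {a : ℝ} (ha : 0 ≤ a) :
    ∃ C, 0 ≤ C ∧ ∀ u w : Fun n T, IsCkCinf ⊤ u → IsCkCinf ⊤ w →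
      tnorm μ 2 u ≤ 1 → tnorm μ 2 (u + w) ≤ 1 →
      tnorm a 0 (Φ (u + w) - Φ u - Φ₁ u w) ≤
        C * (2 * (tnorm (a + μ) 2 w * tnorm μ 2 w) +
          (2 * tnorm (a + μ) 2 u + tnorm (a + μ) 2 w) * (tnorm μ 2 w * tnorm μ 2 w)) := by
  obtain ⟨C, hC0, hC⟩ := exists_tnorm_first_sub_le hT hμ hball hdiff hH1 ha
  refine ⟨C, hC0, fun u w hu hw hu1 huw1 => ?_⟩
  have huw := hu.add hT hw
  have seg : ∀ r ∈ Icc (0 : ℝ) 1, IsCkCinf ⊤ (u + r • w) ∧ tnorm μ 2 (u + r • w) ≤ 1 := by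
    intro r hr
    refine ⟨hu.add hT (hw.smul hT r), ?_⟩
    refine (tnorm_segment_le hT hμ (hu.mono le_top) (huw.mono le_top) hr).trans ?_
    nlinarith [mul_le_mul_of_nonneg_left hu1 (sub_nonneg.2 hr.2),
      mul_le_mul_of_nonneg_left huw1 hr.1]
  have segU : ∀ r ∈ Icc (0 : ℝ) 1, u + r • w ∈ U := fun r hr =>
    hball _ ((seg r hr).1.mono le_top) (seg r hr).2
  have huU : u ∈ U := hball u (hu.mono le_top) hu1
  have hL : IsCkCinf 0 (Φ₁ u w) := hdiff.mem_first u huU hu w hw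
  have main := tnorm_sub_le_of_tendsto hT (J := 0) ha
    (φ := fun r => Φ (u + r • w) - r • Φ₁ u w)
    (G := fun r => Φ₁ (u + r • w) w - Φ₁ u w)
    (M := C * (2 * (tnorm (a + μ) 2 w * tnorm μ 2 w) +
          (2 * tnorm (a + μ) 2 u + tnorm (a + μ) 2 w) * (tnorm μ 2 w * tnorm μ 2 w)))
    (fun r hr => ((hsmooth _ (segU r hr) (seg r hr).1).mono le_top).sub hT (hL.smul hT r))
    (fun r hr => (hdiff.mem_first _ (segU r hr) (seg r hr).1 w hw).sub hT hL)
    (fun r hr => by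
      have := hdiff.first _ (segU r hr) (seg r hr).1 w hw a ha
      refine this.congr' ?_
      filter_upwards [self_mem_nhdsWithin] with s hs
      have e : Φ (u + (r + s) • w) - (r + s) • Φ₁ u w - (Φ (u + r • w) - r • Φ₁ u w) =
          (Φ (u + r • w + s • w) - Φ (u + r • w)) - s • Φ₁ u w := by
        rw [add_smul, add_smul, ← add_assoc]; abel
      rw [e, smul_sub s⁻¹ _ (s • _), smul_smul, inv_mul_cancel₀ hs, one_smul, sub_sub_sub_cancel_right])
    (fun r hr => by
      have n1 := tnorm_nonneg (a + μ) 2 w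
      have n3 := tnorm_nonneg (a + μ) 2 u
      have n6 := tnorm_nonneg μ 2 w
      have hw2 : IsCkCinf (2 : ℕ) w := hw.mono le_top
      have hrw := hC u (r • w) w hu (hw.smul hT r) hw hu1 (seg r hr).2
      have h2 := tnorm_add_le hT (a := a + μ) (by positivity)
        (hu.mono (l := (2 : ℕ)) le_top) (hw2.smul hT r)
      rw [tnorm_smul hT _ hw2, abs_of_nonneg hr.1] at h2
      rw [tnorm_smul hT _ hw2, tnorm_smul hT _ hw2, abs_of_nonneg hr.1] at hrw
      refine hrw.trans (mul_le_mul_of_nonneg_left ?_ hC0)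
      have h3 : tnorm (a + μ) 2 (u + r • w) ≤ tnorm (a + μ) 2 u + tnorm (a + μ) 2 w :=
        h2.trans (add_le_add le_rfl (mul_le_of_le_one_left n1 hr.2))
      have b1 : r * tnorm (a + μ) 2 w ≤ tnorm (a + μ) 2 w := mul_le_of_le_one_left n1 hr.2
      have b2 : r * tnorm μ 2 w ≤ tnorm μ 2 w := mul_le_of_le_one_left n6 hr.2
      have b3 : 0 ≤ r * tnorm μ 2 w := mul_nonneg hr.1 n6
      calc _ ≤ tnorm (a + μ) 2 w * tnorm μ 2 w + tnorm μ 2 w * tnorm (a + μ) 2 w +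
            (tnorm (a + μ) 2 u + (tnorm (a + μ) 2 u + tnorm (a + μ) 2 w)) *
              (tnorm μ 2 w * tnorm μ 2 w) := by gcongr
        _ = _ := by ring)
  simpa [sub_right_comm] using main

/-- Sum of a Taylor remainder at `u` and the change of the linearization from `v` to `u`. It is kept
bilinear in `w` and `u - v`, as both will be small at the same rate when `v` is the smoothing of
`u`. -/
theorem exists_tnorm_error_le (hT : 0 < T) (hμ : 0 ≤ μ)
    (hball : ∀ u : Fun n T, IsCkCinf 2 u → tnorm μ 2 u ≤ 1 → u ∈ U)
    (hsmooth : ∀ u ∈ U, IsCkCinf ⊤ u → IsCkCinf ⊤ (Φ u))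
    (hdiff : IsTwiceDifferentiable Φ U Φ₁ Φ₂) (hH1 : TameSecondDerivative μ Φ₂)
    {a : ℝ} (ha : 0 ≤ a) :
    ∃ C, 0 ≤ C ∧ ∀ u v w : Fun n T, IsCkCinf ⊤ u → IsCkCinf ⊤ v → IsCkCinf ⊤ w →
      tnorm μ 2 u ≤ 1 → tnorm μ 2 v ≤ 1 → tnorm μ 2 (u + w) ≤ 1 →
      tnorm a 0 (Φ (u + w) - Φ u - Φ₁ v w) ≤
        C * (tnorm (a + μ) 2 w * tnorm μ 2 w + tnorm (a + μ) 2 (u - v) * tnorm μ 2 w +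
          tnorm μ 2 (u - v) * tnorm (a + μ) 2 w +
          (tnorm (a + μ) 2 u + tnorm (a + μ) 2 v + tnorm (a + μ) 2 w) *
            ((tnorm μ 2 (u - v) + tnorm μ 2 w) * tnorm μ 2 w)) := by
  obtain ⟨C, hC, h1⟩ := exists_tnorm_taylor_le hT hμ hball hsmooth hdiff hH1 ha
  obtain ⟨C', hC', h2⟩ := exists_tnorm_first_sub_le hT hμ hball hdiff hH1 ha
  refine ⟨2 * C + C', by positivity, fun u v w hu hv hw hu1 hv1 huw1 => ?_⟩
  have inU : ∀ u : Fun n T, IsCkCinf ⊤ u → tnorm μ 2 u ≤ 1 → u ∈ U := fun u hu hu1 =>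
    hball u (hu.mono le_top) hu1
  have huw := hu.add hT hw
  have mu := hdiff.mem_first u (inU u hu hu1) hu w hw
  have mv := hdiff.mem_first v (inU v hv hv1) hv w hw
  have m1 := (((hsmooth _ (inU _ huw huw1) huw).sub hT (hsmooth u (inU u hu hu1) hu)).mono
    (l := (0 : ℕ)) le_top).sub hT mu
  have e : Φ (u + w) - Φ u - Φ₁ v w = (Φ (u + w) - Φ u - Φ₁ u w) + (Φ₁ u w - Φ₁ v w) := by abel
  have b2 := h2 v (u - v) w hv (hu.sub hT hv) hw hv1 (by rwa [add_sub_cancel])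
  rw [add_sub_cancel] at b2
  rw [e]
  refine (tnorm_add_le hT ha m1 (mu.sub hT mv)).trans
    ((add_le_add (h1 u w hu hw hu1 huw1) b2).trans ?_)
  have n1 := tnorm_nonneg (a + μ) 2 w
  have n2 := tnorm_nonneg (a + μ) 2 u
  have n3 := tnorm_nonneg (a + μ) 2 v
  have n4 := tnorm_nonneg (a + μ) 2 (u - v)
  have n5 := tnorm_nonneg μ 2 w
  have n6 := tnorm_nonneg μ 2 (u - v)
  generalize tnorm (a + μ) 2 w = A at *
  generalize tnorm (a + μ) 2 u = A₁ at *
  generalize tnorm (a + μ) 2 v = A₂ at *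
  generalize tnorm (a + μ) 2 (u - v) = A₃ at *
  generalize tnorm μ 2 w = B at *
  generalize tnorm μ 2 (u - v) = B₁ at *
  set Z := A * B + A₃ * B + B₁ * A + (A₁ + A₂ + A) * ((B₁ + B) * B) with hZ
  rw [add_mul (2 * C)]
  refine add_le_add ?_ (mul_le_mul_of_nonneg_left ?_ hC')
  · rw [mul_comm 2 C, mul_assoc]
    refine mul_le_mul_of_nonneg_left ?_ hC
    have : 2 * Z - (2 * (A * B) + (2 * A₁ + A) * (B * B)) =
        2 * (A₃ * B) + 2 * (B₁ * A) + 2 * ((A₁ + A₂ + A) * (B₁ * B)) +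
          2 * (A₂ * (B * B)) + A * (B * B) := by rw [hZ]; ring
    have : 0 ≤ 2 * Z - (2 * (A * B) + (2 * A₁ + A) * (B * B)) := by rw [this]; positivity
    linarith
  · have : Z - (A₃ * B + B₁ * A + (A₂ + A₁) * (B₁ * B)) =
        A * B + A * (B₁ * B) + (A₁ + A₂ + A) * (B * B) := by rw [hZ]; ring
    have : 0 ≤ Z - (A₃ * B + B₁ * A + (A₂ + A₁) * (B₁ * B)) := by rw [this]; positivity
    linarith

end errorEstimate
end NashMoser
end

/-! ### Termwise differentiation of series and completeness. -/

noncomputable section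
namespace NashMoser
open MeasureTheory

section series
variable {V W : Type*} [NormedAddCommGroup V] [NormedSpace ℝ V] [NormedAddCommGroup W]
  [NormedSpace ℝ W] [CompleteSpace W]

theorem integral_count_nat {f : ℕ → W} (hf : Integrable f Measure.count) :
    ∫ k, f k ∂Measure.count = ∑' k, f k := by
  rw [integral_countable hf]
  simp

/-- A series is an integral for the counting measure, so the result on differentiation under the
integral applies. Having it within a convex set covers the closed ball and `[0, T]` up to their
boundaries. -/
theorem hasFDerivWithinAt_tsum_of_convex {s : Set V} (hs : Convex ℝ s) {F : ℕ → V → W}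
    {F' : ℕ → V → V →L[ℝ] W} {b b' : ℕ → ℝ} (hb : Summable b) (hb' : Summable b')
    (hF : ∀ k, ∀ x ∈ s, ‖F k x‖ ≤ b k) (hF' : ∀ k, ∀ x ∈ s, ‖F' k x‖ ≤ b' k)
    (h : ∀ k, ∀ x ∈ s, HasFDerivWithinAt (F k) (F' k x) s x) {x₀ : V} (hx₀ : x₀ ∈ s) :
    HasFDerivWithinAt (fun x => ∑' k, F k x) (∑' k, F' k x₀) s x₀ := by
  have hi : ∀ x ∈ s, Integrable (fun k => F k x) Measure.count := fun x hx =>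
    integrable_count_iff.2 (hb.of_nonneg_of_le (fun _ => norm_nonneg _) fun k => hF k x hx)
  have hi' : Integrable (fun k => F' k x₀) Measure.count :=
    integrable_count_iff.2 (hb'.of_nonneg_of_le (fun _ => norm_nonneg _) fun k => hF' k x₀ hx₀)
  have key := hasFDerivWithinAt_integral_of_convex (ν := Measure.count) hs
    (F := fun x k => F k x) (F' := fun x k => F' k x) (bound := b')
    (integrable_count_iff.2 hb'.norm) hi hx₀ hi'.aestronglyMeasurable
    (ae_of_all _ fun k x hx => ⟨h k x hx, hF' k x hx⟩)
  rw [integral_count_nat hi'] at key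
  exact key.congr (fun x hx => (integral_count_nat (hi x hx)).symm)
    (integral_count_nat (hi x₀ hx₀)).symm

theorem hasDerivWithinAt_tsum_of_convex {s : Set ℝ} (hs : Convex ℝ s) {F F' : ℕ → ℝ → W}
    {b b' : ℕ → ℝ} (hb : Summable b) (hb' : Summable b')
    (hF : ∀ k, ∀ x ∈ s, ‖F k x‖ ≤ b k) (hF' : ∀ k, ∀ x ∈ s, ‖F' k x‖ ≤ b' k)
    (h : ∀ k, ∀ x ∈ s, HasDerivWithinAt (F k) (F' k x) s x) {x₀ : ℝ} (hx₀ : x₀ ∈ s) :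
    HasDerivWithinAt (fun x => ∑' k, F k x) (∑' k, F' k x₀) s x₀ := by
  have hn : ∀ k, ∀ x ∈ s, ‖ContinuousLinearMap.toSpanSingleton ℝ (F' k x)‖ ≤ b' k :=
    fun k x hx => by rw [ContinuousLinearMap.norm_toSpanSingleton]; exact hF' k x hx
  have key := (hasFDerivWithinAt_tsum_of_convex hs
    (F' := fun k x => ContinuousLinearMap.toSpanSingleton ℝ (F' k x)) hb hb' hF hn
    (fun k x hx => (h k x hx).hasFDerivWithinAt) hx₀).hasDerivWithinAt
  refine key.congr_deriv ?_
  have hsum : Summable fun k => ContinuousLinearMap.toSpanSingleton ℝ (F' k x₀) :=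
    Summable.of_norm_bounded hb' fun k => hn k x₀ hx₀
  have := (ContinuousLinearMap.apply ℝ W (1 : ℝ)).map_tsum hsum
  simpa using this

end series

section completeness
variable {n : ℕ} {T : ℝ} {J : ℕ} {w : ℕ → Fun n T} {t : ℝ} {x : Rn n} {j : ℕ}

theorem IsCkCinf.norm_iteratedFDerivWithin_le {u : Fun n T} {m : ℕ} {C : ℝ}
    (hC : 0 ≤ C) (h : ∀ v : Rn n → Rn n, ContDiffOn ℝ ∞ v (OmegaBar n) → ∀ x ∈ OmegaBar n,
      ‖iteratedFDerivWithin ℝ m v (OmegaBar n) x‖ ≤ C * holderNorm (m : ℝ) v)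
    (hu : IsCkCinf J u) (hj : j ≤ J) (ht : t ∈ Icc (0 : ℝ) T) (hx : x ∈ OmegaBar n) :
    ‖iteratedFDerivWithin ℝ m (timeDeriv j u t) (OmegaBar n) x‖ ≤ C * tnorm (m : ℝ) J u :=
  (h _ ((hu.2 j (by exact_mod_cast hj)).1 t ht) x hx).trans
    (mul_le_mul_of_nonneg_left (holderNorm_le_tnorm hu (Nat.cast_nonneg m) ht hj) hC)

theorem IsCkCinf.norm_timeDeriv_le {u : Fun n T} (hu : IsCkCinf J u) (hj : j ≤ J)
    (ht : t ∈ Icc (0 : ℝ) T) (hx : x ∈ OmegaBar n) :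
    ‖timeDeriv j u t x‖ ≤ tnorm ((0 : ℕ) : ℝ) J u :=
  (norm_le_holderNorm _ ((hu.2 j (by exact_mod_cast hj)).1 t ht) hx).trans
    (holderNorm_le_tnorm hu (Nat.cast_nonneg 0) ht hj)

/-- The pointwise sum of a series. -/
def sumFun (w : ℕ → Fun n T) : Fun n T := fun p => ∑' k, w k p

theorem extend_sumFun (ht : t ∈ Icc (0 : ℝ) T) (hx : x ∈ OmegaBar n) :
    extend (sumFun w) t x = ∑' k, extend (w k) t x := by
  rw [extend_of_mem _ ht hx]
  exact tsum_congr fun k => (extend_of_mem _ ht hx).symm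

theorem timeDeriv_sumFun (hT : 0 < T) (hw : ∀ k, IsCkCinf J (w k))
    (hs : ∀ m : ℕ, Summable fun k => tnorm (m : ℝ) J (w k)) (hj : j ≤ J)
    (ht : t ∈ Icc (0 : ℝ) T) (hx : x ∈ OmegaBar n) :
    timeDeriv j (sumFun w) t x = ∑' k, timeDeriv j (w k) t x := by
  induction j generalizing t with
  | zero => simp only [timeDeriv_zero, extend_sumFun ht hx]
  | succ j ih =>
    rw [timeDeriv, iteratedDerivWithin_succ]
    have h1 := (hasDerivWithinAt_tsum_of_convex (convex_Icc (0 : ℝ) T)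
      (F := fun k s => timeDeriv j (w k) s x) (F' := fun k s => timeDeriv (j + 1) (w k) s x)
      (hs 0) (hs 0) (fun k s hs => (hw k).norm_timeDeriv_le (by omega) hs hx)
      (fun k s hs => (hw k).norm_timeDeriv_le hj hs hx)
      (fun k s hs => (hw k).hasDerivWithinAt_timeDeriv hT (by exact_mod_cast hj) hs hx)
      ht).congr
      (f₁ := iteratedDerivWithin j (fun s => extend (sumFun w) s x) (Icc 0 T))
      (fun s hs => ih (by omega) hs) (ih (by omega) ht)
    exact h1.derivWithin (uniqueDiffOn_Icc hT t ht)

theorem hasFTaylorSeriesUpToOn_timeDeriv_sumFun (hT : 0 < T) (hw : ∀ k, IsCkCinf J (w k))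
    (hs : ∀ m : ℕ, Summable fun k => tnorm (m : ℝ) J (w k)) (hj : j ≤ J)
    (ht : t ∈ Icc (0 : ℝ) T) :
    HasFTaylorSeriesUpToOn ∞ (timeDeriv j (sumFun w) t)
      (fun x m => ∑' k, iteratedFDerivWithin ℝ m (timeDeriv j (w k) t) (OmegaBar n) x)
      (OmegaBar n) := by
  choose C hC h using exists_norm_iteratedFDerivWithin_le_holderNorm n
  have hb : ∀ m k, ∀ x ∈ OmegaBar n,
      ‖iteratedFDerivWithin ℝ m (timeDeriv j (w k) t) (OmegaBar n) x‖ ≤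
        C m * tnorm (m : ℝ) J (w k) := fun m k x hx =>
    (hw k).norm_iteratedFDerivWithin_le (hC m) (h m) hj ht hx
  have hsC : ∀ m, Summable fun k => C m * tnorm (m : ℝ) J (w k) := fun m =>
    (hs m).mul_left (C m)
  have hsum : ∀ m, ∀ x ∈ OmegaBar n, Summable fun k =>
      iteratedFDerivWithin ℝ m (timeDeriv j (w k) t) (OmegaBar n) x := fun m x hx =>
    Summable.of_norm_bounded (hsC m) fun k => hb m k x hx
  refine (hasFTaylorSeriesUpToOn_top_iff' le_rfl).2 ⟨fun x hx => ?_, fun m x hx => ?_⟩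
  · rw [timeDeriv_sumFun hT hw hs hj ht hx]
    have := (continuousMultilinearCurryFin0 ℝ (Rn n)
      (Rn n)).toContinuousLinearEquiv.toContinuousLinearMap.map_tsum (hsum 0 x hx)
    refine Eq.trans this (tsum_congr fun k => ?_)
    rfl
  · have hcl := (continuousMultilinearCurryLeftEquiv ℝ (fun _ : Fin (m + 1) => Rn n)
      (Rn n)).toContinuousLinearEquiv.toContinuousLinearMap.map_tsum (hsum (m + 1) x hx)
    have hd := hasFDerivWithinAt_tsum_of_convex (convex_closedBall (0 : Rn n) 1)
      (F := fun k => iteratedFDerivWithin ℝ m (timeDeriv j (w k) t) (OmegaBar n))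
      (F' := fun k x =>
        (iteratedFDerivWithin ℝ (m + 1) (timeDeriv j (w k) t) (OmegaBar n) x).curryLeft)
      (hsC m) (hsC (m + 1)) (hb m)
      (fun k x hx => (le_of_eq (ContinuousMultilinearMap.curryLeft_norm _)).trans
        (hb (m + 1) k x hx))
      (fun k x hx => hasFDerivWithinAt_iteratedFDerivWithin
        (((hw k).2 j (by exact_mod_cast hj)).1 t ht) m hx) hx
    exact hd.congr_fderiv hcl.symm

theorem iteratedFDerivWithin_timeDeriv_sumFun (hT : 0 < T) (hw : ∀ k, IsCkCinf J (w k))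
    (hs : ∀ m : ℕ, Summable fun k => tnorm (m : ℝ) J (w k)) (hj : j ≤ J)
    (ht : t ∈ Icc (0 : ℝ) T) (m : ℕ) (hx : x ∈ OmegaBar n) :
    iteratedFDerivWithin ℝ m (timeDeriv j (sumFun w) t) (OmegaBar n) x =
      ∑' k, iteratedFDerivWithin ℝ m (timeDeriv j (w k) t) (OmegaBar n) x :=
  ((hasFTaylorSeriesUpToOn_timeDeriv_sumFun hT hw hs hj
    ht).eq_iteratedFDerivWithin_of_uniqueDiffOn (by exact_mod_cast le_top)
    (uniqueDiffOn_omegaBar n) hx).symm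

theorem continuousOn_iteratedFDerivWithin_sumFun (hT : 0 < T) (hw : ∀ k, IsCkCinf J (w k))
    (hs : ∀ m : ℕ, Summable fun k => tnorm (m : ℝ) J (w k)) (hj : j ≤ J) (m : ℕ) :
    ContinuousOn (fun p : ℝ × Rn n =>
      iteratedFDerivWithin ℝ m (timeDeriv j (sumFun w) p.1) (OmegaBar n) p.2)
      (Icc (0 : ℝ) T ×ˢ OmegaBar n) := by
  obtain ⟨C, hC, h⟩ := exists_norm_iteratedFDerivWithin_le_holderNorm n m
  refine (continuousOn_tsum (fun k => ((hw k).2 j (by exact_mod_cast hj)).2 m)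
    ((hs m).mul_left C) fun k p hp =>
      (hw k).norm_iteratedFDerivWithin_le hC h hj hp.1 hp.2).congr fun p hp =>
    iteratedFDerivWithin_timeDeriv_sumFun hT hw hs hj hp.1 m hp.2

theorem isCkCinf_sumFun (hT : 0 < T) (hw : ∀ k, IsCkCinf J (w k))
    (hs : ∀ m : ℕ, Summable fun k => tnorm (m : ℝ) J (w k)) : IsCkCinf J (sumFun w) := by
  refine ⟨fun x hx => ?_, fun j hj => ?_⟩
  · refine contDiffOn_of_continuousOn_differentiableOn_deriv (fun m hm => ?_) fun m hm => ?_
    · have hm' : m ≤ J := by exact_mod_cast hm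
      have h1 := (continuousMultilinearCurryFin0 ℝ (Rn n) (Rn n)).continuous.comp_continuousOn
        (continuousOn_iteratedFDerivWithin_sumFun hT hw hs hm' 0)
      exact h1.comp (f := fun s : ℝ => (s, x)) (by fun_prop) fun s hs => ⟨hs, hx⟩
    · have hm' : m + 1 ≤ J := by exact_mod_cast hm
      intro t ht
      exact (hasDerivWithinAt_tsum_of_convex (convex_Icc (0 : ℝ) T)
        (F := fun k s => timeDeriv m (w k) s x) (F' := fun k s => timeDeriv (m + 1) (w k) s x)
        (hs 0) (hs 0) (fun k s hs => (hw k).norm_timeDeriv_le (by omega) hs hx)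
        (fun k s hs => (hw k).norm_timeDeriv_le hm' hs hx)
        (fun k s hs => (hw k).hasDerivWithinAt_timeDeriv hT (by exact_mod_cast hm') hs hx)
        ht).differentiableWithinAt.congr
        (fun s hs' => timeDeriv_sumFun hT hw hs (by omega) hs' hx)
        (timeDeriv_sumFun hT hw hs (by omega) ht hx)
  · have hj' : j ≤ J := by exact_mod_cast hj
    exact ⟨fun t ht => (hasFTaylorSeriesUpToOn_timeDeriv_sumFun hT hw hs hj' ht).contDiffOn,
      continuousOn_iteratedFDerivWithin_sumFun hT hw hs hj'⟩

theorem exists_tnorm_sumFun_le (n : ℕ) {T : ℝ} (hT : 0 < T) (J m : ℕ) :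
    ∃ C : ℝ, 0 ≤ C ∧ ∀ w : ℕ → Fun n T, (∀ k, IsCkCinf J (w k)) →
      (∀ m : ℕ, Summable fun k => tnorm (m : ℝ) J (w k)) →
      tnorm (m : ℝ) J (sumFun w) ≤
        C * ∑' k, (tnorm ((0 : ℕ) : ℝ) J (w k) + tnorm (m : ℝ) J (w k)) := by
  obtain ⟨C, hC, h⟩ := exists_norm_iteratedFDerivWithin_le_holderNorm n m
  obtain ⟨C', hC', h'⟩ := exists_holderNorm_nat_le n m
  refine ⟨(J + 1 : ℕ) * (C' * (1 + C)), by positivity, fun w hw hs => ?_⟩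
  set N := ∑' k, (tnorm ((0 : ℕ) : ℝ) J (w k) + tnorm (m : ℝ) J (w k)) with hN
  have hsN := (hs 0).add (hs m)
  have le1 : ∑' k, tnorm ((0 : ℕ) : ℝ) J (w k) ≤ N :=
    (hs 0).tsum_le_tsum (fun k => le_add_of_nonneg_right (tnorm_nonneg _ _ _)) hsN
  have le2 : ∑' k, tnorm (m : ℝ) J (w k) ≤ N :=
    (hs m).tsum_le_tsum (fun k => le_add_of_nonneg_left (tnorm_nonneg _ _ _)) hsN
  have hN0 : 0 ≤ N := tsum_nonneg fun k => add_nonneg (tnorm_nonneg _ _ _) (tnorm_nonneg _ _ _)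
  refine tnorm_le hT fun t ht => ?_
  have hj : ∀ j ∈ Finset.range (J + 1), holderNorm (m : ℝ) (timeDeriv j (sumFun w) t) ≤
      C' * ((1 + C) * N) := by
    intro j hj
    have hj : j ≤ J := Nat.lt_succ_iff.1 (Finset.mem_range.1 hj)
    have hu := isCkCinf_sumFun hT hw hs
    refine h' _ _ (by positivity) ((hu.2 j (by exact_mod_cast hj)).1 t ht) (fun x hx => ?_)
      fun x hx => ?_
    · rw [timeDeriv_sumFun hT hw hs hj ht hx]
      refine (tsum_of_norm_bounded (hs 0).hasSum fun k =>
        (hw k).norm_timeDeriv_le hj ht hx).trans (le1.trans ?_)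
      exact le_mul_of_one_le_left hN0 (by linarith)
    · rw [iteratedFDerivWithin_timeDeriv_sumFun hT hw hs hj ht m hx]
      refine (tsum_of_norm_bounded ((hs m).mul_left C).hasSum fun k =>
        (hw k).norm_iteratedFDerivWithin_le hC h hj ht hx).trans ?_
      rw [tsum_mul_left]
      exact (mul_le_mul_of_nonneg_left le2 hC).trans
        (mul_le_mul_of_nonneg_right (by linarith) hN0)
  refine (Finset.sum_le_card_nsmul _ _ _ hj).trans (le_of_eq ?_)
  rw [Finset.card_range, nsmul_eq_mul]
  ring

theorem sumFun_sub_sum (hw : ∀ k, IsCkCinf J (w k))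
    (hs : ∀ m : ℕ, Summable fun k => tnorm (m : ℝ) J (w k)) (K : ℕ) :
    sumFun w - ∑ k ∈ Finset.range K, w k = sumFun fun k => w (k + K) := by
  ext1 p
  have hp : Summable fun k => w k p := by
    refine Summable.of_norm_bounded (hs 0) fun k => ?_
    have := (hw k).norm_timeDeriv_le (Nat.zero_le J) p.1.2 p.2.2
    rwa [timeDeriv_zero, extend_of_mem _ p.1.2 p.2.2] at this
  rw [Pi.sub_apply, Finset.sum_apply]
  exact sub_eq_of_eq_add' (hp.sum_add_tsum_nat_add K).symm

theorem tendsto_tnorm_sumFun_sub (hT : 0 < T) (hw : ∀ k, IsCkCinf J (w k))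
    (hs : ∀ m : ℕ, Summable fun k => tnorm (m : ℝ) J (w k)) (m : ℕ) :
    Tendsto (fun K => tnorm (m : ℝ) J (sumFun w - ∑ k ∈ Finset.range K, w k)) atTop (𝓝 0) := by
  obtain ⟨C, hC, h⟩ := exists_tnorm_sumFun_le n hT J m
  have lim := (tendsto_sum_nat_add fun k =>
    tnorm ((0 : ℕ) : ℝ) J (w k) + tnorm (m : ℝ) J (w k)).const_mul C
  rw [mul_zero] at lim
  refine squeeze_zero (fun K => tnorm_nonneg _ _ _) (fun K => ?_) lim
  rw [sumFun_sub_sum hw hs K]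
  exact h _ (fun k => hw _) fun m => (summable_nat_add_iff K).2 (hs m)

/-- Convergence in every fractional Hölder norm. -/
theorem tendsto_tnorm_of_nat (hT : 0 < T) {v : ℕ → Fun n T} (hv : ∀ k, IsCkCinf J (v k))
    (h : ∀ m : ℕ, Tendsto (fun k => tnorm (m : ℝ) J (v k)) atTop (𝓝 0)) {a : ℝ} (ha : 0 ≤ a) :
    Tendsto (fun k => tnorm a J (v k)) atTop (𝓝 0) := by
  by_cases hm : a = (⌊a⌋₊ : ℝ)
  · rw [hm]; exact h _
  obtain ⟨C, -, hC⟩ := exists_tnorm_le_interp n hT J ⌊a⌋₊ a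
    ⟨lt_of_le_of_ne (Nat.floor_le ha) (Ne.symm hm), Nat.lt_floor_add_one a⟩
  have lim := ((h ⌊a⌋₊).add (h (⌊a⌋₊ + 1))).const_mul C
  rw [add_zero, mul_zero] at lim
  refine squeeze_zero (fun K => tnorm_nonneg _ _ _) (fun K => ?_) lim
  -- Here `R = 1` suffices, since both neighbouring integer norms tend to zero.
  have := hC (v K) 1 le_rfl (hv K)
  rwa [Real.one_rpow, Real.one_rpow, one_mul, one_mul] at this

end completeness
end NashMoser
end

/-! ### Instantiation of the iteration and passage to the limit. -/

noncomputable section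
namespace NashMoser

attribute [local irreducible] tnorm

section data
variable {n : ℕ} {T : ℝ}

theorem tnorm_zero_le_tnorm (hT : 0 < T) {a : ℝ} (ha : 0 ≤ a) {J : ℕ} {u : Fun n T}
    (hu : IsCkCinf J u) : tnorm 0 J u ≤ tnorm a J u := by
  rw [← one_mul (tnorm a J u)]
  refine tnorm_le_mul hT zero_le_one ha hu fun t ht j hj => ?_
  rw [one_mul]
  exact holderNorm_zero_le fun x hx =>
    norm_le_holderNorm a ((hu.2 j (by exact_mod_cast hj)).1 t ht) hx

theorem exists_tnorm_smoothFun_zero_le (n : ℕ) {T : ℝ} (hT : 0 < T) (m : ℕ) {a : ℝ}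
    (ha : 0 ≤ a) :
    ∃ C : ℝ, 0 ≤ C ∧ ∀ u : Fun n T, IsCkCinf ⊤ u →
      tnorm (m : ℝ) 0 (smoothFun 0 u) ≤ C * tnorm a 0 u := by
  obtain ⟨C, hC, h⟩ := exists_tnorm_smoothFun_le n hT 0 m 0 le_rfl (Nat.cast_nonneg m)
  refine ⟨C, hC, fun u hu => (h 0 u hu).trans (mul_le_mul_of_nonneg_left ?_ hC)⟩
  rw [Nat.cast_zero, zero_mul, Real.rpow_zero, one_mul]
  exact tnorm_zero_le_tnorm hT ha (hu.mono le_top)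

/-- The only place where a real order of the right-hand side enters the iteration: it is applied
with `a = α + l`. As in the abstract band estimate, orders above and below `a` use smoothing and
approximation respectively. -/
theorem exists_tnorm_smoothFun_diff_le (n : ℕ) {T : ℝ} (hT : 0 < T) (m : ℕ) {a : ℝ}
    (ha : 0 ≤ a) :
    ∃ C : ℝ, 0 ≤ C ∧ ∀ (k : ℕ) (u : Fun n T), IsCkCinf ⊤ u →
      tnorm (m : ℝ) 0 (smoothFun (k + 1) u - smoothFun k u) ≤
        C * (scale (k + 1) (m - a) * tnorm a 0 u) := by
  have hm : (0 : ℝ) ≤ m := Nat.cast_nonneg m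
  have hS : ∀ (k : ℕ) {u : Fun n T}, IsCkCinf ⊤ u → IsCkCinf (0 : ℕ) (smoothFun k u) :=
    fun k u hu => (hu.smoothFun hT k).mono le_top
  rcases le_total a m with h | h
  · obtain ⟨C, hC, h1⟩ := exists_tnorm_smoothFun_le n hT 0 m a ha h
    refine ⟨C + C * 2 ^ (-((m : ℝ) - a)), by positivity, fun k u hu => ?_⟩
    refine (tnorm_sub_le hT hm (hS (k + 1) hu) (hS k hu)).trans
      ((add_le_add (h1 _ u hu) (h1 k u hu)).trans (le_of_eq ?_))
    change C * (scale (k + 1) (m - a) * _) + C * (scale k (m - a) * _) = _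
    rw [TameData.scale_le_scale_succ k]
    ring
  · obtain ⟨C, hC, h1⟩ := exists_tnorm_sub_smoothFun_le n hT 0 m a h
    refine ⟨C + C * 2 ^ (-((m : ℝ) - a)), by positivity, fun k u hu => ?_⟩
    have hu0 : IsCkCinf (0 : ℕ) u := hu.mono le_top
    have e : smoothFun (k + 1) u - smoothFun k u =
        (u - smoothFun k u) - (u - smoothFun (k + 1) u) := by abel
    rw [e]
    refine (tnorm_sub_le hT hm (hu0.sub hT (hS k hu)) (hu0.sub hT (hS (k + 1) hu))).trans
      ((add_le_add (h1 _ u hu) (h1 _ u hu)).trans (le_of_eq ?_))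
    change C * (scale k (m - a) * _) + C * (scale (k + 1) (m - a) * _) = _
    rw [TameData.scale_le_scale_succ k]
    ring

/-- The Nash–Moser iteration for `Φ`. -/
def nashMoserData (hT : 0 < T) (μ l d : ℕ) (U : Set (Fun n T))
    (hball : ∀ u : Fun n T, IsCkCinf 2 u → tnorm (μ : ℝ) 2 u ≤ 1 → u ∈ U)
    (Φ : Fun n T → Fun n T)
    (hsmooth : ∀ u ∈ U, IsCkCinf ⊤ u → IsCkCinf ⊤ (Φ u))
    (Φ₁ : Fun n T → Fun n T →ₗ[ℝ] Fun n T)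
    (Φ₂ : Fun n T → Fun n T →ₗ[ℝ] Fun n T →ₗ[ℝ] Fun n T)
    (hdiff : IsTwiceDifferentiable Φ U Φ₁ Φ₂) (hH1 : TameSecondDerivative (μ : ℝ) Φ₂)
    (C : ℝ → ℝ) (ψ : Fun n T → Fun n T → Fun n T)
    (hψ : ∀ u : Fun n T, IsCkCinf ⊤ u → tnorm (μ : ℝ) 2 u ≤ 1 → ∀ g : Fun n T, IsCkCinf ⊤ g →
      IsCkCinf ⊤ (ψ u g) ∧ Φ₁ u (ψ u g) = g ∧ ∀ a : ℝ, 0 ≤ a →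
        tnorm a 2 (ψ u g) ≤
          C a * (tnorm (a + l) 0 g + tnorm (l : ℝ) 0 g * tnorm (a + d) 2 u))
    (hzero : Φ 0 = 0) (α : ℝ) (hαμ : μ < α) (hαd : d < α) (hαl : l + 2 * μ < α) :
    TameData (Fun n T) where
  X := ckCinf n hT ⊤
  P m := tnorm (m : ℝ) 2
  Q m := tnorm (m : ℝ) 0
  S := smoothFun
  N := tnorm (α + l) 0
  Φ := Φ
  D u v := Φ₁ u v
  ψ := ψ
  μ := μ
  l := l
  d := d
  α := α
  hμ := hαμ
  hd := hαd
  hl := hαl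
  P_nonneg _ _ := tnorm_nonneg _ _ _
  Q_nonneg _ _ := tnorm_nonneg _ _ _
  N_nonneg _ := tnorm_nonneg _ _ _
  P_zero _ := tnorm_zero_fun hT _ _
  Q_zero _ := tnorm_zero_fun hT _ _
  P_add m _ hu _ hv := tnorm_add_le hT (Nat.cast_nonneg m) (IsCkCinf.mono hu le_top)
    (IsCkCinf.mono hv le_top)
  Q_add m _ hu _ hv := tnorm_add_le hT (Nat.cast_nonneg m) (IsCkCinf.mono hu le_top)
    (IsCkCinf.mono hv le_top)
  Q_sub m _ hu _ hv := tnorm_sub_le hT (Nat.cast_nonneg m) (IsCkCinf.mono hu le_top)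
    (IsCkCinf.mono hv le_top)
  S_mem k _ hu := IsCkCinf.smoothFun hT k hu
  S_sub k _ hu _ hv := smoothFun_sub k hu hv
  P_smooth a b hab := exists_tnorm_smoothFun_le n hT 2 b a (Nat.cast_nonneg a)
    (Nat.cast_le.2 hab)
  P_approx a b hab := exists_tnorm_sub_smoothFun_le n hT 2 b a (Nat.cast_le.2 hab)
  Q_smooth a b hab := exists_tnorm_smoothFun_le n hT 0 b a (Nat.cast_nonneg a)
    (Nat.cast_le.2 hab)
  Q_approx a b hab := exists_tnorm_sub_smoothFun_le n hT 0 b a (Nat.cast_le.2 hab)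
  N_zero m := exists_tnorm_smoothFun_zero_le n hT m
    (add_nonneg ((Nat.cast_nonneg μ).trans hαμ.le) (Nat.cast_nonneg l))
  N_succ m := exists_tnorm_smoothFun_diff_le n hT m
    (add_nonneg ((Nat.cast_nonneg μ).trans hαμ.le) (Nat.cast_nonneg l))
  Φ_zero := hzero
  Φ_mem u hu h := hsmooth u (hball u (IsCkCinf.mono hu le_top) h) hu
  ψ_mem v hv h g hg := (hψ v hv h g hg).1
  D_ψ v hv h g hg := (hψ v hv h g hg).2.1
  ψ_le a := by
    refine ⟨max (C a) 0, le_max_right _ _, fun v hv h g hg => ?_⟩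
    rw [Nat.cast_add, Nat.cast_add]
    exact ((hψ v hv h g hg).2.2 a (Nat.cast_nonneg a)).trans (mul_le_mul_of_nonneg_right
      (le_max_left _ _) (add_nonneg (tnorm_nonneg _ _ _)
        (mul_nonneg (tnorm_nonneg _ _ _) (tnorm_nonneg _ _ _))))
  err a := by
    rw [Nat.cast_add]
    obtain ⟨K, hK, h⟩ := exists_tnorm_error_le hT (Nat.cast_nonneg μ) hball hsmooth hdiff hH1
      (Nat.cast_nonneg a)
    exact ⟨K, hK, fun u hu v hv w hw => h u v w hu hv hw⟩

end data

section limit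
variable {n : ℕ} {T : ℝ}

theorem exists_tnorm_le_scale (n : ℕ) {T : ℝ} (hT : 0 < T) (J : ℕ) {a : ℝ} (ha : 0 ≤ a) (α : ℝ)
    {C : ℕ → ℝ} (hC : ∀ m, 0 ≤ C m) :
    ∃ K : ℝ, 0 ≤ K ∧ ∀ (w : ℕ → Fun n T) (N : ℝ), 0 ≤ N → (∀ k, IsCkCinf J (w k)) →
      (∀ (m k : ℕ), tnorm (m : ℝ) J (w k) ≤ C m * (N * scale k (m - α))) →
      ∀ k, tnorm a J (w k) ≤ K * (N * scale k (a - α)) := by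
  by_cases hm : a = (⌊a⌋₊ : ℝ)
  · refine ⟨C ⌊a⌋₊, hC _, fun w N hN hw h k => ?_⟩
    rw [hm, Nat.floor_natCast]
    exact h _ k
  obtain ⟨B, hB, h1⟩ := exists_tnorm_le_interp n hT J ⌊a⌋₊ a
    ⟨lt_of_le_of_ne (Nat.floor_le ha) (Ne.symm hm), Nat.lt_floor_add_one a⟩
  have c1 := hC ⌊a⌋₊
  have c2 := hC (⌊a⌋₊ + 1)
  refine ⟨B * (C ⌊a⌋₊ + C (⌊a⌋₊ + 1)), by positivity, fun w N hN hw h k => ?_⟩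
  have hR : ∀ x : ℝ, scale k 1 ^ x = scale k x := fun x => by
    rw [scale, scale, mul_one, Real.rpow_mul two_pos.le]
  -- The choice `R = 2^k` balances the interpolation: both terms become multiples of `2^{k(a-α)}`.
  have key := h1 (w k) (scale k 1) (one_le_scale k zero_le_one) (hw k)
  rw [hR, hR] at key
  have p1 := (scale_pos k (a - ⌊a⌋₊)).le
  have p2 := (scale_pos k (a - (⌊a⌋₊ + 1))).le
  refine key.trans ?_
  calc _ ≤ B * (scale k (a - ⌊a⌋₊) * (C ⌊a⌋₊ * (N * scale k (⌊a⌋₊ - α))) +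
        scale k (a - (⌊a⌋₊ + 1)) *
          (C (⌊a⌋₊ + 1) * (N * scale k (((⌊a⌋₊ + 1 : ℕ) : ℝ) - α)))) := by
        gcongr
        · exact h _ k
        · exact h _ k
    _ = B * (C ⌊a⌋₊ * (N * (scale k (a - ⌊a⌋₊) * scale k (⌊a⌋₊ - α))) +
        C (⌊a⌋₊ + 1) *
          (N * (scale k (a - (⌊a⌋₊ + 1)) * scale k (((⌊a⌋₊ + 1 : ℕ) : ℝ) - α)))) := by ring
    _ = _ := by
        rw [← scale_add, ← scale_add,
          show a - (⌊a⌋₊ : ℝ) + (⌊a⌋₊ - α) = a - α by ring,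
          show a - ((⌊a⌋₊ : ℝ) + 1) + (((⌊a⌋₊ + 1 : ℕ) : ℝ) - α) = a - α by push_cast; ring]
        ring

theorem tnorm_sum_le (hT : 0 < T) {a : ℝ} (ha : 0 ≤ a) {J : ℕ} {w : ℕ → Fun n T}
    (hw : ∀ k, IsCkCinf J (w k)) (K : ℕ) :
    tnorm a J (∑ k ∈ Finset.range K, w k) ≤ ∑ k ∈ Finset.range K, tnorm a J (w k) := by
  induction K with
  | zero => simp [tnorm_zero_fun hT]
  | succ K ih =>
    rw [Finset.sum_range_succ, Finset.sum_range_succ]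
    refine (tnorm_add_le hT ha ?_ (hw K)).trans (add_le_add ih le_rfl)
    exact (ckCinf n hT J).sum_mem fun k _ => hw k

theorem tnorm_le_of_tendsto (hT : 0 < T) {a B : ℝ} (ha : 0 ≤ a) {J : ℕ} {u : Fun n T}
    {v : ℕ → Fun n T} (hu : IsCkCinf J u) (hv : ∀ k, IsCkCinf J (v k))
    (h : Tendsto (fun k => tnorm a J (u - v k)) atTop (𝓝 0)) (hB : ∀ k, tnorm a J (v k) ≤ B) :
    tnorm a J u ≤ B := by
  have lim := h.const_add B
  rw [add_zero] at lim
  refine ge_of_tendsto' lim fun k => ?_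
  have := tnorm_add_le hT ha (hv k) (hu.sub hT (hv k))
  rw [add_sub_cancel] at this
  exact this.trans (add_le_add (hB k) le_rfl)

theorem eq_of_tnorm_sub_le (hT : 0 < T) {u v : Fun n T} (hu : IsCkCinf 0 u) (hv : IsCkCinf 0 v)
    (h : tnorm 0 0 (u - v) ≤ 0) : u = v := by
  ext1 p
  have hs : IsCkCinf (0 : ℕ) (u - v) := hu.sub hT hv
  have h1 := (hs.norm_timeDeriv_le le_rfl p.1.2 p.2.2).trans_eq (by rw [Nat.cast_zero])
  rw [timeDeriv_zero, extend_of_mem _ p.1.2 p.2.2] at h1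
  exact sub_eq_zero.1 (norm_le_zero_iff.1 (h1.trans h))

end limit

theorem exists_solution {n : ℕ} {T : ℝ} (hT : 0 < T) (μ l d : ℕ) (U : Set (Fun n T))
    (hball : ∀ u : Fun n T, IsCkCinf 2 u → tnorm (μ : ℝ) 2 u ≤ 1 → u ∈ U)
    (Φ : Fun n T → Fun n T) (hcont : ContinuousC2C0 Φ U)
    (hsmooth : ∀ u ∈ U, IsCkCinf ⊤ u → IsCkCinf ⊤ (Φ u))
    (Φ₁ : Fun n T → Fun n T →ₗ[ℝ] Fun n T)
    (Φ₂ : Fun n T → Fun n T →ₗ[ℝ] Fun n T →ₗ[ℝ] Fun n T)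
    (hdiff : IsTwiceDifferentiable Φ U Φ₁ Φ₂) (hH1 : TameSecondDerivative (μ : ℝ) Φ₂)
    (hH2 : TameRightInverse (μ : ℝ) l d Φ₁) (hzero : Φ 0 = 0)
    (α : ℝ) (hαμ : μ < α) (hαd : d < α) (hαl : l + 2 * μ < α) :
    ∃ δ : ℝ, 0 < δ ∧ ∃ C : ℝ → ℝ, ∀ f : Fun n T, IsCkCinf ⊤ f → tnorm (α + l) 0 f ≤ δ →
      ∃ u : Fun n T, IsCkCinf 2 u ∧ u ∈ U ∧ Φ u = f ∧
        ∀ a : ℝ, 0 ≤ a → a < α → tnorm a 2 u ≤ C a * tnorm (α + l) 0 f := by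
  obtain ⟨B, hB⟩ := hH2
  -- The right inverse is extended by zero to inadmissible base points, to obtain a total function;
  -- the iteration meets admissible ones only.
  have hex : ∀ u : Fun n T, ∃ ψ : Fun n T → Fun n T, IsCkCinf ⊤ u → tnorm (μ : ℝ) 2 u ≤ 1 →
      ∀ g : Fun n T, IsCkCinf ⊤ g → IsCkCinf ⊤ (ψ g) ∧ Φ₁ u (ψ g) = g ∧ ∀ a : ℝ, 0 ≤ a →
        tnorm a 2 (ψ g) ≤ B a * (tnorm (a + l) 0 g + tnorm (l : ℝ) 0 g * tnorm (a + d) 2 u) := by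
    intro u
    by_cases h : IsCkCinf ⊤ u ∧ tnorm (μ : ℝ) 2 u ≤ 1
    · obtain ⟨ψ, hψ⟩ := hB u h.1 h.2
      exact ⟨ψ, fun _ _ => hψ⟩
    · exact ⟨fun _ => 0, fun h1 h2 => absurd ⟨h1, h2⟩ h⟩
  choose ψ hψ using hex
  set t := nashMoserData hT μ l d U hball Φ hsmooth Φ₁ Φ₂ hdiff hH1 B ψ hψ hzero α hαμ hαd hαl
  obtain ⟨δ, hδ, C, hC, hit⟩ := t.exists_iteration
  -- The constant for each `a < α` is fixed before `f` is given, from the rate `2^{k(a-α)}` and a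
  -- convergent geometric series. The value outside `[0, α)` is immaterial.
  have hK : ∀ a : ℝ, ∃ K : ℝ, 0 ≤ a → a < α → ∀ (w : ℕ → Fun n T) (N : ℝ), 0 ≤ N →
      (∀ k, IsCkCinf (2 : ℕ) (w k)) →
      (∀ (m k : ℕ), tnorm (m : ℝ) 2 (w k) ≤ C m * (N * scale k (m - α))) →
      ∀ k, tnorm a 2 (∑ j ∈ Finset.range k, w j) ≤ K * N := by
    intro a
    by_cases h : 0 ≤ a ∧ a < α
    · obtain ⟨K, hK, h1⟩ := exists_tnorm_le_scale n hT 2 h.1 α hC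
      obtain ⟨c, hc, h2⟩ := exists_sum_scale_le_of_neg (x := a - α) (by linarith [h.2])
      refine ⟨K * c, fun _ _ w N hN hw hb k => ?_⟩
      refine (tnorm_sum_le hT h.1 hw k).trans ?_
      refine (Finset.sum_le_sum fun j _ => h1 w N hN hw hb j).trans ?_
      rw [← Finset.mul_sum, ← Finset.mul_sum, mul_assoc, mul_comm c]
      exact mul_le_mul_of_nonneg_left (mul_le_mul_of_nonneg_left (h2 k) hN) hK
    · exact ⟨0, fun h1 h2 => absurd ⟨h1, h2⟩ h⟩
  choose K hK using hK
  refine ⟨δ, hδ, K, fun f hf hfδ => ?_⟩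
  obtain ⟨hwX, hwb, hws, huh, hres⟩ := hit f hf hfδ
  have hw : ∀ k, IsCkCinf ⊤ (t.w f k) := hwX
  have hw2 : ∀ k, IsCkCinf (2 : ℕ) (t.w f k) := fun k => (hw k).mono le_top
  have hs : ∀ m : ℕ, Summable fun k => tnorm (m : ℝ) 2 (t.w f k) := hws
  have hu2 : IsCkCinf (2 : ℕ) (sumFun (t.w f)) := isCkCinf_sumFun hT hw2 hs
  have hv : ∀ k, IsCkCinf ⊤ (∑ j ∈ Finset.range k, t.w f j) := fun k =>
    (ckCinf n hT ⊤).sum_mem fun j _ => hw j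
  have hv2 : ∀ k, IsCkCinf (2 : ℕ) (∑ j ∈ Finset.range k, t.w f j) := fun k =>
    (hv k).mono le_top
  have lim : ∀ a : ℝ, 0 ≤ a → Tendsto (fun k =>
      tnorm a 2 (sumFun (t.w f) - ∑ j ∈ Finset.range k, t.w f j)) atTop (𝓝 0) := fun a ha =>
    tendsto_tnorm_of_nat hT (fun k => hu2.sub hT (hv2 k))
      (tendsto_tnorm_sumFun_sub hT hw2 hs) ha
  have hvμ : ∀ k, tnorm (μ : ℝ) 2 (∑ j ∈ Finset.range k, t.w f j) ≤ 1 := fun k => by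
    have := huh k
    rw [t.u_eq_sum] at this
    exact le_trans this (by norm_num)
  have hvU : ∀ k, ∑ j ∈ Finset.range k, t.w f j ∈ U := fun k => hball _ (hv2 k) (hvμ k)
  -- The bound of order `μ` passes to the limit, so the limit is in the closed unit ball and hence
  -- in `U`.
  have huU : sumFun (t.w f) ∈ U := hball _ hu2
    (tnorm_le_of_tendsto hT (Nat.cast_nonneg μ) hu2 hv2 (lim μ (Nat.cast_nonneg μ)) hvμ)
  refine ⟨sumFun (t.w f), hu2, huU, ?_, fun a ha haα => ?_⟩
  · have hf0 : IsCkCinf (0 : ℕ) f := hf.mono le_top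
    have hΦu : IsCkCinf (0 : ℕ) (Φ (sumFun (t.w f))) := hcont.1 _ huU
    have hΦv : ∀ k, IsCkCinf (0 : ℕ) (Φ (∑ j ∈ Finset.range k, t.w f j)) := fun k =>
      hcont.1 _ (hvU k)
    have hres' : Tendsto (fun k => tnorm 0 0 (Φ (∑ j ∈ Finset.range k, t.w f j) - f)) atTop
        (𝓝 0) := by
      refine hres.congr fun k => ?_
      rw [t.u_eq_sum]
      change tnorm ((0 : ℕ) : ℝ) 0 _ = _
      rw [Nat.cast_zero]
      rfl
    refine eq_of_tnorm_sub_le hT hΦu hf0 (le_of_forall_pos_le_add fun ε hε => ?_)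
    -- Continuity may require closeness in a norm of arbitrarily high order `b`. This is why
    -- convergence in every norm was established, not only below `α`.
    obtain ⟨b, hb, η, hη, hcon⟩ := hcont.2 _ huU 0 le_rfl (ε / 2) (by positivity)
    obtain ⟨k, hk1, hk2⟩ := (((lim b hb).eventually (gt_mem_nhds hη)).and
      (hres'.eventually (gt_mem_nhds (half_pos hε)))).exists
    rw [tnorm_sub_comm hT b hu2 (hv2 k)] at hk1
    have h1 := hcon _ (hvU k) hk1
    have h2 := tnorm_sub_le hT le_rfl ((hΦv k).sub hT hf0) ((hΦv k).sub hT hΦu)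
    rw [sub_sub_sub_cancel_left] at h2
    linarith
  · exact tnorm_le_of_tendsto hT ha hu2 hv2 (lim a ha) (hK a ha haα _ _ (tnorm_nonneg _ _ _)
      hw2 hwb)

end NashMoser
end

theorem proposition18p1 (n : ℕ) (T : ℝ) (hT : 0 < T)
    (μ lam d : ℝ) (hμ : μ = 5) (hlam : lam = ((n / 2 : ℕ) : ℝ) + 3)
    (hd : d = ((n / 2 : ℕ) : ℝ) + 7)
    -- the domain of the map: an open set that contains the unit ball of `|||·|||_{μ,2}`
    (U : Set (NashMoser.Fun n T)) (hU : NashMoser.IsOpenC2 U)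
    (hball : ∀ u : NashMoser.Fun n T,
      NashMoser.IsCkCinf 2 u → NashMoser.tnorm μ 2 u ≤ 1 → u ∈ U)
    (Φ : NashMoser.Fun n T → NashMoser.Fun n T)
    (hcont : NashMoser.ContinuousC2C0 Φ U)
    (hsmooth : ∀ u ∈ U, NashMoser.IsCkCinf ⊤ u → NashMoser.IsCkCinf ⊤ (Φ u))
    (Φ₁ : NashMoser.Fun n T → NashMoser.Fun n T →ₗ[ℝ] NashMoser.Fun n T)
    (Φ₂ : NashMoser.Fun n T →
      NashMoser.Fun n T →ₗ[ℝ] NashMoser.Fun n T →ₗ[ℝ] NashMoser.Fun n T)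
    (hdiff : NashMoser.IsTwiceDifferentiable Φ U Φ₁ Φ₂)
    (hH1 : NashMoser.TameSecondDerivative μ Φ₂)
    (hH2 : NashMoser.TameRightInverse μ lam d Φ₁)
    (hzero : Φ 0 = 0)
    (α : ℝ) (hαμ : μ < α) (hαd : d < α) (hαlam : lam + 2 * μ < α)
    (hαN : ∀ m : ℕ, α ≠ (m : ℝ)) :
    ∃ δ : ℝ, 0 < δ ∧ ∃ C : ℝ → ℝ, ∀ f : NashMoser.Fun n T,
      NashMoser.IsCkCinf ⊤ f → NashMoser.tnorm (α + lam) 0 f ≤ δ ^ 2 →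
      ∃ u : NashMoser.Fun n T, NashMoser.IsCkCinf 2 u ∧ u ∈ U ∧ Φ u = f ∧
        ∀ a : ℝ, 0 ≤ a → a < α →
          NashMoser.tnorm a 2 u ≤ C a * NashMoser.tnorm (α + lam) 0 f := by
  obtain rfl : μ = ((5 : ℕ) : ℝ) := by rw [hμ]; norm_num
  obtain rfl : lam = ((n / 2 + 3 : ℕ) : ℝ) := by rw [hlam]; push_cast; rfl
  obtain rfl : d = ((n / 2 + 7 : ℕ) : ℝ) := by rw [hd]; push_cast; rfl
  obtain ⟨δ, hδ, C, h⟩ := NashMoser.exists_solution hT 5 (n / 2 + 3) (n / 2 + 7) U hball Φ hcont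
    hsmooth Φ₁ Φ₂ hdiff hH1 hH2 hzero α hαμ hαd hαlam
  -- The smallness condition is phrased with `δ ^ 2`, hence the square root.
  exact ⟨√δ, Real.sqrt_pos.2 hδ, C, fun f hf hfδ => h f hf (by rwa [Real.sq_sqrt hδ.le] at hfδ)⟩
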